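/- **Setting.** Let $\mathcal A$ be a finite alphabet with $d\ge 2$ letters, let $\pi_0,\pi_1:\mathcal A\to\{1,\dots,d\}$ be bijections that are admissible ($\pi_0^{-1}\{1,\dots,k\}\neq\pi_1^{-1}\{1,\dots,k\}$ for $1\le k<d$), and let $\lambda_\alpha>0$ ($\alpha\in\mathcal A$). Put $I_\alpha=[0,\lambda_\alpha)\times\{\alpha\}$, $I=[0,\sum_\alpha\lambda_\alpha)$, $j_\varepsilon(x,\alpha)=x+\sum_{\pi_\varepsilon(\beta)<\pi_\varepsilon(\alpha)}\lambda_\beta$, and let $T=j_1\circ j_0^{-1}:I\to I$ be the associated interval exchange map. Norms of matrices and vectors are any fixed norms. *Algorithm.* $T$ has the Keane property if $T^m(j_0(0,\alpha))\ne j_0(0,\beta)$ for all $m\ge1$ and all $\alpha,\beta$ with $\pi_0(\beta)>1$. Let $\alpha_0,\alpha_1$ be the letters with $\pi_0(\alpha_0)=\pi_1(\alpha_1)=d$. A Rauzy–Veech step takes $\varepsilon$ with $\lambda_{\alpha_\varepsilon}>\lambda_{\alpha_{1-\varepsilon}}$, has name $\alpha_\varepsilon$, replaces $\lambda_{\alpha_\varepsilon}$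 by $\lambda_{\alpha_\varepsilon}-\lambda_{\alpha_{1-\varepsilon}}$, keeps $\pi_\varepsilon$, and changes $\pi_{1-\varepsilon}$ by moving its last letter to the place just after $\alpha_\varepsilon$; its matrix is $V=\mathbf 1+E_{\alpha_\varepsilon\alpha_{1-\varepsilon}}$. Let $V^{(n)}$ be the matrix of the $n$-th step ($n\ge1$), $n(0)=0$, and let $n(k+1)$ be the largest integer $N$ such that the steps $n$ with $n(k)<n\le N$ take at most $d-1$ names. Put $Z(k)=V^{(n(k-1)+1)}\cdots V^{(n(k))}$, $Q(k,l)=Z(k+1)\cdots Z(l)$, $Q(k)=Q(0,k)$, and let $S(k,l)$ be the operator on $\mathbb R^{\mathcal A}$ with matrix ${}^tQ(k,l)$. Let $\Gamma_s^{(k)}$ be the subspace of all $v\in\mathbb R^{\mathcal A}$ for which there are $\sigma,C>0$ with $\|S(k,l)v\|\le C\|S(k,l)\|^{-\sigma}\|v\|$ for all $l\ge k$, and let $S_\flat(k,l):\mathbb R^{\mathcal A}/\Gamma_s^{(k)}\to\mathbb R^{\mathcal A}/\Gamma_s^{(l)}$ be the bijection induced by $S(k,l)$. $T$ is of *Roth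 type* if it has the Keane property and (a) for every $\epsilon>0$ there is $C>0$ with $\|Z(k+1)\|\le C\|Q(k)\|^{\epsilon}$ for all $k\ge0$; (b) there are $\theta,C>0$ such that for all $k\ge 0$ the restriction of $S(0,k)$ to $\{v:\sum_\alpha\lambda_\alpha v_\alpha=0\}$ has norm at most $C\|Q(k)\|^{1-\theta}$; (c) for every $\epsilon>0$ there is $C>0$ such that $\|S_\flat(k,l)^{-1}\|\le C\|Q(l)\|^{\epsilon}$ and $\|S(k,l)|_{\Gamma_s^{(k)}}\|\le C\|Q(l)\|^{\epsilon}$ for all $l\ge k\ge0$. *Spaces.* For $r\ge1$, $BV^r_*(I)$ is the space of functions $\Phi:I\to\mathbb R$ such that on each $j_0(I_\alpha)$ $\Phi$ is of class $C^{r-1}$, $D^{r-1}\Phi$ is absolutely continuous and $D^r\Phi$ is of bounded variation, and such that $D^l\Phi$ has mean value $0$ on $I$ for $0<l\le r$. The space $C^{r-2+\mathrm{Lip}}(I)$ is the space of bounded functions if $r=1$, and, if $r\ge2$, the space of functions that are $C^{r-2}$ on all of $I$ with $D^{r-2}\Psi$ Lipschitz on $I$. Let $\Gamma_*(r)$ be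 the space of those $\chi\in BV^r_*(I)$ whose restriction to each $j_0(I_\alpha)$ is a polynomial of degree $<r$, and let $\Gamma_T(r)=\{\chi\in\Gamma_*(r):\chi=\psi\circ T-\psi\text{ for some }\psi\in C^{r-2+\mathrm{Lip}}(I)\}$. Let $\Gamma_T$ be the space of functions that are constant on each $j_0(I_\alpha)$ and of the form $\psi-\psi\circ T$ with $\psi$ bounded. **Theorem.** Let $T$ be an interval exchange map of Roth type (with admissible combinatorial data and $d\ge2$) and let $r\ge1$ be an integer. 1. For every $\Phi\in BV^r_*(I)$ there are $\chi\in\Gamma_*(r)$ and $\Psi\in C^{r-2+\mathrm{Lip}}(I)$ with $\Phi=\chi+\Psi\circ T-\Psi$. 2. The class of $\chi$ modulo $\Gamma_T(r)$ is determined by $\Phi$: there is a unique linear map (the obstruction map) $\mathrm{Ob}:BV^r_*(I)\to\Gamma_*(r)/\Gamma_T(r)$ such that, for $\Phi\in BV^r_*(I)$ and $\chi\in\Gamma_*(r)$, one has $\mathrm{Ob}(\Phi)=[\chi]$ if and only if $\Phi=\chi+\Psi\circ T-\Psi$ for some $\Psi\in C^{r-2+\mathrm{Lip}}(I)$. 3.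 $\Gamma_T(r)$ is finite-dimensional and $\dim\Gamma_T(r)=\dim\Gamma_T+r-1$. -/

import Mathlib

open MeasureTheory Set
open scoped Matrix

noncomputable section

namespace IntervalExchange

/-! ### Interval exchange maps -/

/-- Data of an interval exchange map on the alphabet `A`, with `d = card A`: two bijections from `A`
onto the positions `0, …, d - 1` (the order of the intervals before and after the exchange), and
the positive lengths of the intervals. -/
structure Data (A : Type*) [Fintype A] where
  /-- The order of the intervals before the exchange. -/
  top : A ≃ Fin (Fintype.card A)
  /-- The order of the intervals after the exchange. -/
  bot : A ≃ Fin (Fintype.card A)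
  /-- The lengths of the intervals. -/
  len : A → ℝ
  len_pos : ∀ a, 0 < len a

section Geometry

variable {A : Type*} [Fintype A]

/-- The left endpoint of the interval named `a`, when the intervals are put in the order `p`. -/
def offset (p : A ≃ Fin (Fintype.card A)) (len : A → ℝ) (a : A) : ℝ :=
  ∑ b with p b < p a, len b

theorem offset_nonneg (p : A ≃ Fin (Fintype.card A)) {len : A → ℝ} (h : ∀ a, 0 < len a) (a : A) :
    0 ≤ offset p len a :=
  Finset.sum_nonneg fun b _ => (h b).le

theorem offset_add_len (p : A ≃ Fin (Fintype.card A)) (len : A → ℝ) (a : A) :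
    offset p len a + len a = ∑ b with p b ≤ p a, len b := by
  classical
  have : (Finset.univ.filter fun b => p b ≤ p a)
      = insert a (Finset.univ.filter fun b => p b < p a) := by
    ext b
    simp only [Finset.mem_filter, Finset.mem_univ, true_and, Finset.mem_insert]
    rw [le_iff_eq_or_lt, p.injective.eq_iff]
  rw [this, Finset.sum_insert (by simp), offset, add_comm]

theorem offset_add_len_le_total (p : A ≃ Fin (Fintype.card A)) {len : A → ℝ}
    (h : ∀ a, 0 < len a) (a : A) : offset p len a + len a ≤ ∑ b, len b := by
  rw [offset_add_len]
  exact Finset.sum_le_sum_of_subset_of_nonneg (Finset.filter_subset _ _) fun b _ _ => (h b).le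

theorem offset_add_len_le (p : A ≃ Fin (Fintype.card A)) {len : A → ℝ}
    (h : ∀ a, 0 < len a) {a b : A} (hab : p a < p b) :
    offset p len a + len a ≤ offset p len b := by
  rw [offset_add_len]
  refine Finset.sum_le_sum_of_subset_of_nonneg (fun c hc => ?_) fun b _ _ => (h b).le
  simp only [Finset.mem_filter, Finset.mem_univ, true_and] at hc ⊢
  exact hc.trans_lt hab

/-- The translation `(x, a) ↦ x + offset a` of the disjoint union of the intervals `[0, len a)` to
the interval `[0, ∑ len)`. -/
def place (p : A ≃ Fin (Fintype.card A)) (len : A → ℝ) (h : ∀ a, 0 < len a) :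
    (Σ a, Ico (0 : ℝ) (len a)) → Ico (0 : ℝ) (∑ a, len a) :=
  fun x => ⟨offset p len x.1 + x.2, by
    have h1 := offset_nonneg p h x.1
    have h2 := offset_add_len_le_total p h x.1
    have h3 := x.2.2.1
    have h4 := x.2.2.2
    constructor <;> linarith⟩

theorem place_bijective (p : A ≃ Fin (Fintype.card A)) (len : A → ℝ) (h : ∀ a, 0 < len a) :
    Function.Bijective (place p len h) := by
  classical
  constructor
  · rintro ⟨a, x, hx⟩ ⟨b, y, hy⟩ hxy
    have hxy' : offset p len a + x = offset p len b + y := congrArg Subtype.val hxy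
    rcases lt_trichotomy (p a) (p b) with hab | hab | hab
    · have := offset_add_len_le p h hab
      have := hx.2
      have := hy.1
      linarith
    · obtain rfl := p.injective hab
      have : x = y := by linarith
      subst this
      rfl
    · have := offset_add_len_le p h hab
      have := hy.2
      have := hx.1
      linarith
  · rintro ⟨y, hy0, hy1⟩
    set s : Finset A := Finset.univ.filter fun a => offset p len a ≤ y with hs
    have hA : 0 < Fintype.card A := by
      rw [Fintype.card_pos_iff]
      by_contra hA
      rw [not_nonempty_iff] at hA
      simp at hy1
      linarith
    have hne : s.Nonempty := by
      refine ⟨p.symm ⟨0, hA⟩, ?_⟩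
      simp only [hs, Finset.mem_filter, Finset.mem_univ, true_and]
      refine le_trans (le_of_eq ?_) hy0
      unfold offset
      refine Finset.sum_eq_zero fun b hb => ?_
      simp [Fin.lt_def] at hb
    obtain ⟨a, ha, hmax⟩ := s.exists_max_image p hne
    have ha' : offset p len a ≤ y := by simpa [hs] using ha
    have hlt : y < offset p len a + len a := by
      by_cases hlast : (p a : ℕ) + 1 < Fintype.card A
      · set b := p.symm ⟨p a + 1, hlast⟩ with hb
        have hpb : (p b : ℕ) = p a + 1 := by simp [hb]
        have hbs : b ∉ s := fun hbs => by
          have := Fin.le_def.1 (hmax b hbs)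
          omega
        have hby : y < offset p len b := by simpa [hs] using hbs
        refine hby.trans_le (le_of_eq ?_)
        rw [offset_add_len, offset]
        refine Finset.sum_congr ?_ fun _ _ => rfl
        ext c
        simp only [Finset.mem_filter, Finset.mem_univ, true_and, Fin.lt_def, Fin.le_def]
        omega
      · refine hy1.trans_le (le_of_eq ?_)
        rw [offset_add_len]
        refine (Finset.sum_congr ?_ fun _ _ => rfl)
        ext c
        simp only [Finset.mem_filter, Finset.mem_univ, true_and, true_iff, Fin.le_def]
        have := (p c).2
        omega
    exact ⟨⟨a, y - offset p len a, by linarith, by linarith⟩, Subtype.ext (by simp [place])⟩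

/-- The bijection from `⊔ₐ [0, len a)` onto `[0, ∑ len)` in the order `p`. -/
def placeEquiv (p : A ≃ Fin (Fintype.card A)) (len : A → ℝ) (h : ∀ a, 0 < len a) :
    (Σ a, Ico (0 : ℝ) (len a)) ≃ Ico (0 : ℝ) (∑ a, len a) :=
  Equiv.ofBijective (place p len h) (place_bijective p len h)

namespace Data

variable (D : Data A)

/-- The total length. -/
def total : ℝ := ∑ a, D.len a

/-- The interval `I = [0, total)` on which the interval exchange map acts. -/
abbrev Dom : Type := Ico (0 : ℝ) D.total

/-- The bijection `j₀` from the disjoint union of the intervals onto `I`. -/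
def j₀ : (Σ a, Ico (0 : ℝ) (D.len a)) ≃ D.Dom := placeEquiv D.top D.len D.len_pos

/-- The bijection `j₁` from the disjoint union of the intervals onto `I`. -/
def j₁ : (Σ a, Ico (0 : ℝ) (D.len a)) ≃ D.Dom := placeEquiv D.bot D.len D.len_pos

/-- The interval exchange map `T = j₁ ∘ j₀⁻¹`. -/
def T : D.Dom ≃ D.Dom := D.j₀.symm.trans D.j₁

/-- The left endpoint `j₀(0, a)`, as a real number. -/
def left (a : A) : ℝ := offset D.top D.len a

/-- The interval `j₀(Iₐ) = [left a, left a + len a)`, as a set of real numbers. -/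
def piece (a : A) : Set ℝ := Ico (D.left a) (D.left a + D.len a)

/-- Admissible combinatorial data: for `0 < k < d`, the first `k` intervals before the exchange are
not the first `k` intervals after the exchange. -/
def Admissible : Prop :=
  ∀ k : ℕ, 0 < k → k < Fintype.card A → {a | (D.top a : ℕ) < k} ≠ {a | (D.bot a : ℕ) < k}

/-- The Keane property: there is no connexion `(a, b, m)`, where `m > 0`, where `b` is not the
first interval before the exchange, and `Tᵐ (j₀(0, a)) = j₀(0, b)`. -/
def Keane : Prop :=
  ¬ ∃ (a b : A) (m : ℕ), 0 < (D.top b : ℕ) ∧ 0 < m ∧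
    D.T^[m] (D.j₀ ⟨a, 0, left_mem_Ico.2 (D.len_pos a)⟩)
      = D.j₀ ⟨b, 0, left_mem_Ico.2 (D.len_pos b)⟩

end Data

end Geometry

/-! ### The continued fraction algorithm -/

section Algorithm

/-- The permutation of positions in a Rauzy move: positions up to `j` are fixed, the last
position is sent to `j + 1`, and the positions strictly between are shifted by one. -/
def rauzyFun {d : ℕ} (j i : Fin d) : Fin d :=
  if hj : i ≤ j then i
  else if hi : (i : ℕ) + 1 < d then ⟨i + 1, hi⟩
  else ⟨j + 1, by rw [Fin.le_def] at hj; omega⟩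

theorem rauzyFun_injective {d : ℕ} (j : Fin d) : Function.Injective (rauzyFun j) := by
  intro a b hab
  unfold rauzyFun at hab
  have := a.2
  have := b.2
  split_ifs at hab with h1 h2 h3 h4 h5 h6 h7 h8 <;> simp only [Fin.ext_iff, Fin.le_def] at * <;> omega

/-- `rauzyFun j` as a permutation. -/
def rauzyPerm {d : ℕ} (j : Fin d) : Equiv.Perm (Fin d) :=
  Equiv.ofBijective (rauzyFun j) (Finite.injective_iff_bijective.1 (rauzyFun_injective j))

set_option linter.unusedSectionVars false

variable {A : Type*} [Fintype A] [Nonempty A]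

/-- The letter in the last position. -/
def lastLetter (p : A ≃ Fin (Fintype.card A)) : A :=
  p.symm ⟨Fintype.card A - 1, Nat.sub_lt Fintype.card_pos one_pos⟩

variable [DecidableEq A]

namespace Data

variable (D : Data A)

/-- The last letter `α₀` before the exchange. -/
def a₀ : A := lastLetter D.top

/-- The last letter `α₁` after the exchange. -/
def a₁ : A := lastLetter D.bot

/-- The name of the arrow of the Rauzy diagram starting from `D`: the longer one of the two last
intervals. -/
def winner : A := if D.len D.a₁ < D.len D.a₀ then D.a₀ else D.a₁

/-- The secondary name of the arrow starting from `D`. -/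
def loser : A := if D.len D.a₁ < D.len D.a₀ then D.a₁ else D.a₀

/-- The basic operation of the Rauzy–Veech algorithm. In the case of equal lengths, where
the algorithm stops, the data are left unchanged; this never occurs under the Keane property. -/
def step : Data A :=
  if h : D.len D.a₁ < D.len D.a₀ then
    { top := D.top
      bot := D.bot.trans (rauzyPerm (D.bot D.a₀))
      len := Function.update D.len D.a₀ (D.len D.a₀ - D.len D.a₁)
      len_pos := fun a => by
        rcases eq_or_ne a D.a₀ with rfl | ha
        · simpa using h
        · simpa [ha] using D.len_pos a }
  else if h' : D.len D.a₀ < D.len D.a₁ then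
    { top := D.top.trans (rauzyPerm (D.top D.a₁))
      bot := D.bot
      len := Function.update D.len D.a₁ (D.len D.a₁ - D.len D.a₀)
      len_pos := fun a => by
        rcases eq_or_ne a D.a₁ with rfl | ha
        · simpa using h'
        · simpa [ha] using D.len_pos a }
  else D

/-- The data of the `n`-th iterate of the Rauzy–Veech algorithm. -/
def iter (n : ℕ) : Data A := step^[n] D

/-- The matrix `V = 1 + E` of the `n`-th step (counted from `0`): the old lengths are
`V *ᵥ` the new ones. -/
def V (n : ℕ) : Matrix A A ℝ := 1 + Matrix.single (D.iter n).winner (D.iter n).loser 1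

/-- The number of different names taken by the steps `m, …, N - 1` (counted from `0`). -/
def nameCount (m N : ℕ) : ℕ := ((Finset.Ico m N).image fun n => (D.iter n).winner).card

/-- The times of the accelerated algorithm: `time (k + 1)` is the largest `N` such that at most
`d - 1` names are taken by the steps from `time k` to `N`. -/
def time : ℕ → ℕ
  | 0 => 0
  | k + 1 => sSup {N | time k ≤ N ∧ D.nameCount (time k) N ≤ Fintype.card A - 1}

/-- `Zsucc k` is the matrix `Z(k + 1)`, the ordered product of the matrices `V` of the steps from
`time k` to `time (k + 1)`. -/
def Zsucc (k : ℕ) : Matrix A A ℝ :=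
  ((List.range' (D.time k) (D.time (k + 1) - D.time k)).map D.V).prod

/-- The matrix `Q(k, l) = Z(k + 1) ⋯ Z(l)`, for `k ≤ l`. -/
def Q (k l : ℕ) : Matrix A A ℝ := ((List.range' k (l - k)).map D.Zsucc).prod

/-- The operator `S(k, l)` (special Birkhoff sums of piecewise constant functions), with matrix
the transpose of `Q(k, l)`. -/
def S (k l : ℕ) : (A → ℝ) →ₗ[ℝ] (A → ℝ) := (D.Q k l)ᵀ.mulVecLin

end Data

/-- The norm of a matrix: the sum of the absolute values of its coefficients. -/
def matNorm (M : Matrix A A ℝ) : ℝ := ∑ a, ∑ b, |M a b|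

/-- Nonnegative coefficients, and at least `1` on the diagonal. -/
def Big (M : Matrix A A ℝ) : Prop := (∀ a b, 0 ≤ M a b) ∧ ∀ a, 1 ≤ M a a

theorem Big.one : Big (1 : Matrix A A ℝ) :=
  ⟨fun a b => by rw [Matrix.one_apply]; split_ifs <;> norm_num, fun a => by simp⟩

theorem Big.mul {M N : Matrix A A ℝ} (hM : Big M) (hN : Big N) : Big (M * N) := by
  refine ⟨fun a b => Finset.sum_nonneg fun c _ => mul_nonneg (hM.1 a c) (hN.1 c b), fun a => ?_⟩
  calc (1 : ℝ) ≤ M a a * N a a := one_le_mul_of_one_le_of_one_le (hM.2 a) (hN.2 a)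
    _ ≤ ∑ c, M a c * N c a := Finset.single_le_sum (f := fun c => M a c * N c a)
        (fun c _ => mul_nonneg (hM.1 a c) (hN.1 c a)) (Finset.mem_univ a)

theorem Big.list_prod {ι : Type*} (f : ι → Matrix A A ℝ) (hf : ∀ i, Big (f i)) (l : List ι) :
    Big (l.map f).prod := by
  induction l with
  | nil => simpa using Big.one
  | cons i l ih => simpa using (hf i).mul ih

theorem big_V (D : Data A) (n : ℕ) : Big (D.V n) := by
  have h : ∀ a b, (0 : ℝ) ≤ Matrix.single (D.iter n).winner (D.iter n).loser (1 : ℝ) a b := by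
    intro a b
    rw [Matrix.single_apply]
    split_ifs <;> norm_num
  refine ⟨fun a b => add_nonneg (Big.one.1 a b) (h a b), fun a => ?_⟩
  have := h a a
  simp only [Data.V, Matrix.add_apply, Matrix.one_apply_eq]
  linarith

theorem big_Q (D : Data A) (k l : ℕ) : Big (D.Q k l) :=
  Big.list_prod _ (fun _ => Big.list_prod _ (big_V D) _) _

theorem one_le_matNorm {M : Matrix A A ℝ} (hM : Big M) : 1 ≤ matNorm M := by
  obtain ⟨a⟩ := ‹Nonempty A›
  calc (1 : ℝ) ≤ |M a a| := (hM.2 a).trans (le_abs_self _)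
    _ ≤ ∑ b, |M a b| := Finset.single_le_sum (f := fun b => |M a b|)
        (fun b _ => abs_nonneg _) (Finset.mem_univ a)
    _ ≤ matNorm M := Finset.single_le_sum (f := fun a => ∑ b, |M a b|)
        (fun a _ => Finset.sum_nonneg fun b _ => abs_nonneg _) (Finset.mem_univ a)

namespace Data

variable (D : Data A)

/-- The stable subspace `Γₛ^(k)`: the `v` for which there are `σ > 0` and `C > 0` with
`‖S(k, l) v‖ ≤ C ‖S(k, l)‖ ^ (-σ) ‖v‖` for all `l ≥ k`. (The norm of `S(k, l)` is the one of `Q(k, l)`,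
whose transpose is the matrix of `S(k, l)`.) -/
def stable (k : ℕ) : Submodule ℝ (A → ℝ) where
  carrier := {v | ∃ σ > (0 : ℝ), ∃ C > (0 : ℝ), ∀ l, k ≤ l →
    ‖D.S k l v‖ ≤ C * matNorm (D.Q k l) ^ (-σ) * ‖v‖}
  zero_mem' := ⟨1, one_pos, 1, one_pos, fun l _ => by simp⟩
  add_mem' := by
    rintro v w ⟨σ, hσ, C, hC, hv⟩ ⟨τ, hτ, E, hE, hw⟩
    rcases eq_or_ne (v + w) 0 with h0 | h0
    · exact ⟨1, one_pos, 1, one_pos, fun l _ => by simp [h0]⟩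
    have hn : 0 < ‖v + w‖ := norm_pos_iff.2 h0
    refine ⟨min σ τ, lt_min hσ hτ, (C * ‖v‖ + E * ‖w‖ + 1) / ‖v + w‖, by positivity,
      fun l hl => ?_⟩
    have hQ := one_le_matNorm (big_Q D k l)
    have h1 : matNorm (D.Q k l) ^ (-σ) ≤ matNorm (D.Q k l) ^ (-(min σ τ)) :=
      Real.rpow_le_rpow_of_exponent_le hQ (neg_le_neg (min_le_left _ _))
    have h2 : matNorm (D.Q k l) ^ (-τ) ≤ matNorm (D.Q k l) ^ (-(min σ τ)) :=
      Real.rpow_le_rpow_of_exponent_le hQ (neg_le_neg (min_le_right _ _))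
    have h3 : 0 < matNorm (D.Q k l) ^ (-(min σ τ)) := Real.rpow_pos_of_pos (by linarith) _
    calc ‖D.S k l (v + w)‖ ≤ ‖D.S k l v‖ + ‖D.S k l w‖ := by rw [map_add]; exact norm_add_le _ _
      _ ≤ C * matNorm (D.Q k l) ^ (-σ) * ‖v‖ + E * matNorm (D.Q k l) ^ (-τ) * ‖w‖ :=
          add_le_add (hv l hl) (hw l hl)
      _ ≤ C * matNorm (D.Q k l) ^ (-(min σ τ)) * ‖v‖
          + E * matNorm (D.Q k l) ^ (-(min σ τ)) * ‖w‖ := by gcongr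
      _ ≤ (C * ‖v‖ + E * ‖w‖ + 1) * matNorm (D.Q k l) ^ (-(min σ τ)) := by nlinarith
      _ = _ := by field_simp
  smul_mem' := by
    rintro c v ⟨σ, hσ, C, hC, hv⟩
    refine ⟨σ, hσ, C, hC, fun l hl => ?_⟩
    rw [map_smul, norm_smul, norm_smul]
    calc |c| * ‖D.S k l v‖ ≤ |c| * (C * matNorm (D.Q k l) ^ (-σ) * ‖v‖) :=
          mul_le_mul_of_nonneg_left (hv l hl) (abs_nonneg c)
      _ = _ := by rw [Real.norm_eq_abs]; ring

/-- Condition (a): the matrices `Z(k + 1)` grow slower than any power of `Q(k) = Q(0, k)`. -/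
def CondA : Prop :=
  ∀ ε > (0 : ℝ), ∃ C > (0 : ℝ), ∀ k, matNorm (D.Zsucc k) ≤ C * matNorm (D.Q 0 k) ^ ε

/-- Condition (b), spectral gap: there are `θ, C > 0` such that the norm of the restriction of
`S(k) = S(0, k)` to the vectors of mean value `0` is at most `C ‖S(k)‖ ^ (1 - θ)`. -/
def CondB : Prop :=
  ∃ θ > (0 : ℝ), ∃ C > (0 : ℝ), ∀ k, ∀ v : A → ℝ, ∑ a, D.len a * v a = 0 →
    ‖D.S 0 k v‖ ≤ C * matNorm (D.Q 0 k) ^ (1 - θ) * ‖v‖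

/-- Condition (c), coherence: `S(k, l)` induces a bijection from `Γ / Γₛ^(k)` onto `Γ / Γₛ^(l)`, and
the norm of its inverse (for the quotient norms) and the norm of the restriction of `S(k, l)`
to `Γₛ^(k)` are at most `C ‖Q(l)‖ ^ ε`. -/
def CondC : Prop :=
  ∀ ε > (0 : ℝ), ∃ C > (0 : ℝ), ∀ k l, k ≤ l →
    (∀ v : A → ℝ, ‖(Submodule.Quotient.mk v : (A → ℝ) ⧸ D.stable k)‖ ≤
      C * matNorm (D.Q 0 l) ^ ε * ‖(Submodule.Quotient.mk (D.S k l v) : (A → ℝ) ⧸ D.stable l)‖) ∧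
    ∀ v ∈ D.stable k, ‖D.S k l v‖ ≤ C * matNorm (D.Q 0 l) ^ ε * ‖v‖

/-- Interval exchange maps of Roth type. -/
def RothType : Prop := D.Keane ∧ D.CondA ∧ D.CondB ∧ D.CondC

end Data

end Algorithm

/-! ### Function spaces -/

section PieceLemmas

/-- `f` is of class `C^(r - 1)` on `[a, b)`, its derivative of order `r - 1` is absolutely continuous
there, and its derivative of order `r` (which exists almost everywhere) coincides almost
everywhere with a function of bounded variation on `[a, b)`. Since a function of bounded variation
is bounded, absolute continuity on every `[a, c]` with `a ≤ c < b` amounts here to absolute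
continuity on `[a, b)`. -/
def BVPiece (r : ℕ) (f : ℝ → ℝ) (a b : ℝ) : Prop :=
  ContDiffOn ℝ (r - 1 : ℕ) f (Ico a b) ∧
  (∀ c ∈ Ico a b, AbsolutelyContinuousOnInterval (iteratedDerivWithin (r - 1) f (Ico a b)) a c) ∧
  ∃ φ : ℝ → ℝ, BoundedVariationOn φ (Ico a b) ∧
    iteratedDerivWithin r f (Ico a b) =ᵐ[volume.restrict (Ico a b)] φ

theorem boundedVariationOn_add {f g : ℝ → ℝ} {s : Set ℝ} (hf : BoundedVariationOn f s)
    (hg : BoundedVariationOn g s) : BoundedVariationOn (f + g) s := by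
  have h : eVariationOn (f + g) s ≤ eVariationOn f s + eVariationOn g s := by
    refine iSup_le fun p => ?_
    calc ∑ i ∈ Finset.range p.1, edist ((f + g) (p.2.1 (i + 1))) ((f + g) (p.2.1 i))
        ≤ ∑ i ∈ Finset.range p.1, (edist (f (p.2.1 (i + 1))) (f (p.2.1 i))
          + edist (g (p.2.1 (i + 1))) (g (p.2.1 i))) :=
          Finset.sum_le_sum fun i _ => edist_add_add_le _ _ _ _
      _ = _ := Finset.sum_add_distrib
      _ ≤ _ := add_le_add (eVariationOn.sum_le (f := f) p.2.2.1 p.2.2.2)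
          (eVariationOn.sum_le (f := g) p.2.2.1 p.2.2.2)
  exact ne_top_of_le_ne_top (ENNReal.add_ne_top.2 ⟨hf, hg⟩) h

theorem boundedVariationOn_smul (c : ℝ) {f : ℝ → ℝ} {s : Set ℝ} (hf : BoundedVariationOn f s) :
    BoundedVariationOn (c • f) s := by
  have hc : BoundedVariationOn (fun _ : ℝ => c) s := by
    have : eVariationOn (fun _ : ℝ => c) s = 0 :=
      eVariationOn.constant_on (by rintro _ ⟨x, _, rfl⟩ _ ⟨y, _, rfl⟩; rfl)
    simp [BoundedVariationOn, this]
  exact hc.smul hf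

variable {r : ℕ} {f g : ℝ → ℝ} {a b : ℝ}

/-- The derivative of order `r - 1` has a derivative of order one almost everywhere. -/
theorem BVPiece.ae_differentiableWithinAt (hf : BVPiece r f a b) :
    ∀ᵐ x ∂(volume.restrict (Ico a b)),
      DifferentiableWithinAt ℝ (iteratedDerivWithin (r - 1) f (Ico a b)) (Ico a b) x := by
  rw [ae_restrict_iff' measurableSet_Ico]
  have : ∀ n : ℕ, ∀ᵐ x, x ∈ Icc a (b - 1 / (n + 1)) → a < x → x < b - 1 / (n + 1) →
      DifferentiableAt ℝ (iteratedDerivWithin (r - 1) f (Ico a b)) x := by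
    intro n
    by_cases hab : a ≤ b - 1 / (n + 1)
    · have hn : (0 : ℝ) < 1 / (n + 1) := by positivity
      filter_upwards [(hf.2.1 _ ⟨hab, by linarith⟩).ae_differentiableAt] with x hx h1 _ _
      exact hx (by rwa [uIcc_of_le hab])
    · exact Filter.Eventually.of_forall fun x h1 h2 h3 => absurd (h1.1.trans h1.2) hab
  have hne : ∀ᵐ x : ℝ, x ≠ a := by simp [ae_iff, measure_singleton]
  filter_upwards [ae_all_iff.2 this, hne] with x hx hxa hxI
  obtain ⟨n, hn⟩ := exists_nat_one_div_lt (sub_pos.2 hxI.2)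
  have h1 : a < x := lt_of_le_of_ne hxI.1 hxa.symm
  have h2 : x < b - 1 / (n + 1) := by linarith
  exact (hx n ⟨h1.le, h2.le⟩ h1 h2).differentiableWithinAt

theorem uniqueDiffOn_Ico' : UniqueDiffOn ℝ (Ico a b) := uniqueDiffOn_Ico a b

theorem contDiffWithinAt_of_le {n l : ℕ} (hf : ContDiffOn ℝ n f (Ico a b)) (hl : l ≤ n) {x : ℝ}
    (hx : x ∈ Ico a b) : ContDiffWithinAt ℝ l f (Ico a b) x :=
  (hf x hx).of_le (by exact_mod_cast hl)

theorem BVPiece.ae_add (hf : BVPiece r f a b) (hg : BVPiece r g a b) {l : ℕ}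
    (hl : l ≤ r) :
    iteratedDerivWithin l (f + g) (Ico a b) =ᵐ[volume.restrict (Ico a b)]
      iteratedDerivWithin l f (Ico a b) + iteratedDerivWithin l g (Ico a b) := by
  have key : ∀ m ≤ r - 1, EqOn (iteratedDerivWithin m (f + g) (Ico a b))
      (iteratedDerivWithin m f (Ico a b) + iteratedDerivWithin m g (Ico a b)) (Ico a b) :=
    fun m hm x hx => iteratedDerivWithin_add hx uniqueDiffOn_Ico'
      (contDiffWithinAt_of_le hf.1 hm hx) (contDiffWithinAt_of_le hg.1 hm hx)
  rcases Nat.lt_or_ge (r - 1) l with h | h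
  swap
  · filter_upwards [ae_restrict_mem measurableSet_Ico] with x hx
    exact key l h hx
  · obtain rfl : l = r := by omega
    obtain ⟨n, rfl⟩ : ∃ n, l = n + 1 := ⟨l - 1, by omega⟩
    filter_upwards [ae_restrict_mem measurableSet_Ico, hf.ae_differentiableWithinAt,
      hg.ae_differentiableWithinAt] with x hx h1 h2
    simp only [Nat.add_sub_cancel] at h1 h2 key
    simp only [Pi.add_apply, iteratedDerivWithin_succ]
    rw [derivWithin_congr (key n le_rfl) (key n le_rfl hx), derivWithin_add h1 h2]

theorem ac_congr {F G : ℝ → ℝ} (h : EqOn F G (uIcc a b))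
    (hF : AbsolutelyContinuousOnInterval F a b) : AbsolutelyContinuousOnInterval G a b := by
  rw [absolutelyContinuousOnInterval_iff] at hF ⊢
  intro ε hε
  obtain ⟨δ, hδ, H⟩ := hF ε hε
  refine ⟨δ, hδ, fun E hE hlt => ?_⟩
  have h1 := H E hE hlt
  rwa [Finset.sum_congr rfl fun i hi => by
    rw [h (hE.1 i hi).1, h (hE.1 i hi).2]] at h1

theorem BVPiece.add (hf : BVPiece r f a b) (hg : BVPiece r g a b) :
    BVPiece r (f + g) a b := by
  obtain ⟨φ, hφ, hφ'⟩ := hf.2.2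
  obtain ⟨ψ, hψ, hψ'⟩ := hg.2.2
  refine ⟨hf.1.add hg.1, fun c hc => ?_, φ + ψ, boundedVariationOn_add hφ hψ,
    (hf.ae_add hg le_rfl).trans (hφ'.add hψ')⟩
  have hsub : uIcc a c ⊆ Ico a b := by
    rw [uIcc_of_le hc.1]
    exact fun x hx => ⟨hx.1, hx.2.trans_lt hc.2⟩
  refine ac_congr (fun x hx => ?_) ((hf.2.1 c hc).add (hg.2.1 c hc))
  exact (iteratedDerivWithin_add (hsub hx) uniqueDiffOn_Ico'
      (contDiffWithinAt_of_le hf.1 le_rfl (hsub hx))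
      (contDiffWithinAt_of_le hg.1 le_rfl (hsub hx))).symm

theorem iteratedDerivWithin_smul' (c : ℝ) (l : ℕ) (s : Set ℝ) :
    iteratedDerivWithin l (c • f) s = c • iteratedDerivWithin l f s := by
  ext x
  simp

theorem BVPiece.smul (c : ℝ) (hf : BVPiece r f a b) : BVPiece r (c • f) a b := by
  obtain ⟨φ, hφ, hφ'⟩ := hf.2.2
  refine ⟨contDiffOn_const.smul hf.1, fun d hd => ?_, c • φ, boundedVariationOn_smul c hφ, ?_⟩
  · rw [iteratedDerivWithin_smul']
    exact (hf.2.1 d hd).const_smul c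
  · rw [iteratedDerivWithin_smul']
    exact hφ'.const_smul c

theorem BVPiece.zero : BVPiece r 0 a b := by
  have h : ∀ l, iteratedDerivWithin l (0 : ℝ → ℝ) (Ico a b) = 0 := fun l => by
    have := iteratedDerivWithin_smul' (f := 0) 0 l (Ico a b)
    simpa using this
  refine ⟨contDiffOn_const, fun c _ => ?_, 0, ?_, ?_⟩
  · rw [h]
    exact (contDiffOn_const (c := (0 : ℝ))).absolutelyContinuousOnInterval
  · exact ne_of_eq_of_ne (eVariationOn.constant_on
      (by rintro _ ⟨x, _, rfl⟩ _ ⟨y, _, rfl⟩; rfl)) ENNReal.zero_ne_top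
  · rw [h]

theorem bounded_of_boundedVariationOn {φ : ℝ → ℝ} (hφ : BoundedVariationOn φ (Ico a b)) :
    ∃ M, ∀ x ∈ Ico a b, |φ x| ≤ M := by
  refine ⟨|φ a| + (eVariationOn φ (Ico a b)).toReal, fun x hx => ?_⟩
  have ha : a ∈ Ico a b := ⟨le_rfl, hx.1.trans_lt hx.2⟩
  have := hφ.dist_le hx ha
  rw [Real.dist_eq] at this
  have := abs_sub_abs_le_abs_sub (φ x) (φ a)
  linarith

theorem aestronglyMeasurable_of_boundedVariationOn {φ : ℝ → ℝ}
    (hφ : BoundedVariationOn φ (Ico a b)) :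
    AEStronglyMeasurable φ (volume.restrict (Ico a b)) := by
  obtain ⟨p, q, hp, hq, rfl⟩ := hφ.locallyBoundedVariationOn.exists_monotoneOn_sub_monotoneOn
  exact ((aemeasurable_restrict_of_monotoneOn measurableSet_Ico hp).sub
    (aemeasurable_restrict_of_monotoneOn measurableSet_Ico hq)).aestronglyMeasurable

theorem integrableOn_of_bounded {φ : ℝ → ℝ}
    (hφ : AEStronglyMeasurable φ (volume.restrict (Ico a b)))
    (h : ∃ M, ∀ x ∈ Ico a b, |φ x| ≤ M) : IntegrableOn φ (Ico a b) := by
  obtain ⟨M, hM⟩ := h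
  refine IntegrableOn.of_bound (by simp) hφ M ?_
  filter_upwards [ae_restrict_mem measurableSet_Ico] with x hx
  exact hM x hx

theorem BVPiece.bounded (hr : 1 ≤ r) (hf : BVPiece r f a b) (j : ℕ) :
    ∃ M, ∀ x ∈ Ico a b, |iteratedDerivWithin (r - 1 - j) f (Ico a b) x| ≤ M := by
  induction j with
  | zero =>
    obtain ⟨φ, hφ, hφ'⟩ := hf.2.2
    obtain ⟨M, hM⟩ := bounded_of_boundedVariationOn hφ
    set G := iteratedDerivWithin (r - 1) f (Ico a b) with hG
    refine ⟨|G a| + M * (b - a), fun c hc => ?_⟩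
    simp only [Nat.sub_zero]
    have h1 := (hf.2.1 c hc).integral_deriv_eq_sub
    have h2 : ‖∫ x in a..c, deriv G x‖ ≤ M * |c - a| := by
      refine intervalIntegral.norm_integral_le_of_norm_le_const_ae ?_
      rw [Filter.EventuallyEq, ae_restrict_iff' measurableSet_Ico] at hφ'
      have hne : ∀ᵐ x : ℝ, x ≠ a := by simp [ae_iff, measure_singleton]
      filter_upwards [hφ', hne] with x hx hxa hxI
      rw [uIoc_of_le hc.1] at hxI
      have hxI' : x ∈ Ico a b := ⟨hxI.1.le, hxI.2.trans_lt hc.2⟩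
      have h3 := hx hxI'
      obtain ⟨n, rfl⟩ : ∃ n, r = n + 1 := ⟨r - 1, by omega⟩
      rw [iteratedDerivWithin_succ, derivWithin_of_mem_nhds (Ico_mem_nhds hxI.1 hxI'.2)] at h3
      have h4 : deriv G x = φ x := h3
      rw [h4]
      exact hM x hxI'
    rw [h1, Real.norm_eq_abs, abs_of_nonneg (sub_nonneg.2 hc.1)] at h2
    have h5 := abs_sub_abs_le_abs_sub (G c) (G a)
    have h6 : 0 ≤ M := (abs_nonneg _).trans (hM c hc)
    have h7 : M * (c - a) ≤ M * (b - a) :=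
      mul_le_mul_of_nonneg_left (by linarith [hc.2]) h6
    linarith
  | succ j ih =>
    rcases Nat.lt_or_ge j (r - 1) with hj | hj
    · obtain ⟨M, hM⟩ := ih
      set l := r - 1 - (j + 1) with hl
      have hl' : r - 1 - j = l + 1 := by omega
      rw [hl'] at hM
      refine ⟨|iteratedDerivWithin l f (Ico a b) a| + M * (b - a), fun x hx => ?_⟩
      have ha : a ∈ Ico a b := ⟨le_rfl, hx.1.trans_lt hx.2⟩
      have hd : ∀ y ∈ Ico a b, DifferentiableWithinAt ℝ (iteratedDerivWithin l f (Ico a b))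
          (Ico a b) y := fun y hy => hf.1.differentiableOn_iteratedDerivWithin
            (by exact_mod_cast (by omega : l < r - 1)) uniqueDiffOn_Ico' y hy
      have h1 := (convex_Ico a b).norm_image_sub_le_of_norm_derivWithin_le (C := M) hd
        (fun y hy => by
          have := hM y hy
          rwa [iteratedDerivWithin_succ] at this) ha hx
      rw [Real.norm_eq_abs, Real.norm_eq_abs, abs_of_nonneg (sub_nonneg.2 hx.1)] at h1
      have h5 := abs_sub_abs_le_abs_sub (iteratedDerivWithin l f (Ico a b) x)
        (iteratedDerivWithin l f (Ico a b) a)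
      have h6 : 0 ≤ M := (abs_nonneg _).trans (hM x hx)
      have h7 : M * (x - a) ≤ M * (b - a) :=
        mul_le_mul_of_nonneg_left (by linarith [hx.2]) h6
      linarith
    · rwa [show r - 1 - (j + 1) = r - 1 - j by omega]

theorem BVPiece.integrableOn (hr : 1 ≤ r) (hf : BVPiece r f a b) {l : ℕ} (hl : l ≤ r) :
    IntegrableOn (iteratedDerivWithin l f (Ico a b)) (Ico a b) := by
  rcases Nat.lt_or_ge l r with h | h
  · refine integrableOn_of_bounded ?_ ?_
    · exact (hf.1.continuousOn_iteratedDerivWithin (by exact_mod_cast (by omega : l ≤ r - 1))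
        uniqueDiffOn_Ico').aestronglyMeasurable measurableSet_Ico
    · have := hf.bounded hr (r - 1 - l)
      rwa [show r - 1 - (r - 1 - l) = l by omega] at this
  · obtain rfl : l = r := le_antisymm hl h
    obtain ⟨φ, hφ, hφ'⟩ := hf.2.2
    exact (integrableOn_of_bounded (aestronglyMeasurable_of_boundedVariationOn hφ)
      (bounded_of_boundedVariationOn hφ)).congr hφ'.symm

end PieceLemmas

section Spaces

variable {A : Type*} [Fintype A]

namespace Data

variable (D : Data A)

/-- The extension by `0` of a function on `I` to the real line. Only its restriction to `I` is ever
used below. -/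
def ext : (D.Dom → ℝ) →ₗ[ℝ] (ℝ → ℝ) where
  toFun f x := if h : x ∈ Ico (0 : ℝ) D.total then f ⟨x, h⟩ else 0
  map_add' f g := by
    ext x
    simp only [Pi.add_apply]
    split_ifs <;> simp
  map_smul' c f := by
    ext x
    simp only [Pi.smul_apply, RingHom.id_apply]
    split_ifs <;> simp

/-- The space `BV^r_*(I)`, for `r ≥ 1`: functions `Φ` on `I` such that on each interval `j₀(Iₐ)`, `Φ` is of
class `C^(r - 1)`, `D^(r - 1) Φ` is absolutely continuous and `D^r Φ` is of bounded variation, and such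
that `D^l Φ` has mean value `0` on `I` for `0 < l ≤ r`. -/
def BVStar (r : ℕ) : Submodule ℝ (D.Dom → ℝ) where
  carrier := {Φ |
    (∀ a, BVPiece r (D.ext Φ) (D.left a) (D.left a + D.len a)) ∧
    ∀ l, 0 < l → l ≤ r →
      ∑ a, ∫ x in D.piece a, iteratedDerivWithin l (D.ext Φ) (D.piece a) x = 0}
  zero_mem' := by
    refine ⟨fun a => by rw [map_zero]; exact BVPiece.zero, fun l hl hlr => ?_⟩
    have h : ∀ a, iteratedDerivWithin l (0 : ℝ → ℝ) (D.piece a) = 0 := fun a => by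
      have := iteratedDerivWithin_smul' (f := 0) 0 l (D.piece a)
      simpa using this
    rw [map_zero]
    simp only [h]
    simp
  add_mem' := by
    rintro Φ Ψ ⟨h1, h2⟩ ⟨h3, h4⟩
    refine ⟨fun a => by rw [map_add]; exact (h1 a).add (h3 a), fun l hl hlr => ?_⟩
    have hr : 1 ≤ r := by omega
    calc ∑ a, ∫ x in D.piece a, iteratedDerivWithin l (D.ext (Φ + Ψ)) (D.piece a) x
        = ∑ a, ((∫ x in D.piece a, iteratedDerivWithin l (D.ext Φ) (D.piece a) x)
          + ∫ x in D.piece a, iteratedDerivWithin l (D.ext Ψ) (D.piece a) x) := by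
          refine Finset.sum_congr rfl fun a _ => ?_
          rw [map_add]
          exact (integral_congr_ae ((h1 a).ae_add (h3 a) hlr)).trans
            (integral_add ((h1 a).integrableOn hr hlr) ((h3 a).integrableOn hr hlr))
      _ = 0 := by rw [Finset.sum_add_distrib, h2 l hl hlr, h4 l hl hlr, add_zero]
  smul_mem' := by
    rintro c Φ ⟨h1, h2⟩
    refine ⟨fun a => by rw [map_smul]; exact (h1 a).smul c, fun l hl hlr => ?_⟩
    rw [map_smul]
    simp_rw [iteratedDerivWithin_smul', Pi.smul_apply, integral_smul, ← Finset.smul_sum]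
    rw [h2 l hl hlr, smul_zero]

/-- The space `Γ` of functions that are constant on each interval `j₀(Iₐ)`. -/
def Γ : Submodule ℝ (D.Dom → ℝ) where
  carrier := {χ | ∀ a, ∃ c : ℝ, ∀ x : D.Dom, (x : ℝ) ∈ D.piece a → χ x = c}
  zero_mem' := fun a => ⟨0, fun x _ => rfl⟩
  add_mem' := by
    intro f g hf hg a
    obtain ⟨c, hc⟩ := hf a
    obtain ⟨e, he⟩ := hg a
    exact ⟨c + e, fun x hx => by rw [Pi.add_apply, hc x hx, he x hx]⟩
  smul_mem' := by
    intro t f hf a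
    obtain ⟨c, hc⟩ := hf a
    exact ⟨t * c, fun x hx => by rw [Pi.smul_apply, hc x hx, smul_eq_mul]⟩

/-- The space `Γ(r)` of functions whose restriction to each interval `j₀(Iₐ)` is a polynomial of
degree `< r`. -/
def ΓPoly (r : ℕ) : Submodule ℝ (D.Dom → ℝ) where
  carrier := {χ | ∀ a, ∃ p ∈ Polynomial.degreeLT ℝ r,
    ∀ x : D.Dom, (x : ℝ) ∈ D.piece a → χ x = p.eval (x : ℝ)}
  zero_mem' := fun a => ⟨0, zero_mem _, fun x _ => by simp⟩
  add_mem' := by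
    intro f g hf hg a
    obtain ⟨p, hp, hfp⟩ := hf a
    obtain ⟨q, hq, hgq⟩ := hg a
    exact ⟨p + q, add_mem hp hq, fun x hx => by
      rw [Pi.add_apply, hfp x hx, hgq x hx, Polynomial.eval_add]⟩
  smul_mem' := by
    intro t f hf a
    obtain ⟨p, hp, hfp⟩ := hf a
    exact ⟨t • p, Submodule.smul_mem _ _ hp, fun x hx => by
      rw [Pi.smul_apply, hfp x hx, Polynomial.eval_smul]⟩

/-- The space `Γ_*(r) = Γ(r) ∩ BV^r_*(I)`. -/
def ΓStar (r : ℕ) : Submodule ℝ (D.Dom → ℝ) := D.ΓPoly r ⊓ D.BVStar r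

/-- The space of bounded functions on `I`. -/
def bounded : Submodule ℝ (D.Dom → ℝ) where
  carrier := {ψ | ∃ M : ℝ, ∀ x, |ψ x| ≤ M}
  zero_mem' := ⟨0, fun x => by simp⟩
  add_mem' := by
    rintro f g ⟨M, hM⟩ ⟨N, hN⟩
    exact ⟨M + N, fun x => (abs_add_le _ _).trans (add_le_add (hM x) (hN x))⟩
  smul_mem' := by
    rintro t f ⟨M, hM⟩
    exact ⟨|t| * M, fun x => by
      rw [Pi.smul_apply, smul_eq_mul, abs_mul]
      exact mul_le_mul_of_nonneg_left (hM x) (abs_nonneg t)⟩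

/-- For `n ≥ 0`, the space `C^(n + Lip)(I)` of functions of class `C^n` on all of `I` whose derivative of
order `n` is Lipschitz on `I`. -/
def smoothLip (n : ℕ) : Submodule ℝ (D.Dom → ℝ) where
  carrier := {ψ | ContDiffOn ℝ n (D.ext ψ) (Ico 0 D.total) ∧
    ∃ K, LipschitzOnWith K (iteratedDerivWithin n (D.ext ψ) (Ico 0 D.total)) (Ico 0 D.total)}
  zero_mem' := by
    rw [mem_ofPred_eq, map_zero]
    refine ⟨contDiffOn_const, 0, ?_⟩
    have h := iteratedDerivWithin_smul' (f := 0) 0 n (Ico 0 D.total)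
    rw [zero_smul, zero_smul] at h
    rw [h]
    exact (LipschitzWith.const (0 : ℝ)).lipschitzOnWith
  add_mem' := by
    rintro f g ⟨h1, K, hK⟩ ⟨h2, L, hL⟩
    rw [mem_ofPred_eq, map_add]
    refine ⟨h1.add h2, K + L, fun x hx y hy => ?_⟩
    rw [iteratedDerivWithin_add hx uniqueDiffOn_Ico' (h1 x hx) (h2 x hx),
      iteratedDerivWithin_add hy uniqueDiffOn_Ico' (h1 y hy) (h2 y hy)]
    exact hK.add hL hx hy
  smul_mem' := by
    rintro c f ⟨h1, K, hK⟩
    rw [mem_ofPred_eq, map_smul, iteratedDerivWithin_smul']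
    refine ⟨contDiffOn_const.smul h1, ‖c‖₊ * K, fun x hx y hy => ?_⟩
    rw [Pi.smul_apply, Pi.smul_apply, edist_smul₀, ENNReal.coe_mul, mul_assoc,
      ENNReal.smul_def, smul_eq_mul]
    gcongr
    exact hK hx hy

/-- The space `C^(r - 2 + Lip)(I)`, for `r ≥ 1`; for `r = 1` it is the space of bounded functions. -/
def CLip : ℕ → Submodule ℝ (D.Dom → ℝ)
  | 0 => D.bounded
  | 1 => D.bounded
  | n + 2 => D.smoothLip n

/-- The linear map `ψ ↦ ψ ∘ T - ψ`. -/
def coboundary : (D.Dom → ℝ) →ₗ[ℝ] (D.Dom → ℝ) :=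
  LinearMap.funLeft ℝ ℝ D.T - LinearMap.id

/-- The space `Γ_T` of functions `χ ∈ Γ` of the form `χ = ψ - ψ ∘ T` with `ψ` bounded. -/
def ΓT : Submodule ℝ (D.Dom → ℝ) := D.Γ ⊓ D.bounded.map (-D.coboundary)

/-- The space `Γ_T(r)` of functions `χ ∈ Γ_*(r)` of the form `χ = ψ ∘ T - ψ` with
`ψ ∈ C^(r - 2 + Lip)(I)`. -/
def ΓTPoly (r : ℕ) : Submodule ℝ (D.Dom → ℝ) := D.ΓStar r ⊓ (D.CLip r).map D.coboundary

end Data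

end Spaces

end IntervalExchange

end

open MeasureTheory Set
open scoped Matrix

noncomputable section

namespace IntervalExchange

set_option linter.unusedSectionVars false

/-! ### Endpoints and lengths under one Rauzy–Veech step. -/

section Step

variable {A : Type*} [Fintype A]

/-! The heart is the case `r = 1`, which is a renormalization argument. Let `F` be a representative
of bounded variation of the derivative of `Φ`. Its special Birkhoff sums at time `k` of the
accelerated algorithm have total variation at most that of `F`, so they stay within a constant of
their averages on the intervals. These averages form a vector of mean value zero that follows the
cocycle `S` up to errors which, by (a), are smaller than any power of `q k = ‖Q(k)‖`; the spectral
gap (b) then bounds the sums of `F` by `q k ^ (1 - δ)` (`abs_sb_le_of_mass_zero`). Positivity of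
long products together with (a) makes all return times comparable up to small powers, so the
intervals have length at most `q k ^ (-1 + δ / 2)`. Integration shows that the special Birkhoff sums
of `Φ` are constant on each interval up to a negative power of `q k`. The resulting vectors follow
`S` with polynomially small errors, and coherence (c) provides a vector `χ` whose orbit under `S`
shadows them (`exists_shadowing`). Hence the special Birkhoff sums of `Φ - χ` decay like a power of
`q k` (`exists_small_sb`).

To pass from small special sums to a coboundary, the zero function is taken as an approximate
transfer function at time `k` and extended backwards through the steps, each of which restores one
cut-off piece of the interval (`EndpointStep.nearCoboundary`). The cost of a block is summable in
`k`, so the resulting functions on `I` are uniformly bounded while the error tends to zero.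
Therefore `Φ - χ` has bounded Birkhoff sums, and minus their limsup is a bounded, measurable
transfer function.

For larger `r` one differentiates, solves the equation one degree lower and integrates
(`exists_lift`). The vanishing means in `BV^r_*` say exactly that the polynomial part obtained below
has mean zero; the integration constants, one on each interval, go into `χ`. Once existence is
known, the obstruction map is pure linear algebra.

For the dimension, differentiation maps `Γ_T(r + 1)` to `Γ_T(r)`. It is onto by integration. Its
kernel consists of piecewise constant coboundaries of functions `ψ` that are at least Lipschitz.
Such a `ψ` has the same increments over an interval and over its image. Its vectors of increments
transform like the lengths, so (b), applied by duality, makes them proportional to the lengths; then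
`ψ` is affine (`affine_of_invariantIncrements`). Thus the kernel is the line spanned by the
displacements of `T`, which are not all zero, and each derivative costs one dimension. At `r = 1`
the space is `Γ_T`. -/

theorem rauzyPerm_apply {d : ℕ} (j i : Fin d) : ((rauzyPerm j i : Fin d) : ℕ) =
    if (i : ℕ) ≤ j then (i : ℕ) else if (i : ℕ) + 1 < d then (i : ℕ) + 1 else j + 1 := by
  show ((rauzyFun j i : Fin d) : ℕ) = _
  unfold rauzyFun
  simp only [Fin.le_def]
  split_ifs <;> rfl

theorem lastLetter_pos [Nonempty A] (p : A ≃ Fin (Fintype.card A)) :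
    (p (lastLetter p) : ℕ) = Fintype.card A - 1 := by
  simp [lastLetter]

theorem lt_lastLetter [Nonempty A] (p : A ≃ Fin (Fintype.card A)) {a : A} (ha : a ≠ lastLetter p) :
    (p a : ℕ) < Fintype.card A - 1 := by
  have h1 := (p a).2
  have h2 : (p a : ℕ) ≠ Fintype.card A - 1 := fun h => ha <| p.injective <| Fin.ext <| by
    rw [h, lastLetter_pos]
  omega

variable [DecidableEq A]

theorem offset_add_len_lastLetter [Nonempty A] (p : A ≃ Fin (Fintype.card A)) (len : A → ℝ) :
    offset p len (lastLetter p) + len (lastLetter p) = ∑ a, len a := by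
  rw [offset_add_len]
  refine Finset.sum_congr (Finset.filter_true_of_mem fun b _ => ?_) fun _ _ => rfl
  rw [Fin.le_def, lastLetter_pos]
  have := (p b).2
  omega

theorem sum_update_sub (len : A → ℝ) {w l : A} :
    ∑ a, Function.update len w (len w - len l) a = (∑ a, len a) - len l := by
  rw [Finset.sum_update_of_mem (Finset.mem_univ w), Finset.sdiff_singleton_eq_erase,
    ← Finset.add_sum_erase _ _ (Finset.mem_univ w)]
  ring

theorem offset_update_last [Nonempty A] (p : A ≃ Fin (Fintype.card A)) (len : A → ℝ) (x : ℝ) (a : A) :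
    offset p (Function.update len (lastLetter p) x) a = offset p len a := by
  refine Finset.sum_congr rfl fun b hb => ?_
  rw [Function.update_of_ne]
  rintro rfl
  simp only [Finset.mem_filter, Finset.mem_univ, true_and, Fin.lt_def, lastLetter_pos] at hb
  have := (p a).2
  omega

/-- The last letter is inserted just after `w`, and `w` loses exactly its length, so the pair fills
the old place of `w` and nothing else moves. In the sum of differences only the terms of these two
letters survive, and they cancel. -/
theorem offset_rauzy [Nonempty A] (p : A ≃ Fin (Fintype.card A)) (len : A → ℝ) {w : A}
    (hw : w ≠ lastLetter p) {a : A} (ha : a ≠ lastLetter p) :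
    offset (p.trans (rauzyPerm (p w))) (Function.update len w (len w - len (lastLetter p))) a
      = offset p len a := by
  set l := lastLetter p with hl
  have hwl := lt_lastLetter p hw
  have hal := lt_lastLetter p ha
  have hll : (p l : ℕ) = _ := lastLetter_pos p
  unfold offset
  rw [Finset.sum_filter, Finset.sum_filter, ← sub_eq_zero, ← Finset.sum_sub_distrib]
  have : ∀ b, ((if (p.trans (rauzyPerm (p w))) b < (p.trans (rauzyPerm (p w))) a then
      Function.update len w (len w - len l) b else 0) - if p b < p a then len b else 0)
      = (if b = l then (if p w < p a then len l else 0) else 0)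
        - (if b = w then (if p w < p a then len l else 0) else 0) := by
    intro b
    have hb := (p b).2
    simp only [Equiv.trans_apply, Fin.lt_def, rauzyPerm_apply]
    rcases eq_or_ne b l with rfl | hbl
    · rw [Function.update_of_ne hw.symm]
      simp only [hw.symm, if_true, if_false]
      split_ifs <;> first | omega | simp
    · have hbl' := lt_lastLetter p hbl
      rcases eq_or_ne b w with rfl | hbw
      · simp only [Function.update_self, if_true, hbl, if_false]
        split_ifs <;> first | omega | simp
      · rw [Function.update_of_ne hbw]
        simp only [hbl, hbw, if_false]
        split_ifs <;> first | omega | simp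
  rw [Finset.sum_congr rfl fun b _ => this b, Finset.sum_sub_distrib]
  simp

theorem offset_rauzy_last [Nonempty A] (p : A ≃ Fin (Fintype.card A)) (len : A → ℝ) {w : A}
    (hw : w ≠ lastLetter p) :
    offset (p.trans (rauzyPerm (p w))) (Function.update len w (len w - len (lastLetter p)))
      (lastLetter p) = offset p len w + len w - len (lastLetter p) := by
  set l := lastLetter p with hl
  have hwl := lt_lastLetter p hw
  have hll : (p l : ℕ) = _ := lastLetter_pos p
  unfold offset
  rw [Finset.sum_filter, Finset.sum_filter, add_sub_assoc, ← sub_eq_iff_eq_add',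
    ← Finset.sum_sub_distrib]
  have : ∀ b, ((if (p.trans (rauzyPerm (p w))) b < (p.trans (rauzyPerm (p w))) l then
      Function.update len w (len w - len l) b else 0) - if p b < p w then len b else 0)
      = (if b = w then len w - len l else 0) := by
    intro b
    have hb := (p b).2
    simp only [Equiv.trans_apply, Fin.lt_def, rauzyPerm_apply]
    rcases eq_or_ne b l with rfl | hbl
    · simp only [hw.symm, if_false]
      split_ifs <;> first | omega | simp
    · have hbl' := lt_lastLetter p hbl
      rcases eq_or_ne b w with rfl | hbw
      · simp only [Function.update_self, if_true]
        split_ifs <;> first | omega | simp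
      · rw [Function.update_of_ne hbw]
        have : (p b : ℕ) ≠ p w := fun h => hbw (p.injective (Fin.ext h))
        simp only [hbw, if_false]
        split_ifs <;> first | omega | simp
  rw [Finset.sum_congr rfl fun b _ => this b]
  simp

namespace Data

/-- The left endpoint of the image `j₁(Iₐ)` of the interval `j₀(Iₐ)`, as a real number. -/
def right (D : Data A) (a : A) : ℝ := offset D.bot D.len a

theorem left_nonneg (D : Data A) (a : A) : 0 ≤ D.left a := offset_nonneg _ D.len_pos a

theorem right_nonneg (D : Data A) (a : A) : 0 ≤ D.right a := offset_nonneg _ D.len_pos a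

theorem left_add_len_le (D : Data A) (a : A) : D.left a + D.len a ≤ D.total :=
  offset_add_len_le_total _ D.len_pos a

theorem right_add_len_le (D : Data A) (a : A) : D.right a + D.len a ≤ D.total :=
  offset_add_len_le_total _ D.len_pos a

variable [Nonempty A]

/-- The algorithm does not stop at `D`: the last intervals have different lengths. -/
def Generic (D : Data A) : Prop := D.len D.a₀ ≠ D.len D.a₁

variable {D : Data A}

theorem Generic.cases (h : D.Generic) :
    (D.winner = D.a₀ ∧ D.loser = D.a₁ ∧ D.step.top = D.top ∧
      D.step.bot = D.bot.trans (rauzyPerm (D.bot D.winner))) ∨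
    (D.winner = D.a₁ ∧ D.loser = D.a₀ ∧ D.step.bot = D.bot ∧
      D.step.top = D.top.trans (rauzyPerm (D.top D.winner))) := by
  rcases lt_or_gt_of_ne h with h | h
  · right
    simp [winner, loser, step, h, h.not_gt]
  · left
    simp [winner, loser, step, h]

theorem Generic.len_loser_lt (h : D.Generic) : D.len D.loser < D.len D.winner := by
  rcases lt_or_gt_of_ne h with h | h
  · simp [winner, loser, h, h.not_gt]
  · simp [winner, loser, h]

theorem Generic.winner_ne_loser (h : D.Generic) : D.winner ≠ D.loser := fun h' => by
  have := h.len_loser_lt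
  rw [h'] at this
  exact lt_irrefl _ this

theorem Generic.step_len (h : D.Generic) :
    D.step.len = Function.update D.len D.winner (D.len D.winner - D.len D.loser) := by
  rcases lt_or_gt_of_ne h with h | h
  · simp [winner, loser, step, h, h.not_gt]
  · simp [winner, loser, step, h]

theorem Generic.step_len_winner (h : D.Generic) :
    D.step.len D.winner = D.len D.winner - D.len D.loser := by
  rw [h.step_len, Function.update_self]

theorem Generic.step_len_of_ne (h : D.Generic) {a : A} (ha : a ≠ D.winner) :
    D.step.len a = D.len a := by
  rw [h.step_len, Function.update_of_ne ha]

theorem Generic.step_len_le (h : D.Generic) (a : A) : D.step.len a ≤ D.len a := by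
  rcases eq_or_ne a D.winner with rfl | ha
  · rw [h.step_len_winner]
    linarith [D.len_pos D.loser]
  · rw [h.step_len_of_ne ha]

theorem Generic.step_total (h : D.Generic) : D.step.total = D.total - D.len D.loser := by
  rw [total, h.step_len, sum_update_sub]
  rfl

/-- How the endpoints `L`, `R` of the intervals before and after the exchange change in a step
whose winner `w` is last before the exchange and whose loser `l` is last after it. -/
structure EndpointStep (w l : A) (len L R len' L' R' : A → ℝ) (tot tot' : ℝ) : Prop where
  ne : w ≠ l
  lt : len l < len w
  len_winner : len' w = len w - len l
  len_of_ne : ∀ a, a ≠ w → len' a = len a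
  tot_eq : tot' = tot - len l
  left_eq : ∀ a, L' a = L a
  right_eq : ∀ a, a ≠ l → R' a = R a
  right_loser : R' l = R w + len w - len l
  left_winner : L w + len w = tot
  right_end : R l + len l = tot
  len_pos : ∀ a, 0 < len' a
  left_nonneg : ∀ a, 0 ≤ L' a
  right_nonneg : ∀ a, 0 ≤ R' a
  left_le : ∀ a, L' a + len' a ≤ tot'
  right_le : ∀ a, R' a + len' a ≤ tot'

/-- Passing to the inverse map exchanges left and right endpoints and turns one type of step into
the other. Stating both types through `EndpointStep` lets a statement with this symmetry be proved
for one type only. -/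
theorem Generic.endpoints (h : D.Generic) :
    EndpointStep D.winner D.loser D.len D.left D.right D.step.len D.step.left D.step.right
      D.total D.step.total ∨
    EndpointStep D.winner D.loser D.len D.right D.left D.step.len D.step.right D.step.left
      D.total D.step.total := by
  have hne := h.winner_ne_loser
  rcases h.cases with ⟨h1, h2, h3, h4⟩ | ⟨h1, h2, h3, h4⟩
  · have hb : D.winner ≠ lastLetter D.bot := by
      have : D.loser = lastLetter D.bot := h2
      rwa [← this]
    left
    refine ⟨hne, h.len_loser_lt, h.step_len_winner, fun a => h.step_len_of_ne, h.step_total,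
      fun a => ?_, fun a ha => ?_, ?_, ?_, ?_, D.step.len_pos, D.step.left_nonneg,
      D.step.right_nonneg, D.step.left_add_len_le, D.step.right_add_len_le⟩
    · unfold left
      rw [h3, h.step_len, h1]
      exact offset_update_last _ _ _ _
    · unfold right
      rw [h4, h.step_len]
      rw [h2] at ha ⊢
      exact offset_rauzy D.bot D.len hb ha
    · unfold right
      rw [h4, h.step_len, h2]
      exact offset_rauzy_last D.bot D.len hb
    · rw [h1]
      exact offset_add_len_lastLetter _ _
    · rw [h2]
      exact offset_add_len_lastLetter _ _
  · have hb : D.winner ≠ lastLetter D.top := by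
      have : D.loser = lastLetter D.top := h2
      rwa [← this]
    right
    refine ⟨hne, h.len_loser_lt, h.step_len_winner, fun a => h.step_len_of_ne, h.step_total,
      fun a => ?_, fun a ha => ?_, ?_, ?_, ?_, D.step.len_pos, D.step.right_nonneg,
      D.step.left_nonneg, D.step.right_add_len_le, D.step.left_add_len_le⟩
    · unfold right
      rw [h3, h.step_len, h1]
      exact offset_update_last _ _ _ _
    · unfold left
      rw [h4, h.step_len]
      rw [h2] at ha ⊢
      exact offset_rauzy D.top D.len hb ha
    · unfold left
      rw [h4, h.step_len, h2]
      exact offset_rauzy_last D.top D.len hb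
    · rw [h1]
      exact offset_add_len_lastLetter _ _
    · rw [h2]
      exact offset_add_len_lastLetter _ _

end Data

end Step

/-! ### The interval exchange map in local coordinates. -/

section Dynamics

variable {A : Type*} [Fintype A] [DecidableEq A]

namespace Data

variable (D : Data A)

/-- The point `j₀(x, a)`. -/
def pt (a : A) (x : ℝ) (hx : x ∈ Ico 0 (D.len a)) : D.Dom :=
  ⟨D.left a + x, by
    have := D.left_nonneg a
    have := D.left_add_len_le a
    have := hx.1
    have := hx.2
    constructor <;> linarith⟩

theorem j₀_apply (a : A) (x : ℝ) (hx : x ∈ Ico 0 (D.len a)) :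
    D.j₀ ⟨a, x, hx⟩ = D.pt a x hx := rfl

theorem T_pt (a : A) (x : ℝ) (hx : x ∈ Ico 0 (D.len a)) :
    (D.T (D.pt a x hx) : ℝ) = D.right a + x := by
  rw [← j₀_apply, T, Equiv.trans_apply, Equiv.symm_apply_apply]
  rfl

theorem exists_pt (y : D.Dom) : ∃ a x hx, y = D.pt a x hx := by
  obtain ⟨⟨a, x, hx⟩, rfl⟩ := D.j₀.surjective y
  exact ⟨a, x, hx, rfl⟩

theorem T_apply {y : D.Dom} {a : A} {x : ℝ} (hx : x ∈ Ico 0 (D.len a)) (hy : (y : ℝ) = D.left a + x) :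
    (D.T y : ℝ) = D.right a + x := by
  have : y = D.pt a x hx := Subtype.ext hy
  rw [this, T_pt]

end Data

end Dynamics

/-! ### First return maps; the Keane property and admissibility survive a step. -/

section Keane

variable {A : Type*} [Fintype A] [DecidableEq A] [Nontrivial A]

namespace Data

variable {D : Data A}

theorem two_le_card : 2 ≤ Fintype.card A := Fintype.one_lt_card

/-- The interval exchange map after a step is the first return map of the one before the step. -/
theorem Generic.step_T (h : D.Generic) (y' : D.step.Dom) (y : D.Dom) (hy : (y : ℝ) = y') :
    (D.T y : ℝ) = D.step.T y' ∨ (D.T (D.T y) : ℝ) = D.step.T y' := by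
  obtain ⟨a, x, hx, rfl⟩ := D.step.exists_pt y'
  rw [T_pt]
  change (y : ℝ) = D.step.left a + x at hy
  rcases h.endpoints with e | e
  -- Winner last before the exchange: `T` sends the loser's interval onto the cut-off end of `I`,
  -- which lies in the winner's interval, and one more iterate returns.
  · rcases eq_or_ne a D.loser with rfl | ha
    · right
      have hx' : x ∈ Ico 0 (D.len D.loser) := by rwa [← h.step_len_of_ne h.winner_ne_loser.symm]
      have h1 : (D.T y : ℝ) = D.right D.loser + x := T_apply D hx' (by rw [hy, e.left_eq])
      rw [T_apply D (a := D.winner) (x := D.len D.winner - D.len D.loser + x), e.right_loser]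
      · ring
      · have := e.lt
        exact ⟨by linarith [hx'.1], by linarith [hx'.2]⟩
      · rw [h1]
        linarith [e.left_winner, e.right_end]
    · left
      rw [T_apply D (a := a) (x := x) ⟨hx.1, hx.2.trans_le (h.step_len_le a)⟩ (by rw [hy, e.left_eq]),
        e.right_eq a ha]
  -- Winner last after the exchange: the new interval of the loser is the end of the old interval of
  -- the winner, and `T` sends it onto the old interval of the loser, which is cut off.
  · rcases eq_or_ne a D.loser with rfl | ha
    · right
      have hx' : x ∈ Ico 0 (D.len D.loser) := by rwa [← h.step_len_of_ne h.winner_ne_loser.symm]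
      have h1 : (D.T y : ℝ) = D.right D.winner + (D.len D.winner - D.len D.loser + x) := by
        refine T_apply D ?_ (by rw [hy, e.right_loser]; ring)
        have := e.lt
        exact ⟨by linarith [hx'.1], by linarith [hx'.2]⟩
      rw [T_apply D (a := D.loser) (x := x) hx', e.left_eq]
      rw [h1]
      linarith [e.left_winner, e.right_end]
    · left
      rw [T_apply D (a := a) (x := x) ⟨hx.1, hx.2.trans_le (h.step_len_le a)⟩
        (by rw [hy, e.right_eq a ha]), e.left_eq]

theorem Generic.step_total_le (h : D.Generic) : D.step.total ≤ D.total := by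
  rw [h.step_total]
  linarith [D.len_pos D.loser]

theorem Generic.step_T_iterate (h : D.Generic) (m : ℕ) (y' : D.step.Dom) (y : D.Dom)
    (hy : (y : ℝ) = y') : ∃ m', m ≤ m' ∧ (D.T^[m'] y : ℝ) = D.step.T^[m] y' := by
  induction m generalizing y y' with
  | zero => exact ⟨0, le_rfl, hy⟩
  | succ m ih =>
    rcases h.step_T y' y hy with h1 | h1
    · obtain ⟨m', hm, h2⟩ := ih _ _ h1
      exact ⟨m' + 1, by omega, h2⟩
    · obtain ⟨m', hm, h2⟩ := ih _ _ h1
      exact ⟨m' + 2, by omega, h2⟩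

theorem zero_mem_Ico (D : Data A) (a : A) : (0 : ℝ) ∈ Ico 0 (D.len a) := left_mem_Ico.2 (D.len_pos a)

/-- Used to carry connexions of the new map back to the old one. The shift by one iterate occurs
only for a loser that was last before the exchange: its old left end is the new total length,
outside the new domain. -/
theorem Generic.endpoint_orbit (h : D.Generic) (a : A) (y : D.Dom)
    (hy : (y : ℝ) = D.step.left a) :
    y = D.pt a 0 (D.zero_mem_Ico a) ∨
    (D.T y = D.pt a 0 (D.zero_mem_Ico a) ∧ D.left a = D.step.total) := by
  rcases h.endpoints with e | e
  · left
    apply Subtype.ext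
    change _ = D.left a + 0
    rw [hy, e.left_eq, add_zero]
  · rcases eq_or_ne a D.loser with rfl | ha
    · right
      refine ⟨Subtype.ext ?_, by linarith [e.right_end, e.tot_eq]⟩
      rw [T_apply D (a := D.winner) (x := D.len D.winner - D.len D.loser)]
      · change _ = D.left D.loser + 0
        linarith [e.left_winner, e.right_end]
      · have := e.lt
        exact ⟨by linarith, by linarith [D.len_pos D.loser]⟩
      · rw [hy, e.right_loser]
        ring
    · left
      apply Subtype.ext
      change _ = D.left a + 0
      rw [hy, e.right_eq a ha, add_zero]

theorem Generic.top_pos (h : D.Generic) {b : A} (hb : 0 < (D.step.top b : ℕ)) :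
    0 < (D.top b : ℕ) := by
  rcases h.cases with ⟨-, -, h3, -⟩ | ⟨-, -, -, h4⟩
  · rwa [h3] at hb
  · by_contra h0
    rw [h4, Equiv.trans_apply, rauzyPerm_apply, if_pos (by omega)] at hb
    omega

theorem Keane.step (hK : D.Keane) (h : D.Generic) : D.step.Keane := by
  rintro ⟨a, b, m, hb, hm, hab⟩
  rw [j₀_apply, j₀_apply] at hab
  set ya' := D.step.pt a 0 (D.step.zero_mem_Ico a) with hya'
  set ya : D.Dom := ⟨ya', ya'.2.1, ya'.2.2.trans_le h.step_total_le⟩ with hya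
  obtain ⟨m', hm', h1⟩ := h.step_T_iterate m ya' ya rfl
  rw [hab] at h1
  have hb' := h.top_pos hb
  have h1' : (D.T^[m'] ya : ℝ) = D.step.left b := by
    rw [h1]
    exact add_zero _
  have hlt : (D.T^[m'] ya : ℝ) < D.step.total := by
    rw [h1]
    exact Subtype.prop (D.step.pt b 0 _) |>.2
  -- The extra iterate, if there is one, makes `n` at least `2`; so `n = 1` can only mean that none
  -- was added.
  have key : ∃ n, m' ≤ n ∧ n ≤ m' + 1 ∧ (n = 1 → m' = 1) ∧
      D.T^[n] ya = D.pt b 0 (D.zero_mem_Ico b) := by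
    rcases h.endpoint_orbit b _ h1' with h2 | h2
    · exact ⟨m', le_rfl, by omega, fun h => h, h2⟩
    · refine ⟨m' + 1, by omega, le_rfl, fun h => by omega, ?_⟩
      rw [Function.iterate_succ_apply']
      exact h2.1
  obtain ⟨n, hn, hn', hn1, h2⟩ := key
  rcases h.endpoint_orbit a ya (by simp [hya, hya', pt]) with h3 | ⟨h3, h4⟩
  · rw [h3] at h2
    exact hK ⟨a, b, n, hb', by omega, h2⟩
  · obtain ⟨k, rfl⟩ : ∃ k, n = k + 1 := ⟨n - 1, by omega⟩
    rw [Function.iterate_succ_apply, h3] at h2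
    -- For `k = 0` one iterate of the starting point would be the old left end of `a`, which equals
    -- the new total length, although the orbit returned strictly below it.
    rcases Nat.eq_zero_or_pos k with rfl | hk
    · obtain rfl : m' = 1 := hn1 rfl
      rw [Function.iterate_one, h3] at hlt
      change D.left a + 0 < _ at hlt
      linarith
    · exact hK ⟨a, b, k, hb', hk, h2⟩

/-- With equal last lengths the image of the left end of `a₁` is the left end of `a₀`: a connexion
with `m = 1`. -/
theorem Keane.generic (hK : D.Keane) : D.Generic := fun h => by
  have hc := two_le_card (A := A)
  refine hK ⟨D.a₁, D.a₀, 1, ?_, one_pos, ?_⟩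
  · have := lastLetter_pos D.top
    change (D.top (lastLetter D.top) : ℕ) > 0
    omega
  · rw [j₀_apply, j₀_apply, Function.iterate_one]
    apply Subtype.ext
    rw [T_pt]
    change _ = D.left D.a₀ + 0
    have h1 : D.left D.a₀ + D.len D.a₀ = D.total := offset_add_len_lastLetter _ _
    have h2 : D.right D.a₁ + D.len D.a₁ = D.total := offset_add_len_lastLetter _ _
    linarith

/-- The winner is last in one row, so a common initial block of the new rows omits it. The moved
letter and all displaced ones sit to the right of the winner in the other row, so that block was
already common before the step. -/
theorem Admissible.step (hA : D.Admissible) (h : D.Generic) : D.step.Admissible := by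
  intro k hk hkd heq
  rcases h.cases with ⟨h1, -, h3, h4⟩ | ⟨h1, -, h3, h4⟩
  · have hw : D.winner ∉ {a | (D.step.top a : ℕ) < k} := by
      rw [h3, h1]
      have : (D.top D.a₀ : ℕ) = _ := lastLetter_pos D.top
      simp only [mem_ofPred_eq, this]
      omega
    have hw' := hw
    rw [heq, mem_ofPred_eq, h4, Equiv.trans_apply, rauzyPerm_apply, if_pos le_rfl, not_lt] at hw'
    refine hA k hk hkd ?_
    rw [← h3, heq, h4]
    ext a
    simp only [mem_ofPred_eq, Equiv.trans_apply, rauzyPerm_apply]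
    split_ifs <;> omega
  · have hw : D.winner ∉ {a | (D.step.bot a : ℕ) < k} := by
      rw [h3, h1]
      have : (D.bot D.a₁ : ℕ) = _ := lastLetter_pos D.bot
      simp only [mem_ofPred_eq, this]
      omega
    have hw' := hw
    rw [← heq, mem_ofPred_eq, h4, Equiv.trans_apply, rauzyPerm_apply, if_pos le_rfl, not_lt] at hw'
    refine hA k hk hkd ?_
    rw [← h3, ← heq, h4]
    ext a
    simp only [mem_ofPred_eq, Equiv.trans_apply, rauzyPerm_apply]
    split_ifs <;> omega

theorem iter_succ (D : Data A) (n : ℕ) : D.iter (n + 1) = (D.iter n).step :=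
  Function.iterate_succ_apply' _ _ _

theorem iter_iter (D : Data A) (m n : ℕ) : (D.iter m).iter n = D.iter (m + n) := by
  unfold iter
  rw [add_comm, Function.iterate_add_apply]

theorem Keane.iter (hK : D.Keane) (n : ℕ) : (D.iter n).Keane := by
  induction n with
  | zero => exact hK
  | succ n ih =>
    rw [iter_succ]
    exact ih.step ih.generic

theorem Keane.iter_generic (hK : D.Keane) (n : ℕ) : (D.iter n).Generic := (hK.iter n).generic

theorem Admissible.iter (hA : D.Admissible) (hK : D.Keane) (n : ℕ) : (D.iter n).Admissible := by
  induction n with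
  | zero => exact hA
  | succ n ih =>
    rw [iter_succ]
    exact ih.step (hK.iter_generic n)

end Data

end Keane

/-! ### Every letter wins infinitely often. -/

section Winners

open Filter

variable {A : Type*} [Fintype A] [DecidableEq A] [Nontrivial A]

theorem eventually_succ_eq_of_bounded {f : ℕ → ℕ} (d : ℕ) (hd : ∀ n, f n ≤ d)
    (hf : ∀ᶠ n in atTop, f n ≤ f (n + 1)) : ∀ᶠ n in atTop, f (n + 1) = f n := by
  obtain ⟨N, hN⟩ := eventually_atTop.1 hf
  have hmono : Monotone fun n => f (N + n) :=
    monotone_nat_of_le_succ fun n => hN (N + n) (by omega)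
  obtain ⟨M, hM⟩ : ∃ M, ∀ n, f (N + n) ≤ f (N + M) := by
    have hfin : (range fun n => f (N + n)).Finite :=
      (finite_Iic d).subset (by rintro _ ⟨n, rfl⟩; exact hd _)
    obtain ⟨_, ⟨M, rfl⟩, hM⟩ := hfin.exists_maximal (range_nonempty _)
    refine ⟨M, fun n => ?_⟩
    rcases le_total (f (N + n)) (f (N + M)) with h | h
    · exact h
    · exact hM ⟨n, rfl⟩ h
  filter_upwards [eventually_ge_atTop (N + M)] with n hn
  obtain ⟨j, rfl⟩ : ∃ j, n = N + j := ⟨n - N, by omega⟩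
  have h1 := hM j
  have h2 := hM (j + 1)
  have h3 : f (N + M) ≤ f (N + j) := hmono (by omega)
  have h4 : f (N + M) ≤ f (N + (j + 1)) := hmono (by omega)
  rw [add_assoc]
  omega

theorem eq_setOf_lt_ncard {d : ℕ} (p : A ≃ Fin d) (X : Set A) (h : ∀ x ∈ X, ∀ y ∉ X, p x < p y) :
    X = {a | (p a : ℕ) < X.ncard} := by
  obtain ⟨k, hkd, hk⟩ : ∃ k ≤ d, X = {a | (p a : ℕ) < k} := by
    by_cases hX : Xᶜ.Nonempty
    · obtain ⟨y, hy, hmin⟩ := Set.exists_min_image Xᶜ p (Set.toFinite _) hX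
      refine ⟨p y, (p y).2.le, ?_⟩
      ext a
      refine ⟨fun ha => h a ha y hy, fun ha => ?_⟩
      by_contra haX
      exact absurd (Fin.le_def.1 (hmin a haX)) (not_le.2 ha)
    · refine ⟨d, le_rfl, ?_⟩
      ext a
      have : a ∈ X := by
        by_contra haX
        exact hX ⟨a, haX⟩
      simp [this]
  have hcard : X.ncard = k := by
    have : X = p.symm '' {i | (i : ℕ) < k} := by
      rw [hk]
      ext a
      simp
    rw [this, Set.ncard_image_of_injective _ p.symm.injective, Set.ncard_eq_toFinset_card']
    simp [Fin.card_filter_val_lt, hkd]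
  rw [hcard]
  exact hk

namespace Data

variable {D : Data A}

theorem total_pos (D : Data A) : 0 < D.total :=
  Finset.sum_pos (fun a _ => D.len_pos a) Finset.univ_nonempty

/-- A letter that no longer wins keeps its length, and each of its losses removes that length from
the total. The totals decrease and stay positive, so their differences tend to zero and the losses
must stop. -/
theorem eventually_loser_ne (hK : D.Keane) {b : A}
    (hb : ∀ᶠ n in atTop, (D.iter n).winner ≠ b) : ∀ᶠ n in atTop, (D.iter n).loser ≠ b := by
  obtain ⟨N, hN⟩ := eventually_atTop.1 hb
  have hlen : ∀ n, (D.iter (N + n)).len b = (D.iter N).len b := by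
    intro n
    induction n with
    | zero => rfl
    | succ n ih =>
      rw [← add_assoc, iter_succ, (hK.iter_generic _).step_len_of_ne (hN _ (by omega)).symm, ih]
  have hanti : Antitone fun n => (D.iter n).total := antitone_nat_of_succ_le fun n => by
    rw [iter_succ]
    exact (hK.iter_generic n).step_total_le
  have hlim := tendsto_atTop_ciInf hanti ⟨0, by rintro _ ⟨n, rfl⟩; exact (total_pos _).le⟩
  have hdiff := hlim.sub (hlim.comp (tendsto_add_atTop_nat 1))
  rw [sub_self] at hdiff
  filter_upwards [hdiff.eventually (gt_mem_nhds ((D.iter N).len_pos b)), eventually_ge_atTop N]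
    with n hn hNn hl
  simp only [Function.comp_apply, iter_succ, (hK.iter_generic n).step_total, hl] at hn
  obtain ⟨j, rfl⟩ : ∃ j, n = N + j := ⟨n - N, by omega⟩
  rw [hlen] at hn
  linarith

theorem Generic.not_last_of_ne (h : D.Generic) {b : A} (hw : D.winner ≠ b)
    (hl : D.loser ≠ b) : (D.top b : ℕ) < Fintype.card A - 1 ∧ (D.bot b : ℕ) < Fintype.card A - 1 := by
  rcases h.cases with ⟨h1, h2, -⟩ | ⟨h1, h2, -⟩
  · rw [h1] at hw
    rw [h2] at hl
    exact ⟨lt_lastLetter _ hw.symm, lt_lastLetter _ hl.symm⟩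
  · rw [h1] at hw
    rw [h2] at hl
    exact ⟨lt_lastLetter _ hl.symm, lt_lastLetter _ hw.symm⟩

/-- Under the Keane property, each letter is the name of infinitely many steps. -/
theorem frequently_winner (hA : D.Admissible) (hK : D.Keane) (a : A) :
    ∃ᶠ n in atTop, (D.iter n).winner = a := by
  by_contra hcon
  -- `X` collects the letters that win only finitely often. It will turn out to be an initial block
  -- of both rows, against admissibility.
  set X : Set A := {b | ∀ᶠ n in atTop, (D.iter n).winner ≠ b} with hX
  have haX : a ∈ X := not_frequently.1 hcon
  have hXw : ∀ b ∈ X, ∀ᶠ n in atTop, (D.iter n).winner ≠ b := fun b hb => hb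
  have hpos : ∀ b ∈ X, ∀ᶠ n in atTop,
      ((D.iter n).top b : ℕ) < Fintype.card A - 1 ∧ ((D.iter n).bot b : ℕ) < Fintype.card A - 1 := by
    intro b hb
    filter_upwards [hXw b hb, eventually_loser_ne hK (hXw b hb)] with n h1 h2
    exact (hK.iter_generic n).not_last_of_ne h1 h2
  -- A letter that is not last can only be pushed to the right. As letters of `X` are eventually
  -- never last, their positions stabilize.
  have hmove : ∀ (n : ℕ) (b : A), ((D.iter n).top b : ℕ) < Fintype.card A - 1 →
      ((D.iter n).top b : ℕ) ≤ (D.iter (n + 1)).top b := by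
    intro n b hb
    rw [iter_succ]
    rcases (hK.iter_generic n).cases with ⟨-, -, h3, -⟩ | ⟨-, -, -, h4⟩
    · rw [h3]
    · rw [h4, Equiv.trans_apply, rauzyPerm_apply]
      split_ifs <;> omega
  have hmove' : ∀ (n : ℕ) (b : A), ((D.iter n).bot b : ℕ) < Fintype.card A - 1 →
      ((D.iter n).bot b : ℕ) ≤ (D.iter (n + 1)).bot b := by
    intro n b hb
    rw [iter_succ]
    rcases (hK.iter_generic n).cases with ⟨-, -, -, h4⟩ | ⟨-, -, h3, -⟩
    · rw [h4, Equiv.trans_apply, rauzyPerm_apply]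
      split_ifs <;> omega
    · rw [h3]
  have hev : ∀ᶠ n in atTop, ∀ b ∈ X,
      ((D.iter n).top b : ℕ) < Fintype.card A - 1 ∧ ((D.iter n).bot b : ℕ) < Fintype.card A - 1 ∧
      ((D.iter (n + 1)).top b : ℕ) = (D.iter n).top b ∧
      ((D.iter (n + 1)).bot b : ℕ) = (D.iter n).bot b := by
    rw [eventually_all]
    intro b
    by_cases hb : b ∈ X
    · have h1 := hpos b hb
      have h2 := eventually_succ_eq_of_bounded (f := fun n => ((D.iter n).top b : ℕ))
        (Fintype.card A) (fun n => ((D.iter n).top b).2.le) (by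
          filter_upwards [h1] with n hn using hmove n b hn.1)
      have h3 := eventually_succ_eq_of_bounded (f := fun n => ((D.iter n).bot b : ℕ))
        (Fintype.card A) (fun n => ((D.iter n).bot b).2.le) (by
          filter_upwards [h1] with n hn using hmove' n b hn.2)
      filter_upwards [h1, h2, h3] with n h1 h2 h3 _
      exact ⟨h1.1, h1.2, h2, h3⟩
    · exact Eventually.of_forall fun n h => absurd h hb
  obtain ⟨N, hN⟩ := eventually_atTop.1 hev
  -- A letter of `X` to the right of the winner in the row that changes would be pushed by the
  -- insertion; in the other row the winner is last.
  have hwin : ∀ n, N ≤ n → ∀ b ∈ X, ((D.iter n).top b : ℕ) ≤ (D.iter n).top (D.iter n).winner ∧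
      ((D.iter n).bot b : ℕ) ≤ (D.iter n).bot (D.iter n).winner := by
    intro n hn b hb
    obtain ⟨h1, h2, h3, h4⟩ := hN n hn b hb
    rcases (hK.iter_generic n).cases with ⟨e1, -, -, e4⟩ | ⟨e1, -, -, e4⟩
    · have h5 : ((D.iter n).top (D.iter n).winner : ℕ) = Fintype.card A - 1 := by rw [e1]; exact lastLetter_pos _
      refine ⟨by omega, ?_⟩
      rw [iter_succ, e4, Equiv.trans_apply, rauzyPerm_apply] at h4
      split_ifs at h4 <;> omega
    · have h5 : ((D.iter n).bot (D.iter n).winner : ℕ) = Fintype.card A - 1 := by rw [e1]; exact lastLetter_pos _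
      refine ⟨?_, by omega⟩
      rw [iter_succ, e4, Equiv.trans_apply, rauzyPerm_apply] at h3
      split_ifs at h3 <;> omega
  have hpres : ∀ n, N ≤ n → ∀ c, (∀ b ∈ X, ((D.iter n).top b : ℕ) ≤ (D.iter n).top c ∧
      ((D.iter n).bot b : ℕ) ≤ (D.iter n).bot c) → ∀ b ∈ X,
      ((D.iter (n + 1)).top b : ℕ) ≤ (D.iter (n + 1)).top c ∧
      ((D.iter (n + 1)).bot b : ℕ) ≤ (D.iter (n + 1)).bot c := by
    intro n hn c hc b hb
    obtain ⟨-, -, h3, h4⟩ := hN n hn b hb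
    obtain ⟨h5, h6⟩ := hc b hb
    obtain ⟨h7, h8⟩ := hwin n hn b hb
    have := ((D.iter n).top c).2
    have := ((D.iter n).bot c).2
    rw [h3, h4]
    rw [iter_succ]
    rcases (hK.iter_generic n).cases with ⟨-, -, e3, e4⟩ | ⟨-, -, e3, e4⟩
    · refine ⟨by rwa [e3], ?_⟩
      rw [e4, Equiv.trans_apply, rauzyPerm_apply]
      split_ifs <;> omega
    · refine ⟨?_, by rwa [e3]⟩
      rw [e4, Equiv.trans_apply, rauzyPerm_apply]
      split_ifs <;> omega
  -- Every letter outside `X` wins once more after time `N`; at that moment it is to the right of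
  -- `X` in both rows, and it stays there.
  have hfin : ∀ᶠ n in atTop, ∀ c ∉ X, ∀ b ∈ X, ((D.iter n).top b : ℕ) ≤ (D.iter n).top c ∧
      ((D.iter n).bot b : ℕ) ≤ (D.iter n).bot c := by
    rw [eventually_all]
    intro c
    by_cases hc : c ∈ X
    · exact Eventually.of_forall fun n h => absurd hc h
    · have hc' : ∃ᶠ n in atTop, (D.iter n).winner = c := by
        simpa [hX, Filter.Frequently] using hc
      obtain ⟨n, hn, hwn⟩ := (frequently_atTop.1 hc') N
      filter_upwards [eventually_ge_atTop n] with m hm _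
      induction m, hm using Nat.le_induction with
      | base =>
        have := hwin n hn
        rwa [hwn] at this
      | succ m hm ih => exact hpres m (by omega) c ih
  obtain ⟨n, hn⟩ := hfin.exists
  have hXne : X ≠ univ := by
    intro h
    have : ∀ᶠ n in atTop, ∀ b, (D.iter n).winner ≠ b := by
      rw [eventually_all]
      intro b
      exact hXw b (by rw [h]; trivial)
    obtain ⟨n, hn⟩ := this.exists
    exact hn _ rfl
  have ht := eq_setOf_lt_ncard (D.iter n).top X fun x hx y hy =>
    lt_of_le_of_ne (Fin.le_def.2 (hn y hy x hx).1) fun h =>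
      hy ((D.iter n).top.injective h ▸ hx)
  have hb := eq_setOf_lt_ncard (D.iter n).bot X fun x hx y hy =>
    lt_of_le_of_ne (Fin.le_def.2 (hn y hy x hx).2) fun h =>
      hy ((D.iter n).bot.injective h ▸ hx)
  refine (hA.iter hK n) X.ncard ((Set.ncard_pos).2 ⟨a, haX⟩) ?_ (ht.symm.trans hb)
  rw [← Nat.card_eq_fintype_card]
  exact Set.ncard_lt_card hXne

end Data

end Winners

/-! ### Norms and column sums of nonnegative matrices. -/

section Norm

variable {A : Type*} [Fintype A] [DecidableEq A] [Nonempty A]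

theorem matNorm_nonneg (M : Matrix A A ℝ) : 0 ≤ matNorm M :=
  Finset.sum_nonneg fun _ _ => Finset.sum_nonneg fun _ _ => abs_nonneg _

theorem abs_apply_le_matNorm (M : Matrix A A ℝ) (a b : A) : |M a b| ≤ matNorm M :=
  (Finset.single_le_sum (f := fun b => |M a b|) (fun _ _ => abs_nonneg _)
    (Finset.mem_univ b)).trans
  (Finset.single_le_sum (f := fun a => ∑ b, |M a b|)
    (fun _ _ => Finset.sum_nonneg fun _ _ => abs_nonneg _) (Finset.mem_univ a))

theorem matNorm_mul_le (M N : Matrix A A ℝ) : matNorm (M * N) ≤ matNorm M * matNorm N := by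
  have h : ∀ a b, |(M * N) a b| ≤ ∑ c, |M a c| * |N c b| := fun a b => by
    rw [Matrix.mul_apply]
    exact (Finset.abs_sum_le_sum_abs _ _).trans
      (Finset.sum_le_sum fun c _ => (abs_mul _ _).le)
  calc matNorm (M * N) ≤ ∑ a, ∑ b, ∑ c, |M a c| * |N c b| :=
        Finset.sum_le_sum fun a _ => Finset.sum_le_sum fun b _ => h a b
    _ = ∑ a, ∑ c, |M a c| * ∑ b, |N c b| := by
        refine Finset.sum_congr rfl fun a _ => ?_
        rw [Finset.sum_comm]
        simp_rw [Finset.mul_sum]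
    _ ≤ ∑ a, ∑ c, |M a c| * matNorm N := by
        gcongr with a _ c _
        exact Finset.single_le_sum (f := fun a => ∑ b, |N a b|)
          (fun _ _ => Finset.sum_nonneg fun _ _ => abs_nonneg _) (Finset.mem_univ c)
    _ = _ := by simp_rw [← Finset.sum_mul]; rfl

theorem norm_mulVec_le (M : Matrix A A ℝ) (v : A → ℝ) : ‖M *ᵥ v‖ ≤ matNorm M * ‖v‖ := by
  refine (pi_norm_le_iff_of_nonneg (mul_nonneg (matNorm_nonneg M) (norm_nonneg v))).2 fun a => ?_
  calc ‖(M *ᵥ v) a‖ ≤ ∑ b, |M a b * v b| := Finset.abs_sum_le_sum_abs _ _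
    _ ≤ ∑ b, |M a b| * ‖v‖ := by
        gcongr with b
        rw [abs_mul]
        gcongr
        exact norm_le_pi_norm v b
    _ = (∑ b, |M a b|) * ‖v‖ := by rw [Finset.sum_mul]
    _ ≤ _ := by
        gcongr
        exact Finset.single_le_sum (f := fun a => ∑ b, |M a b|)
          (fun _ _ => Finset.sum_nonneg fun _ _ => abs_nonneg _) (Finset.mem_univ a)

theorem matNorm_transpose (M : Matrix A A ℝ) : matNorm Mᵀ = matNorm M := by
  unfold matNorm
  rw [Finset.sum_comm]
  rfl

theorem Big.matNorm_eq {M : Matrix A A ℝ} (hM : Big M) : matNorm M = ∑ b, ∑ a, M a b := by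
  unfold matNorm
  rw [Finset.sum_comm]
  simp_rw [abs_of_nonneg (hM.1 _ _)]

/-- The sum of the coefficients of a column of a matrix. -/
def colSum (M : Matrix A A ℝ) (b : A) : ℝ := ∑ a, M a b

theorem Big.one_le_colSum {M : Matrix A A ℝ} (hM : Big M) (b : A) : 1 ≤ colSum M b :=
  (hM.2 b).trans (Finset.single_le_sum (f := fun a => M a b) (fun a _ => hM.1 a b)
    (Finset.mem_univ b))

theorem Big.colSum_le {M : Matrix A A ℝ} (hM : Big M) (b : A) : colSum M b ≤ matNorm M := by
  rw [hM.matNorm_eq]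
  exact Finset.single_le_sum (f := fun b => ∑ a, M a b)
    (fun b _ => Finset.sum_nonneg fun a _ => hM.1 a b) (Finset.mem_univ b)

theorem colSum_mul (M N : Matrix A A ℝ) (b : A) :
    colSum (M * N) b = ∑ c, colSum M c * N c b := by
  unfold colSum
  simp_rw [Matrix.mul_apply, Finset.sum_mul]
  rw [Finset.sum_comm]

theorem matNorm_le_matNorm_mul {M N : Matrix A A ℝ} (hM : Big M) (hN : Big N) :
    matNorm M ≤ matNorm (M * N) := by
  rw [hM.matNorm_eq, (hM.mul hN).matNorm_eq]
  refine Finset.sum_le_sum fun b _ => ?_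
  change colSum M b ≤ colSum (M * N) b
  rw [colSum_mul]
  calc colSum M b = colSum M b * 1 := (mul_one _).symm
    _ ≤ colSum M b * N b b := mul_le_mul_of_nonneg_left (hN.2 b)
        (zero_le_one.trans (hM.one_le_colSum b))
    _ ≤ _ := Finset.single_le_sum (f := fun c => colSum M c * N c b) (fun c _ => mul_nonneg
        (zero_le_one.trans (hM.one_le_colSum c)) (hN.1 c b)) (Finset.mem_univ b)

/-- A positive factor mixes the columns: each column of the product dominates the sum of all columns
of `M`. This is what later balances the return times. -/
theorem matNorm_le_colSum_mul {M N : Matrix A A ℝ} (hM : Big M) (hN : ∀ a b, 1 ≤ N a b) (b : A) :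
    matNorm M ≤ colSum (M * N) b := by
  rw [hM.matNorm_eq, colSum_mul]
  refine Finset.sum_le_sum fun c _ => ?_
  exact le_mul_of_one_le_right (zero_le_one.trans (hM.one_le_colSum c)) (hN c b)

theorem matNorm_le_of_le_colSum {M N : Matrix A A ℝ} (hM : Big M) (hN : Big N) {t : ℝ}
    (ht : ∀ b, t ≤ colSum M b) : t * matNorm N ≤ matNorm (M * N) := by
  rw [hN.matNorm_eq, (hM.mul hN).matNorm_eq, Finset.mul_sum]
  refine Finset.sum_le_sum fun b _ => ?_
  change _ ≤ colSum (M * N) b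
  rw [colSum_mul, Finset.mul_sum]
  exact Finset.sum_le_sum fun c _ => mul_le_mul_of_nonneg_right (ht c) (hN.1 c b)

end Norm

/-! ### Times of the accelerated algorithm and positivity of its matrices. -/

section Times

variable {A : Type*} [Fintype A] [DecidableEq A] [Nontrivial A]

namespace Data

variable (D : Data A)

/-- The ordered product of the matrices of the steps `m, …, n - 1`. -/
def W (m n : ℕ) : Matrix A A ℝ := ((List.range' m (n - m)).map D.V).prod

theorem W_self (m : ℕ) : D.W m m = 1 := by simp [W]

theorem W_mul {m n p : ℕ} (h1 : m ≤ n) (h2 : n ≤ p) : D.W m n * D.W n p = D.W m p := by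
  obtain ⟨i, rfl⟩ := Nat.exists_eq_add_of_le h1
  obtain ⟨j, rfl⟩ := Nat.exists_eq_add_of_le h2
  unfold W
  rw [← List.prod_append, ← List.map_append, show m + i - m = i by omega,
    show m + i + j - (m + i) = j by omega, show m + i + j - m = i + j by omega]
  have := List.range'_append (s := m) (m := i) (n := j) (step := 1)
  rw [one_mul] at this
  rw [this]

theorem W_succ {m n : ℕ} (h : m ≤ n) : D.W m (n + 1) = D.W m n * D.V n := by
  rw [← D.W_mul h n.le_succ]
  congr 1
  simp [W]

theorem big_W (m n : ℕ) : Big (D.W m n) := Big.list_prod _ (big_V D) _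

theorem V_mul_apply (M : Matrix A A ℝ) (n : ℕ) (a b : A) :
    (M * D.V n) a b = M a b + if b = (D.iter n).loser then M a (D.iter n).winner else 0 := by
  rw [V, mul_add, mul_one, Matrix.add_apply]
  congr 1
  split_ifs with h
  · rw [h, Matrix.mul_single_apply_same, mul_one]
  · rw [Matrix.mul_single_apply_of_ne]
    exact h

variable {D} (hA : D.Admissible) (hK : D.Keane)

include hA hK

/-- By maximality of the block, one more step brings in the missing name. That step has index `time
(k + 1)` and opens the next block, hence the non-strict upper bound. -/
theorem time_spec (k : ℕ) : D.time k < D.time (k + 1) ∧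
    ∀ a, ∃ n, D.time k ≤ n ∧ n ≤ D.time (k + 1) ∧ (D.iter n).winner = a := by
  have hc := two_le_card (A := A)
  set s := D.time k with hs
  set X : Set ℕ := {N | s ≤ N ∧ D.nameCount s N ≤ Fintype.card A - 1} with hX
  have htime : D.time (k + 1) = sSup X := rfl
  have hmono : ∀ N N', N ≤ N' → D.nameCount s N ≤ D.nameCount s N' := fun N N' h =>
    Finset.card_le_card (Finset.image_subset_image (Finset.Ico_subset_Ico_right h))
  obtain ⟨N₀, hN₀⟩ : ∃ N₀, ∀ a, ∃ n, s ≤ n ∧ n < N₀ ∧ (D.iter n).winner = a := by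
    have : ∀ a, ∃ n, s ≤ n ∧ (D.iter n).winner = a := fun a => by
      obtain ⟨n, hn, h⟩ := (Filter.frequently_atTop.1 (frequently_winner hA hK a)) s
      exact ⟨n, hn, h⟩
    choose f hf using this
    refine ⟨Finset.univ.sup f + 1, fun a => ⟨f a, (hf a).1, ?_, (hf a).2⟩⟩
    exact Nat.lt_succ_of_le (Finset.le_sup (Finset.mem_univ a))
  -- Boundedness matters: the supremum of an unbounded set of naturals would be the default value
  -- `0`. It holds because all names have been taken before `N₀`.
  have hbdd : BddAbove X := by
    refine ⟨N₀, fun N hN => ?_⟩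
    by_contra hlt
    have h1 := hmono N₀ N (by omega)
    have h2 : D.nameCount s N₀ = Fintype.card A := by
      unfold nameCount
      rw [← Finset.card_univ]
      congr 1
      refine Finset.eq_univ_of_forall fun a => ?_
      obtain ⟨n, hn, hn', h⟩ := hN₀ a
      exact Finset.mem_image.2 ⟨n, Finset.mem_Ico.2 ⟨hn, hn'⟩, h⟩
    have := hN.2
    omega
  have hmem : s + 1 ∈ X := ⟨by omega, by
    have : D.nameCount s (s + 1) = 1 := by
      unfold nameCount
      rw [Nat.Ico_succ_singleton]
      simp
    omega⟩
  refine ⟨?_, fun a => ?_⟩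
  · rw [htime]
    exact Nat.lt_of_succ_le (le_csSup hbdd hmem)
  · have h1 : sSup X ∈ X := Nat.sSup_mem ⟨_, hmem⟩ hbdd
    have h2 : sSup X + 1 ∉ X := fun h => by
      have := le_csSup hbdd h
      omega
    have h3 : ¬ D.nameCount s (sSup X + 1) ≤ Fintype.card A - 1 := fun h =>
      h2 ⟨by have := h1.1; omega, h⟩
    have h4 : D.nameCount s (sSup X + 1) = Fintype.card A :=
      le_antisymm (Finset.card_le_univ _) (by omega)
    have h5 := (Finset.card_eq_iff_eq_univ _).1 h4
    have h6 := Finset.mem_univ a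
    rw [← h5, Finset.mem_image] at h6
    obtain ⟨n, hn, h⟩ := h6
    rw [Finset.mem_Ico] at hn
    exact ⟨n, hn.1, by rw [htime]; omega, h⟩

theorem time_strictMono : StrictMono D.time :=
  strictMono_nat_of_lt_succ fun k => (time_spec hA hK k).1

theorem Q_eq_W {k l : ℕ} (h : k ≤ l) : D.Q k l = D.W (D.time k) (D.time l) := by
  obtain ⟨j, rfl⟩ := Nat.exists_eq_add_of_le h
  have hm := (time_strictMono hA hK).monotone
  induction j with
  | zero => simp [Q, W_self]
  | succ j ih =>
    have h1 : D.Q k (k + (j + 1)) = D.Q k (k + j) * D.Zsucc (k + j) := by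
      unfold Q
      rw [show k + (j + 1) - k = j + 1 by omega, show k + j - k = j by omega,
        List.range'_concat, List.map_append, List.prod_append]
      simp
    rw [h1, ih (by omega), ← D.W_mul (hm (show k ≤ k + j by omega))
      (hm (show k + j ≤ k + (j + 1) by omega))]
    rfl

theorem Q_mul {j k l : ℕ} (h1 : j ≤ k) (h2 : k ≤ l) : D.Q j k * D.Q k l = D.Q j l := by
  have hm := (time_strictMono hA hK).monotone
  rw [Q_eq_W hA hK h1, Q_eq_W hA hK h2, Q_eq_W hA hK (h1.trans h2), D.W_mul (hm h1) (hm h2)]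

theorem Zsucc_eq (k : ℕ) : D.Zsucc k = D.Q k (k + 1) := by
  rw [Q_eq_W hA hK k.le_succ]
  rfl

omit hA hK in
theorem Q_self (k : ℕ) : D.Q k k = 1 := by simp [Q]

omit hA in
-- The winner keeps its last place in its own row, so it is one of the two competitors of the next
-- step.
theorem winner_persists (n : ℕ) : (D.iter n).winner = (D.iter (n + 1)).winner ∨
    (D.iter n).winner = (D.iter (n + 1)).loser := by
  have h := hK.iter_generic n
  have h' := hK.iter_generic (n + 1)
  rw [iter_succ] at h' ⊢
  rcases h.cases with ⟨e1, -, e3, -⟩ | ⟨e1, -, e3, -⟩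
  · have : (D.iter n).winner = (D.iter n).step.a₀ := by
      rw [e1, a₀, a₀, e3]
    rcases h'.cases with ⟨f1, f2, -⟩ | ⟨f1, f2, -⟩
    · left; rw [this, f1]
    · right; rw [this, f2]
  · have : (D.iter n).winner = (D.iter n).step.a₁ := by
      rw [e1, a₁, a₁, e3]
    rcases h'.cases with ⟨f1, f2, -⟩ | ⟨f1, f2, -⟩
    · right; rw [this, f2]
    · left; rw [this, f1]

/-- If the support `B` of row `a` did not grow over four blocks, then during this window a winner in
`B` would force the loser into `B`. Since a winner competes again at the next step, a winner outside
`B` would then be followed only by winners outside `B`. But a letter outside `B` wins in the first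
block or at the opening step of the second, and `a`, which is in `B`, wins from the third block on,
at the latest at the opening step of the fourth. -/
theorem support_grows (m : ℕ) (a : A) (k : ℕ) (hm : m ≤ D.time k)
    (hne : {b | 1 ≤ D.W m (D.time k) a b} ≠ univ) :
    {b | 1 ≤ D.W m (D.time k) a b} ⊂ {b | 1 ≤ D.W m (D.time (k + 4)) a b} := by
  have htm := time_strictMono hA hK
  set B : ℕ → Set A := fun n => {b | 1 ≤ D.W m n a b} with hB
  have hstep : ∀ n, m ≤ n → B n ⊆ B (n + 1) := fun n hn b hb => by
    have h1 : 1 ≤ D.W m n a b := hb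
    have h2 := (D.big_W m n).1 a (D.iter n).winner
    change 1 ≤ D.W m (n + 1) a b
    rw [D.W_succ hn, V_mul_apply]
    split_ifs <;> linarith
  have hmono : ∀ n n', m ≤ n → n ≤ n' → B n ⊆ B n' := fun n n' hn hnn' => by
    induction n', hnn' using Nat.le_induction with
    | base => exact subset_rfl
    | succ n' h ih => exact ih.trans (hstep n' (by omega))
  have hle : D.time k ≤ D.time (k + 4) := htm.monotone (by omega)
  refine (hmono _ _ hm hle).ssubset_of_ne fun heq => ?_
  change B (D.time k) = B (D.time (k + 4)) at heq
  have hconst : ∀ n, D.time k ≤ n → n ≤ D.time (k + 4) → B n = B (D.time k) := fun n h1 h2 =>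
    ((hmono n _ (by omega) h2).trans heq.symm.subset).antisymm (hmono _ n hm h1)
  have hlose : ∀ n, D.time k ≤ n → n < D.time (k + 4) →
      (D.iter n).winner ∈ B (D.time k) → (D.iter n).loser ∈ B (D.time k) := fun n h1 h2 hw => by
    rw [← hconst (n + 1) (by omega) h2]
    rw [← hconst n h1 h2.le] at hw
    have h3 : 1 ≤ D.W m n a (D.iter n).winner := hw
    have h4 := (D.big_W m n).1 a (D.iter n).loser
    change 1 ≤ D.W m (n + 1) a (D.iter n).loser
    rw [D.W_succ (by omega), V_mul_apply, if_pos rfl]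
    linarith
  have hpersist : ∀ n, D.time k ≤ n → n + 1 < D.time (k + 4) →
      (D.iter n).winner ∉ B (D.time k) → (D.iter (n + 1)).winner ∉ B (D.time k) := by
    intro n h1 h2 hw hw'
    rcases winner_persists hK n with h | h
    · exact hw (h ▸ hw')
    · exact hw (h ▸ hlose (n + 1) (by omega) h2 hw')
  have hpersist' : ∀ n n', D.time k ≤ n → n ≤ n' → n' < D.time (k + 4) →
      (D.iter n).winner ∉ B (D.time k) → (D.iter n').winner ∉ B (D.time k) := by
    intro n n' h1 h2 h3 hw
    induction n', h2 using Nat.le_induction with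
    | base => exact hw
    | succ n' h ih => exact hpersist n' (by omega) h3 (ih (by omega))
  obtain ⟨b, hb⟩ := (Set.ne_univ_iff_exists_notMem _).1 hne
  obtain ⟨n, hn1, hn2, hn3⟩ := (time_spec hA hK k).2 b
  obtain ⟨n', hn1', hn2', hn3'⟩ := (time_spec hA hK (k + 2)).2 a
  have t1 := htm (show k + 1 < k + 2 by omega)
  have t2 := htm (show k + 3 < k + 4 by omega)
  have t3 : D.time (k + 2 + 1) = D.time (k + 3) := rfl
  refine hpersist' n n' hn1 (by omega) (by omega) (by rw [hn3]; exact hb) ?_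
  rw [hn3']
  exact hmono m (D.time k) le_rfl hm (show a ∈ B m by simp [hB, W_self])

/-- After sufficiently many steps, the matrices of the algorithm have positive coefficients. -/
theorem one_le_Q (k : ℕ) (a b : A) : 1 ≤ D.Q k (k + 4 * Fintype.card A) a b := by
  have htm := time_strictMono hA hK
  have key : ∀ i, {b | 1 ≤ D.W (D.time k) (D.time (k + 4 * i)) a b} = univ ∨
      i ≤ {b | 1 ≤ D.W (D.time k) (D.time (k + 4 * i)) a b}.ncard := by
    intro i
    induction i with
    | zero => right; simp
    | succ i ih =>
      by_cases h : {b | 1 ≤ D.W (D.time k) (D.time (k + 4 * i)) a b} = univ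
      · left
        refine eq_univ_of_forall fun b => ?_
        have hle : D.time (k + 4 * i) ≤ D.time (k + 4 * (i + 1)) := htm.monotone (by omega)
        have hle' : D.time k ≤ D.time (k + 4 * i) := htm.monotone (by omega)
        have hb : b ∈ {b | 1 ≤ D.W (D.time k) (D.time (k + 4 * i)) a b} := by rw [h]; trivial
        have hb' : 1 ≤ D.W (D.time k) (D.time (k + 4 * i)) a b := hb
        change 1 ≤ D.W (D.time k) (D.time (k + 4 * (i + 1))) a b
        rw [← D.W_mul hle' hle, Matrix.mul_apply]
        refine le_trans (one_le_mul_of_one_le_of_one_le hb' ((D.big_W _ _).2 b))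
          (Finset.single_le_sum (f := fun c => D.W (D.time k) (D.time (k + 4 * i)) a c *
            D.W (D.time (k + 4 * i)) (D.time (k + 4 * (i + 1))) c b) (fun c _ => mul_nonneg
            ((D.big_W _ _).1 a c) ((D.big_W _ _).1 c b)) (Finset.mem_univ b))
      · right
        have h1 := support_grows hA hK (D.time k) a (k + 4 * i) (htm.monotone (by omega)) h
        have h2 := Set.ncard_lt_ncard h1 (Set.toFinite _)
        have h3 := ih.resolve_left h
        exact lt_of_le_of_lt h3 h2
  have huniv : {b | 1 ≤ D.W (D.time k) (D.time (k + 4 * Fintype.card A)) a b} = univ := by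
    rcases key (Fintype.card A) with h | h
    · exact h
    · by_contra hne
      have := Set.ncard_lt_card hne
      rw [Nat.card_eq_fintype_card] at this
      omega
  have : b ∈ {b | 1 ≤ D.W (D.time k) (D.time (k + 4 * Fintype.card A)) a b} := by
    rw [huniv]; trivial
  rw [Q_eq_W hA hK (by omega)]
  exact this

omit hA in
theorem V_mulVec_len (n : ℕ) : D.V n *ᵥ (D.iter (n + 1)).len = (D.iter n).len := by
  have h := hK.iter_generic n
  rw [V, Matrix.add_mulVec, Matrix.one_mulVec, iter_succ]
  ext a
  rw [Pi.add_apply, Matrix.single_mulVec, Function.update_apply]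
  rcases eq_or_ne a (D.iter n).winner with rfl | ha
  · rw [if_pos rfl, h.step_len_winner, h.step_len_of_ne h.winner_ne_loser.symm]
    ring
  · rw [if_neg ha, h.step_len_of_ne ha]
    simp

omit hA in
theorem W_mulVec_len {m n : ℕ} (h : m ≤ n) : D.W m n *ᵥ (D.iter n).len = (D.iter m).len := by
  induction n, h using Nat.le_induction with
  | base => rw [W_self, Matrix.one_mulVec]
  | succ n h ih => rw [D.W_succ h, ← Matrix.mulVec_mulVec, V_mulVec_len hK, ih]

omit hA in
theorem det_W {m n : ℕ} (h : m ≤ n) : (D.W m n).det = 1 := by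
  induction n, h using Nat.le_induction with
  | base => rw [W_self, Matrix.det_one]
  | succ n h ih =>
    rw [D.W_succ h, Matrix.det_mul, ih, one_mul]
    exact Matrix.det_transvection_of_ne _ _ (hK.iter_generic n).winner_ne_loser 1

end Data

end Times

/-! ### Growth of the norms `q k` and balance of the return times. -/

section Growth

variable {A : Type*} [Fintype A] [DecidableEq A] [Nontrivial A]

namespace Data

/-- The norm of `Q(k) = Q(0, k)`. -/
def q (D : Data A) (k : ℕ) : ℝ := matNorm (D.Q 0 k)

variable {D : Data A} 

theorem one_le_q (k : ℕ) : 1 ≤ D.q k := one_le_matNorm (big_Q D 0 k)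

theorem q_pos (k : ℕ) : 0 < D.q k := zero_lt_one.trans_le (one_le_q k)

theorem rpow_pos_q (k : ℕ) (s : ℝ) : 0 < D.q k ^ s := Real.rpow_pos_of_pos (q_pos k) s

theorem q_rpow_le (k : ℕ) {s t : ℝ} (h : s ≤ t) : D.q k ^ s ≤ D.q k ^ t :=
  Real.rpow_le_rpow_of_exponent_le (one_le_q k) h

theorem q_rpow_mul (k : ℕ) (s t : ℝ) : D.q k ^ s * D.q k ^ t = D.q k ^ (s + t) :=
  (Real.rpow_add (q_pos k) s t).symm

theorem one_le_q_rpow (k : ℕ) {s : ℝ} (hs : 0 ≤ s) : 1 ≤ D.q k ^ s :=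
  Real.one_le_rpow (one_le_q k) hs

section

variable (hA : D.Admissible) (hK : D.Keane)

include hA hK

theorem q_mono : Monotone D.q := monotone_nat_of_le_succ fun k => by
  unfold q
  rw [← Q_mul hA hK (Nat.zero_le k) k.le_succ]
  exact matNorm_le_matNorm_mul (big_Q D _ _) (big_Q D _ _)

theorem q_rpow_mono {s : ℝ} (hs : 0 ≤ s) {j k : ℕ} (h : j ≤ k) : D.q j ^ s ≤ D.q k ^ s :=
  Real.rpow_le_rpow (q_pos j).le (q_mono hA hK h) hs

theorem q_rpow_anti {s : ℝ} (hs : s ≤ 0) {j k : ℕ} (h : j ≤ k) : D.q k ^ s ≤ D.q j ^ s :=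
  Real.rpow_le_rpow_of_nonpos (q_pos j) (q_mono hA hK h) hs

/-- Each column of the longer product dominates the whole norm of `Q(k)`, and there are at least two
columns. -/
theorem two_mul_q_le (k : ℕ) : 2 * D.q k ≤ D.q (k + 4 * Fintype.card A) := by
  unfold q
  rw [← Q_mul hA hK (Nat.zero_le k) (show k ≤ k + 4 * Fintype.card A by omega),
    ((big_Q D 0 k).mul (big_Q D _ _)).matNorm_eq]
  calc 2 * matNorm (D.Q 0 k) ≤ Fintype.card A * matNorm (D.Q 0 k) := by
        gcongr
        · exact matNorm_nonneg _
        · exact_mod_cast two_le_card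
    _ = ∑ _b : A, matNorm (D.Q 0 k) := by simp
    _ ≤ _ := Finset.sum_le_sum fun b _ =>
        matNorm_le_colSum_mul (big_Q D _ _) (one_le_Q hA hK k) b

/-- Exponential growth is what makes negative powers of `q` summable and lets any polynomial in `k`
be absorbed into a small power of `q k`. The factor `2` covers the indices below `4 d`. -/
theorem exists_pow_le_q : ∃ ρ > (1 : ℝ), ∀ k, ρ ^ k ≤ 2 * D.q k := by
  set m := 4 * Fintype.card A with hm
  have hm0 : 0 < m := by
    have := two_le_card (A := A)
    omega
  refine ⟨2 ^ ((m : ℝ)⁻¹), Real.one_lt_rpow one_lt_two (by positivity), fun k => ?_⟩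
  have hρ : ((2 : ℝ) ^ ((m : ℝ)⁻¹)) ^ m = 2 := Real.rpow_inv_natCast_pow (by norm_num) hm0.ne'
  have h1 : (1 : ℝ) ≤ 2 ^ ((m : ℝ)⁻¹) := Real.one_le_rpow one_le_two (by positivity)
  induction k using Nat.strong_induction_on with
  | _ k ih =>
    rcases lt_or_ge k m with h | h
    · calc ((2 : ℝ) ^ ((m : ℝ)⁻¹)) ^ k ≤ ((2 : ℝ) ^ ((m : ℝ)⁻¹)) ^ m := pow_le_pow_right₀ h1 h.le
        _ = 2 := hρ
        _ ≤ 2 * D.q k := by linarith [one_le_q (D := D) k]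
    · obtain ⟨j, rfl⟩ : ∃ j, k = j + m := ⟨k - m, by omega⟩
      rw [pow_add, hρ]
      have := ih j (by omega)
      have := two_mul_q_le hA hK j
      linarith

theorem summable_q_rpow {s : ℝ} (hs : 0 < s) : Summable fun k => D.q k ^ (-s) := by
  obtain ⟨ρ, hρ, h⟩ := exists_pow_le_q hA hK
  have hρ0 : 0 < ρ := by linarith
  have hr : ρ ^ (-s) < 1 := Real.rpow_lt_one_of_one_lt_of_neg hρ (by linarith)
  refine Summable.of_nonneg_of_le (fun k => (rpow_pos_q k _).le) (fun k => ?_)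
    ((summable_geometric_of_lt_one (Real.rpow_pos_of_pos hρ0 _).le hr).mul_left (2 ^ s))
  have h1 : (2 * D.q k) ^ (-s) ≤ (ρ ^ k) ^ (-s) :=
    Real.rpow_le_rpow_of_nonpos (by positivity) (h k) (by linarith)
  rw [Real.mul_rpow (by norm_num) (q_pos k).le] at h1
  calc D.q k ^ (-s) = 2 ^ s * (2 ^ (-s) * D.q k ^ (-s)) := by
        rw [← mul_assoc, ← Real.rpow_add (by norm_num)]
        simp
    _ ≤ 2 ^ s * (ρ ^ k) ^ (-s) := by gcongr
    _ = 2 ^ s * (ρ ^ (-s)) ^ k := by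
        rw [← Real.rpow_natCast, ← Real.rpow_natCast, ← Real.rpow_mul hρ0.le, ← Real.rpow_mul hρ0.le,
          mul_comm (k : ℝ)]

theorem tendsto_q_rpow {s : ℝ} (hs : 0 < s) :
    Filter.Tendsto (fun k => D.q k ^ (-s)) Filter.atTop (nhds 0) :=
  (summable_q_rpow hA hK hs).tendsto_atTop_zero

/-- The sum over `j ≤ k` of a power of `q k` is at most a slightly larger power. -/
theorem succ_mul_q_rpow_le {s : ℝ} (hs : 0 < s) :
    ∃ C > 0, ∀ k : ℕ, ((k : ℝ) + 1) ≤ C * D.q k ^ s := by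
  have hsum := summable_q_rpow hA hK hs
  have hpos : 0 < ∑' k, D.q k ^ (-s) :=
    hsum.tsum_pos (fun k => (rpow_pos_q k _).le) 0 (rpow_pos_q 0 _)
  refine ⟨∑' k, D.q k ^ (-s), hpos, fun k => ?_⟩
  have h1 : ∑ j ∈ Finset.range (k + 1), D.q k ^ (-s) ≤ ∑' k, D.q k ^ (-s) :=
    (Finset.sum_le_sum fun j hj => q_rpow_anti hA hK (by linarith)
      (Nat.lt_succ_iff.1 (Finset.mem_range.1 hj))).trans
      (hsum.sum_le_tsum _ fun j _ => (rpow_pos_q j _).le)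
  rw [Finset.sum_const, Finset.card_range, nsmul_eq_mul, Real.rpow_neg (q_pos k).le,
    ← div_eq_mul_inv, div_le_iff₀ (rpow_pos_q k _)] at h1
  exact_mod_cast h1

/-- Half of the exponent is spent at the first index, by monotonicity of `q`; the other half pays
for convergence, uniformly in `k`. -/
theorem tsum_q_rpow_le {s : ℝ} (hs : 0 < s) : ∃ C > 0, ∀ k : ℕ, ∀ t ≥ 2 * s,
    Summable (fun i => D.q (k + i) ^ (-t)) ∧ ∑' i, D.q (k + i) ^ (-t) ≤ C * D.q k ^ (-s) := by
  have hsum := summable_q_rpow hA hK hs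
  have hpos : 0 < ∑' k, D.q k ^ (-s) :=
    hsum.tsum_pos (fun k => (rpow_pos_q k _).le) 0 (rpow_pos_q 0 _)
  refine ⟨∑' k, D.q k ^ (-s), hpos, fun k t ht => ?_⟩
  have hs' : Summable fun i => D.q (k + i) ^ (-s) := by
    simpa only [add_comm] using (summable_nat_add_iff k).2 hsum
  have hle : ∀ i, D.q (k + i) ^ (-t) ≤ D.q (k + i) ^ (-s) * D.q k ^ (-s) := fun i => by
    calc D.q (k + i) ^ (-t) ≤ D.q (k + i) ^ (-s + -s) := q_rpow_le _ (by linarith)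
      _ = D.q (k + i) ^ (-s) * D.q (k + i) ^ (-s) := (q_rpow_mul _ _ _).symm
      _ ≤ _ := mul_le_mul_of_nonneg_left (q_rpow_anti hA hK (by linarith) (by omega))
          (rpow_pos_q _ _).le
  have hS : Summable (fun i => D.q (k + i) ^ (-t)) :=
    Summable.of_nonneg_of_le (fun i => (rpow_pos_q _ _).le) hle (hs'.mul_right _)
  refine ⟨hS, (hS.tsum_le_tsum hle (hs'.mul_right _)).trans ?_⟩
  rw [tsum_mul_right]
  refine mul_le_mul_of_nonneg_right ?_ (rpow_pos_q _ _).le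
  have := hsum.sum_add_tsum_nat_add k
  have h0 : 0 ≤ ∑ i ∈ Finset.range k, D.q i ^ (-s) :=
    Finset.sum_nonneg fun i _ => (rpow_pos_q _ _).le
  simp only [add_comm k]
  linarith

theorem S_apply {k l : ℕ} (v : A → ℝ) : D.S k l v = (D.Q k l)ᵀ *ᵥ v := rfl

theorem S_comp {j k l : ℕ} (h1 : j ≤ k) (h2 : k ≤ l) (v : A → ℝ) :
    D.S k l (D.S j k v) = D.S j l v := by
  simp only [S, Matrix.mulVecLin_apply, Matrix.mulVec_mulVec]
  rw [← Matrix.transpose_mul, Q_mul hA hK h1 h2]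

omit hA hK in
theorem S_self (k : ℕ) (v : A → ℝ) : D.S k k v = v := by
  simp [S, Q_self]

omit hA hK in
theorem norm_S_le (k l : ℕ) (v : A → ℝ) : ‖D.S k l v‖ ≤ matNorm (D.Q k l) * ‖v‖ := by
  rw [← matNorm_transpose]
  exact norm_mulVec_le _ _

theorem det_Q {k l : ℕ} (h : k ≤ l) : (D.Q k l).det = 1 := by
  rw [Q_eq_W hA hK h]
  exact det_W hK ((time_strictMono hA hK).monotone h)

theorem S_injective {k l : ℕ} (h : k ≤ l) : Function.Injective (D.S k l) := by
  have : IsUnit (D.Q k l)ᵀ := by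
    rw [Matrix.isUnit_iff_isUnit_det, Matrix.det_transpose, det_Q hA hK h]
    exact isUnit_one
  exact Matrix.mulVec_injective_of_isUnit this

theorem S_surjective {k l : ℕ} (h : k ≤ l) : Function.Surjective (D.S k l) :=
  LinearMap.injective_iff_surjective.1 (S_injective hA hK h)

/-- The matrix has determinant one, so its inverse is its adjugate, whose entries are polynomials in
entries bounded by `q k`. The exponent `d` is crude, but any fixed power suffices. -/
theorem norm_le_norm_S : ∃ C > (0 : ℝ), ∀ k v,
    ‖v‖ ≤ C * D.q k ^ (Fintype.card A : ℝ) * ‖D.S 0 k v‖ := by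
  set d := Fintype.card A with hd
  have hd0 : 0 < d := Fintype.card_pos
  refine ⟨d * (d * d.factorial), by positivity, fun k v => ?_⟩
  have hq := one_le_q (D := D) k
  set M := (D.Q 0 k)ᵀ with hM
  have hdet : M.det = 1 := by rw [hM, Matrix.det_transpose, det_Q hA hK k.zero_le]
  have hv : v = M.adjugate *ᵥ (M *ᵥ v) := by
    rw [Matrix.mulVec_mulVec, Matrix.adjugate_mul, hdet, one_smul, Matrix.one_mulVec]
  have hentry : ∀ a b, |M a b| ≤ D.q k := fun a b => abs_apply_le_matNorm (D.Q 0 k) b a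
  have hadj : ∀ a b, |M.adjugate a b| ≤ d.factorial * D.q k ^ d := fun a b => by
    rw [Matrix.adjugate_apply]
    -- The replaced row has entries `0` and `1`, bounded by `q k` because `1 ≤ q k`.
    have := Matrix.det_le (A := M.updateRow b (Pi.single a 1)) (abv := IsAbsoluteValue.toAbsoluteValue (abs : ℝ → ℝ))
      (x := D.q k) (fun i j => by
        change |_| ≤ _
        rw [Matrix.updateRow_apply]
        split_ifs
        · rw [Pi.single_apply]
          split_ifs
          · simpa using hq
          · simpa using zero_le_one.trans hq
        · exact hentry i j)
    rwa [nsmul_eq_mul] at this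
  have hnorm : matNorm M.adjugate ≤ d * (d * d.factorial) * D.q k ^ (d : ℝ) := by
    rw [Real.rpow_natCast]
    calc matNorm M.adjugate ≤ ∑ _a : A, ∑ _b : A, (d.factorial * D.q k ^ d : ℝ) :=
          Finset.sum_le_sum fun a _ => Finset.sum_le_sum fun b _ => hadj a b
      _ = _ := by
          simp only [Finset.sum_const, Finset.card_univ, nsmul_eq_mul]
          ring
  calc ‖v‖ = ‖M.adjugate *ᵥ (M *ᵥ v)‖ := by rw [← hv]
    _ ≤ matNorm M.adjugate * ‖M *ᵥ v‖ := norm_mulVec_le _ _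
    _ ≤ _ := mul_le_mul_of_nonneg_right hnorm (norm_nonneg _)

theorem Q_mulVec_len {k l : ℕ} (h : k ≤ l) :
    D.Q k l *ᵥ (D.iter (D.time l)).len = (D.iter (D.time k)).len := by
  rw [Q_eq_W hA hK h]
  exact W_mulVec_len hK ((time_strictMono hA hK).monotone h)

end

variable (hA : D.Admissible) (hK : D.Keane) (ha : D.CondA)

include hA hK ha

theorem matNorm_Q_succ_le {s : ℝ} (hs : 0 < s) : ∃ C > 0, ∀ k, matNorm (D.Q k (k + 1)) ≤ C * D.q k ^ s := by
  obtain ⟨C, hC, h⟩ := ha s hs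
  refine ⟨C, hC, fun k => ?_⟩
  rw [← Zsucc_eq hA hK]
  exact h k

theorem matNorm_Q_add_le (m : ℕ) {s : ℝ} (hs : 0 < s) :
    ∃ C > 0, ∀ k, matNorm (D.Q k (k + m)) ≤ C * D.q (k + m) ^ s := by
  induction m generalizing s with
  | zero =>
    refine ⟨matNorm (1 : Matrix A A ℝ), zero_lt_one.trans_le (one_le_matNorm Big.one), fun k => ?_⟩
    rw [add_zero, Q_self]
    exact le_mul_of_one_le_right (matNorm_nonneg _) (one_le_q_rpow k hs.le)
  | succ m ih =>
    obtain ⟨C, hC, h⟩ := ih (half_pos hs)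
    obtain ⟨E, hE, h'⟩ := matNorm_Q_succ_le hA hK ha (half_pos hs)
    refine ⟨C * E, by positivity, fun k => ?_⟩
    rw [← Q_mul hA hK (show k ≤ k + m by omega) (show k + m ≤ k + (m + 1) by omega)]
    refine (matNorm_mul_le _ _).trans ?_
    calc matNorm (D.Q k (k + m)) * matNorm (D.Q (k + m) (k + (m + 1)))
        ≤ (C * D.q (k + m) ^ (s / 2)) * (E * D.q (k + m) ^ (s / 2)) :=
          mul_le_mul (h k) (h' (k + m)) (matNorm_nonneg _) (mul_pos hC (rpow_pos_q _ _)).le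
      _ = C * E * D.q (k + m) ^ s := by
          rw [mul_mul_mul_comm, q_rpow_mul, add_halves]
      _ ≤ _ := by
          exact mul_le_mul_of_nonneg_left (q_rpow_mono hA hK hs.le (by omega)) (by positivity)

/-- Column sums are return times. After `4 d` blocks each of them dominates the earlier norm `q j`,
while by (a) the norm has grown only by a small power; so all return times agree with `q k` up to
small powers. The constant `q m` handles the first `m` indices. -/
theorem q_rpow_le_colSum {s : ℝ} (hs : 0 < s) :
    ∃ C > 0, ∀ k b, D.q k ^ (1 - s) ≤ C * colSum (D.Q 0 k) b := by
  set m := 4 * Fintype.card A with hm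
  obtain ⟨C, hC, h⟩ := matNorm_Q_add_le hA hK ha m hs
  refine ⟨max C (D.q m), lt_max_of_lt_left hC, fun k b => ?_⟩
  have hc : 1 ≤ colSum (D.Q 0 k) b := (big_Q D 0 k).one_le_colSum b
  rcases le_total k m with hk | hk
  · calc D.q k ^ (1 - s) ≤ D.q k ^ (1 : ℝ) := q_rpow_le k (by linarith)
      _ = D.q k := Real.rpow_one _
      _ ≤ D.q m := q_mono hA hK hk
      _ ≤ max C (D.q m) * 1 := by rw [mul_one]; exact le_max_right _ _
      _ ≤ _ := mul_le_mul_of_nonneg_left hc (hC.le.trans (le_max_left _ _))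
  · obtain ⟨j, rfl⟩ : ∃ j, k = j + m := ⟨k - m, by omega⟩
    have h1 : D.q j ≤ colSum (D.Q 0 (j + m)) b := by
      rw [← Q_mul hA hK (Nat.zero_le j) (show j ≤ j + m by omega)]
      exact matNorm_le_colSum_mul (big_Q D _ _) (one_le_Q hA hK j) b
    have h2 : D.q (j + m) ≤ D.q j * (C * D.q (j + m) ^ s) := by
      conv_lhs => rw [q, ← Q_mul hA hK (Nat.zero_le j) (show j ≤ j + m by omega)]
      exact (matNorm_mul_le _ _).trans (mul_le_mul_of_nonneg_left (h j) (q_pos j).le)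
    calc D.q (j + m) ^ (1 - s) = D.q (j + m) * D.q (j + m) ^ (-s) := by
          rw [sub_eq_add_neg, Real.rpow_add (q_pos _), Real.rpow_one]
      _ ≤ D.q j * (C * D.q (j + m) ^ s) * D.q (j + m) ^ (-s) :=
          mul_le_mul_of_nonneg_right h2 (rpow_pos_q _ _).le
      _ = C * D.q j := by
          rw [mul_assoc, mul_assoc, q_rpow_mul, add_neg_cancel, Real.rpow_zero]
          ring
      _ ≤ _ := mul_le_mul (le_max_left _ _) h1 (q_pos j).le (hC.le.trans (le_max_left _ _))

/-- The total length is the sum of return time times length, so a lower bound for the return times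
is an upper bound for the lengths. -/
theorem len_iter_time_le {s : ℝ} (hs : 0 < s) :
    ∃ C > 0, ∀ k b, (D.iter (D.time k)).len b ≤ C * D.q k ^ (-1 + s) := by
  obtain ⟨C, hC, h⟩ := q_rpow_le_colSum hA hK ha hs
  refine ⟨C * D.total, mul_pos hC D.total_pos, fun k b => ?_⟩
  have hl := (D.iter (D.time k)).len_pos
  have h1 : colSum (D.Q 0 k) b * (D.iter (D.time k)).len b ≤ D.total := by
    have h2 : ∑ c, colSum (D.Q 0 k) c * (D.iter (D.time k)).len c = D.total := by
      have h3 : D.len = D.Q 0 k *ᵥ (D.iter (D.time k)).len := (Q_mulVec_len hA hK k.zero_le).symm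
      rw [total]
      conv_rhs => rw [h3]
      simp only [colSum, Finset.sum_mul, Matrix.mulVec, dotProduct]
      rw [Finset.sum_comm]
    rw [← h2]
    exact Finset.single_le_sum (f := fun c => colSum (D.Q 0 k) c * (D.iter (D.time k)).len c)
      (fun c _ => mul_nonneg (zero_le_one.trans ((big_Q D 0 k).one_le_colSum c)) (hl c).le)
      (Finset.mem_univ b)
  have h4 : D.q k ^ (1 - s) * (D.iter (D.time k)).len b ≤ C * D.total := by
    calc _ ≤ C * colSum (D.Q 0 k) b * (D.iter (D.time k)).len b :=
          mul_le_mul_of_nonneg_right (h k b) (hl b).le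
      _ = C * (colSum (D.Q 0 k) b * (D.iter (D.time k)).len b) := by ring
      _ ≤ _ := mul_le_mul_of_nonneg_left h1 hC.le
  calc (D.iter (D.time k)).len b
      = D.q k ^ (1 - s) * (D.iter (D.time k)).len b * D.q k ^ (-1 + s) := by
        rw [mul_right_comm, q_rpow_mul]
        simp
    _ ≤ _ := mul_le_mul_of_nonneg_right h4 (rpow_pos_q _ _).le

/-- Because the columns of `Q(j)` are balanced, the norm is multiplicative up to a small power:
`‖Q(j, k)‖` is almost `q k / q j`. -/
theorem matNorm_Q_le {s : ℝ} (hs : 0 < s) :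
    ∃ C > 0, ∀ j k, j ≤ k → matNorm (D.Q j k) ≤ C * D.q k * D.q j ^ (-1 + s) := by
  obtain ⟨C, hC, h⟩ := q_rpow_le_colSum hA hK ha hs
  refine ⟨C, hC, fun j k hjk => ?_⟩
  have h1 : D.q j ^ (1 - s) * C⁻¹ * matNorm (D.Q j k) ≤ D.q k := by
    rw [q, q, ← Q_mul hA hK (Nat.zero_le j) hjk]
    refine matNorm_le_of_le_colSum (big_Q D _ _) (big_Q D _ _) fun b => ?_
    rw [← div_eq_mul_inv, div_le_iff₀ hC, mul_comm]
    exact h j b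
  calc matNorm (D.Q j k)
      = C * (D.q j ^ (1 - s) * C⁻¹ * matNorm (D.Q j k)) * D.q j ^ (-1 + s) := by
        have : D.q j ^ (1 - s) * D.q j ^ (-1 + s) = 1 := by rw [q_rpow_mul]; simp
        field_simp
        linear_combination (-matNorm (D.Q j k)) * this
    _ ≤ _ := by
        have := rpow_pos_q (D := D) j (-1 + s)
        gcongr

end Data

end Growth

/-! ### Sequences that nearly follow the cocycle. -/

section Sequences

variable {A : Type*} [Fintype A] [DecidableEq A] [Nontrivial A]

namespace Data

/-- The error made at time `k` by a sequence of vectors that nearly follows the cocycle `S`. -/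
def defect (D : Data A) (u : ℕ → A → ℝ) : ℕ → A → ℝ
  | 0 => u 0
  | k + 1 => u (k + 1) - D.S k (k + 1) (u k)

variable {D : Data A} (hA : D.Admissible) (hK : D.Keane)

include hA hK

theorem eq_sum_defect (u : ℕ → A → ℝ) (k : ℕ) :
    u k = ∑ j ∈ Finset.range (k + 1), D.S j k (D.defect u j) := by
  induction k with
  | zero => simp [defect, S_self]
  | succ k ih =>
    rw [Finset.sum_range_succ, S_self, defect]
    have : ∑ j ∈ Finset.range (k + 1), D.S j (k + 1) (D.defect u j) = D.S k (k + 1) (u k) := by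
      conv_rhs => rw [ih, map_sum]
      refine Finset.sum_congr rfl fun j hj => ?_
      rw [S_comp hA hK (Nat.lt_succ_iff.1 (Finset.mem_range.1 hj)) k.le_succ]
    rw [this]
    abel

theorem norm_le_of_terms {u : ℕ → A → ℝ} {C p : ℝ} (hC : 0 < C)
    (h : ∀ k j, j ≤ k → ‖D.S j k (D.defect u j)‖ ≤ C * D.q k ^ p) {s : ℝ} (hs : 0 < s) :
    ∃ E > 0, ∀ k, ‖u k‖ ≤ E * D.q k ^ (p + s) := by
  obtain ⟨B, hB, h'⟩ := succ_mul_q_rpow_le hA hK hs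
  refine ⟨C * B, by positivity, fun k => ?_⟩
  rw [eq_sum_defect hA hK u k]
  calc _ ≤ ∑ j ∈ Finset.range (k + 1), C * D.q k ^ p :=
        norm_sum_le_of_le _ fun j hj => h k j (Nat.lt_succ_iff.1 (Finset.mem_range.1 hj))
    _ = ((k : ℝ) + 1) * (C * D.q k ^ p) := by simp
    _ ≤ (B * D.q k ^ s) * (C * D.q k ^ p) :=
        mul_le_mul_of_nonneg_right (h' k) (mul_pos hC (rpow_pos_q _ _)).le
    _ = C * B * D.q k ^ (p + s) := by
        rw [← q_rpow_mul]
        ring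

/-- `S(k, l)` is the transpose of the matrix that takes the new lengths to the old ones, so the
integral is preserved. -/
theorem sum_len_mul_S {k l : ℕ} (h : k ≤ l) (v : A → ℝ) :
    ∑ a, (D.iter (D.time l)).len a * D.S k l v a = ∑ a, (D.iter (D.time k)).len a * v a := by
  have h1 := Q_mulVec_len hA hK h
  have h2 : (D.iter (D.time l)).len ⬝ᵥ D.S k l v = (D.iter (D.time k)).len ⬝ᵥ v := by
    rw [S_apply hA hK, Matrix.mulVec_transpose, dotProduct_comm, ← Matrix.dotProduct_mulVec, h1,
      dotProduct_comm]
  exact h2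

/-- Defects made at times `j ≤ k` are split at `q j = q k ^ η`. An early one is pulled back to time
`0`, where even a loss of a fixed power of `q j` is a small power of `q k`; for a late one, a
negative power of `q j` is already a negative power of `q k`. -/
theorem small_regime {k j : ℕ} {η : ℝ} (h : D.q j ≤ D.q k ^ η) {s : ℝ} (hs : 0 ≤ s) :
    D.q j ^ s ≤ D.q k ^ (η * s) := by
  rw [Real.rpow_mul (q_pos k).le]
  exact Real.rpow_le_rpow (q_pos j).le h hs

theorem large_regime {k j : ℕ} {η : ℝ} (h : D.q k ^ η ≤ D.q j) {s : ℝ} (hs : 0 ≤ s) :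
    D.q j ^ (-s) ≤ D.q k ^ (-(η * s)) := by
  rw [← mul_neg, Real.rpow_mul (q_pos k).le]
  exact Real.rpow_le_rpow_of_nonpos (rpow_pos_q k η) h (by linarith)

/-- A sequence of vectors of mean value zero that follows the cocycle up to subpolynomial errors
grows slower than `‖Q(k)‖`. -/
theorem norm_le_of_meanZero (ha : D.CondA) (hb : D.CondB) (u : ℕ → A → ℝ)
    (hu : ∀ k, ∑ a, (D.iter (D.time k)).len a * u k a = 0)
    (he : ∀ s > (0 : ℝ), ∃ C > (0 : ℝ), ∀ k, ‖D.defect u k‖ ≤ C * D.q k ^ s) :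
    ∃ δ > (0 : ℝ), ∃ C > (0 : ℝ), ∀ k, ‖u k‖ ≤ C * D.q k ^ (1 - δ) := by
  obtain ⟨θ, hθ, B, hB, hb⟩ := hb
  have hmean : ∀ k, ∑ a, (D.iter (D.time k)).len a * D.defect u k a = 0 := by
    intro k
    cases k with
    | zero => exact hu 0
    | succ k =>
      simp only [defect, Pi.sub_apply, mul_sub, Finset.sum_sub_distrib]
      rw [hu, sum_len_mul_S hA hK k.le_succ, hu, sub_zero]
  set d : ℝ := (Fintype.card A : ℝ) with hd
  have hd0 : 0 ≤ d := Nat.cast_nonneg _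
  -- Chosen so that the loss `η * (d + 1)` of an early defect uses up half of the spectral gap.
  set η : ℝ := θ / (2 * (d + 1)) with hη
  have hη0 : 0 < η := by positivity
  obtain ⟨C₁, hC₁, h1⟩ := he (1 / 4) (by norm_num)
  obtain ⟨C₂, hC₂, h2⟩ := matNorm_Q_le hA hK ha (s := 1 / 4) (by norm_num)
  obtain ⟨C₃, hC₃, h3⟩ := norm_le_norm_S hA hK
  set δ : ℝ := min (θ / 2) (η / 2) with hδ
  have hδ0 : 0 < δ := lt_min (by positivity) (by positivity)
  have key : ∀ k j, j ≤ k →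
      ‖D.S j k (D.defect u j)‖ ≤ (B * C₃ * C₁ + C₂ * C₁) * D.q k ^ (1 - δ) := by
    intro k j hjk
    have hp := rpow_pos_q (D := D) k (1 - δ)
    rcases le_total (D.q j) (D.q k ^ η) with h | h
    -- Early defect: its pull-back to time `0` still has mean value zero, so (b) applies.
    · obtain ⟨v, hv⟩ := S_surjective hA hK j.zero_le (D.defect u j)
      have hv0 : ∑ a, D.len a * v a = 0 := by
        rw [← hmean j, ← hv, sum_len_mul_S hA hK j.zero_le]
        rfl
      have hvn : ‖v‖ ≤ C₃ * C₁ * D.q k ^ (η * (d + 1)) := by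
        calc ‖v‖ ≤ C₃ * D.q j ^ d * ‖D.S 0 j v‖ := h3 j v
          _ ≤ C₃ * D.q j ^ d * (C₁ * D.q j ^ (1 / 4 : ℝ)) := by
              rw [hv]
              exact mul_le_mul_of_nonneg_left (h1 j) (mul_pos hC₃ (rpow_pos_q _ _)).le
          _ = C₃ * C₁ * D.q j ^ (d + 1 / 4) := by rw [← q_rpow_mul]; ring
          _ ≤ C₃ * C₁ * D.q j ^ (d + 1) := by
              exact mul_le_mul_of_nonneg_left (q_rpow_le _ (by norm_num)) (by positivity)
          _ ≤ _ := by
              refine mul_le_mul_of_nonneg_left ?_ (by positivity)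
              exact small_regime hA hK h (by positivity)
      rw [← hv, S_comp hA hK j.zero_le hjk]
      calc ‖D.S 0 k v‖ ≤ B * D.q k ^ (1 - θ) * ‖v‖ := hb k v hv0
        _ ≤ B * D.q k ^ (1 - θ) * (C₃ * C₁ * D.q k ^ (η * (d + 1))) :=
            mul_le_mul_of_nonneg_left hvn (mul_pos hB (rpow_pos_q _ _)).le
        _ = B * C₃ * C₁ * D.q k ^ (1 - θ + η * (d + 1)) := by rw [← q_rpow_mul]; ring
        _ ≤ B * C₃ * C₁ * D.q k ^ (1 - δ) := by
            refine mul_le_mul_of_nonneg_left (q_rpow_le _ ?_) (by positivity)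
            have : η * (d + 1) = θ / 2 := by
              rw [hη]
              field_simp
            have := min_le_left (θ / 2) (η / 2)
            linarith
        _ ≤ _ := mul_le_mul_of_nonneg_right (le_add_of_nonneg_right (by positivity)) hp.le
    -- Late defect: near multiplicativity of the norm gains `q j ^ (-3/4)`, of which the defect
    -- gives back only `q j ^ (1/4)`.
    · calc ‖D.S j k (D.defect u j)‖ ≤ matNorm (D.Q j k) * ‖D.defect u j‖ := norm_S_le _ _ _
        _ ≤ (C₂ * D.q k * D.q j ^ (-1 + 1 / 4 : ℝ)) * (C₁ * D.q j ^ (1 / 4 : ℝ)) :=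
            mul_le_mul (h2 j k hjk) (h1 j) (norm_nonneg _)
              (mul_pos (mul_pos hC₂ (q_pos _)) (rpow_pos_q _ _)).le
        _ = C₂ * C₁ * D.q k * D.q j ^ (-(1 / 2) : ℝ) := by
            rw [mul_mul_mul_comm, q_rpow_mul, mul_right_comm C₂]
            norm_num
        _ ≤ C₂ * C₁ * D.q k * D.q k ^ (-(η * (1 / 2))) :=
            mul_le_mul_of_nonneg_left (large_regime hA hK h (by norm_num))
              (mul_pos (mul_pos hC₂ hC₁) (q_pos _)).le
        _ = C₂ * C₁ * D.q k ^ (1 - η / 2) := by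
            conv_lhs => rw [mul_assoc, ← Real.rpow_one (D.q k), ← Real.rpow_mul (q_pos k).le, one_mul, q_rpow_mul]
            ring_nf
        _ ≤ C₂ * C₁ * D.q k ^ (1 - δ) := by
            refine mul_le_mul_of_nonneg_left (q_rpow_le _ ?_) (by positivity)
            have := min_le_right (θ / 2) (η / 2)
            linarith
        _ ≤ _ := mul_le_mul_of_nonneg_right (le_add_of_nonneg_left (by positivity)) hp.le
  obtain ⟨E, hE, h⟩ := norm_le_of_terms hA hK (by positivity) key (half_pos hδ0)
  refine ⟨δ / 2, half_pos hδ0, E, hE, fun k => ?_⟩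
  have := h k
  rwa [show 1 - δ + δ / 2 = 1 - δ / 2 by ring] at this

theorem matNorm_Q_mono_left {j k l : ℕ} (h1 : j ≤ k) (h2 : k ≤ l) :
    matNorm (D.Q k l) ≤ matNorm (D.Q j l) := by
  rw [← Q_mul hA hK h1 h2]
  have := matNorm_le_of_le_colSum (big_Q D j k) (big_Q D k l)
    (fun b => (big_Q D j k).one_le_colSum b)
  rwa [one_mul] at this

theorem matNorm_Q_mono_right {j k l : ℕ} (h1 : j ≤ k) (h2 : k ≤ l) :
    matNorm (D.Q j k) ≤ matNorm (D.Q j l) := by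
  rw [← Q_mul hA hK h1 h2]
  exact matNorm_le_matNorm_mul (big_Q D j k) (big_Q D k l)

/-- A fixed finite stretch of the cocycle changes the norms involved by bounded factors only, which
are absorbed into `C`; the rate `σ` is unchanged. Pulling back also needs the times `l` between `j`
and `k`, which are covered by the term `N ^ (1 + σ)`. -/
theorem S_mem_stable {j k : ℕ} (h : j ≤ k) {v : A → ℝ} :
    D.S j k v ∈ D.stable k ↔ v ∈ D.stable j := by
  constructor
  · rintro ⟨σ, hσ, C, hC, hv⟩
    set N := matNorm (D.Q j k) with hN
    have hN1 : 1 ≤ N := one_le_matNorm (big_Q D j k)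
    have hN0 : 0 < N := by linarith
    refine ⟨σ, hσ, C * N ^ σ * N + N ^ (1 + σ), by positivity, fun l hl => ?_⟩
    have hM1 := one_le_matNorm (big_Q D j l)
    set M := matNorm (D.Q j l) with hM
    have hM0 : 0 < M := by linarith
    have hMp : 0 < M ^ (-σ) := Real.rpow_pos_of_pos hM0 _
    rcases le_total k l with hkl | hkl
    · have hP1 := one_le_matNorm (big_Q D k l)
      have h1 : matNorm (D.Q k l) ^ (-σ) ≤ N ^ σ * M ^ (-σ) := by
        have h2 : M ≤ N * matNorm (D.Q k l) := by
          rw [hM, ← Q_mul hA hK h hkl]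
          exact matNorm_mul_le _ _
        have h3 := Real.rpow_le_rpow_of_nonpos hM0 h2 (by linarith : -σ ≤ 0)
        rw [Real.mul_rpow hN0.le (by linarith)] at h3
        calc _ = N ^ σ * (N ^ (-σ) * matNorm (D.Q k l) ^ (-σ)) := by
              rw [← mul_assoc, ← Real.rpow_add hN0]
              simp
          _ ≤ _ := mul_le_mul_of_nonneg_left h3 (by positivity)
      calc ‖D.S j l v‖ = ‖D.S k l (D.S j k v)‖ := by rw [S_comp hA hK h hkl]
        _ ≤ C * matNorm (D.Q k l) ^ (-σ) * ‖D.S j k v‖ := hv l hkl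
        _ ≤ C * (N ^ σ * M ^ (-σ)) * (N * ‖v‖) := by
            gcongr
            exact norm_S_le _ _ _
        _ = C * N ^ σ * N * M ^ (-σ) * ‖v‖ := by ring
        _ ≤ _ := by
            gcongr
            have : 0 ≤ N ^ (1 + σ) := by positivity
            linarith
    · have hMN : M ≤ N := matNorm_Q_mono_right hA hK hl hkl
      calc ‖D.S j l v‖ ≤ M * ‖v‖ := norm_S_le _ _ _
        _ = M ^ (1 + σ) * M ^ (-σ) * ‖v‖ := by
            rw [← Real.rpow_add hM0]
            simp
        _ ≤ N ^ (1 + σ) * M ^ (-σ) * ‖v‖ := by gcongr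
        _ ≤ _ := by
            gcongr
            have : 0 ≤ C * N ^ σ * N := by positivity
            linarith
  · rintro ⟨σ, hσ, C, hC, hv⟩
    rcases eq_or_ne v 0 with rfl | hv0
    · rw [map_zero]
      exact zero_mem _
    have hw : 0 < ‖D.S j k v‖ := norm_pos_iff.2 fun h0 =>
      hv0 (S_injective hA hK h (h0.trans (map_zero _).symm))
    have hv' : 0 < ‖v‖ := norm_pos_iff.2 hv0
    refine ⟨σ, hσ, C * ‖v‖ / ‖D.S j k v‖, by positivity, fun l hl => ?_⟩
    rw [S_comp hA hK h hl]
    calc ‖D.S j l v‖ ≤ C * matNorm (D.Q j l) ^ (-σ) * ‖v‖ := hv l (h.trans hl)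
      _ ≤ C * matNorm (D.Q k l) ^ (-σ) * ‖v‖ := by
          have := Real.rpow_le_rpow_of_nonpos
            (zero_lt_one.trans_le (one_le_matNorm (big_Q D k l)))
            (matNorm_Q_mono_left hA hK h hl) (by linarith : -σ ≤ 0)
          gcongr
      _ = _ := by
          field_simp

omit hA hK in
/-- The rate of contraction is uniform on the stable space. -/
theorem stable_uniform {D : Data A} : ∃ σ > (0 : ℝ), ∃ C > (0 : ℝ), ∀ v ∈ D.stable 0, ∀ k,
    ‖D.S 0 k v‖ ≤ C * D.q k ^ (-σ) * ‖v‖ := by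
  set b := Module.finBasis ℝ (D.stable 0) with hb
  have hn : ∀ i, 0 ≤ ‖(b i : A → ℝ)‖ := fun i => norm_nonneg _
  have h : ∀ i, ∃ σ > (0 : ℝ), ∃ C > (0 : ℝ), ∀ l, 0 ≤ l →
      ‖D.S 0 l (b i)‖ ≤ C * matNorm (D.Q 0 l) ^ (-σ) * ‖(b i : A → ℝ)‖ := fun i => (b i).2
  choose σ hσ C hC hbound using h
  -- A common positive rate for the finitely many basis vectors; going through logarithms also
  -- covers an empty basis.
  obtain ⟨τ, hτ, hτσ⟩ : ∃ τ > (0 : ℝ), ∀ i, τ ≤ σ i := by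
    obtain ⟨M, hM⟩ := Finset.exists_le (Finset.univ.image fun i => -Real.log (σ i))
    refine ⟨Real.exp (-M), Real.exp_pos _, fun i => ?_⟩
    have := hM _ (Finset.mem_image_of_mem _ (Finset.mem_univ i))
    rw [← Real.exp_log (hσ i)]
    exact Real.exp_le_exp.2 (by linarith)
  set L := LinearMap.toContinuousLinearMap b.equivFun.toLinearMap with hL
  have hcoord : ∀ v : D.stable 0, ∀ i, |b.repr v i| ≤ ‖L‖ * ‖(v : A → ℝ)‖ := fun v i => by
    have h1 : ‖b.equivFun v‖ ≤ ‖L‖ * ‖v‖ := L.le_opNorm v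
    exact (norm_le_pi_norm (b.equivFun v) i).trans h1
  refine ⟨τ, hτ, ‖L‖ * ∑ i, C i * ‖(b i : A → ℝ)‖ + 1, ?_, fun v hv k => ?_⟩
  · have := Finset.sum_nonneg fun i (_ : i ∈ Finset.univ) => mul_nonneg (hC i).le (hn i)
    positivity
  have hq := one_le_q (D := D) k
  have hv' : v = ∑ i, b.repr ⟨v, hv⟩ i • (b i : A → ℝ) := by
    have := congrArg Subtype.val (b.sum_repr ⟨v, hv⟩)
    rw [Submodule.coe_sum] at this
    exact this.symm
  have hqp := rpow_pos_q (D := D) k (-τ)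
  calc ‖D.S 0 k v‖ = ‖∑ i, b.repr ⟨v, hv⟩ i • D.S 0 k (b i)‖ := by
        conv_lhs => rw [hv', map_sum]
        simp only [map_smul]
    _ ≤ ∑ i, (‖L‖ * ‖v‖) * (C i * D.q k ^ (-τ) * ‖(b i : A → ℝ)‖) := by
        refine norm_sum_le_of_le _ fun i _ => ?_
        rw [norm_smul]
        refine mul_le_mul (hcoord ⟨v, hv⟩ i) ?_ (norm_nonneg _) (by positivity)
        refine (hbound i k k.zero_le).trans ?_
        have : matNorm (D.Q 0 k) ^ (-σ i) ≤ D.q k ^ (-τ) := q_rpow_le k (by linarith [hτσ i])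
        have := (hC i).le
        gcongr
    _ = ‖L‖ * (∑ i, C i * ‖(b i : A → ℝ)‖) * D.q k ^ (-τ) * ‖v‖ := by
        rw [← Finset.mul_sum, Finset.mul_sum, Finset.mul_sum, Finset.sum_mul, Finset.sum_mul]
        refine Finset.sum_congr rfl fun i _ => ?_
        ring
    _ ≤ _ := by
        gcongr
        linarith

end Data

end Sequences

/-! ### Shadowing by an orbit of the cocycle, from coherence. -/

section Correction

variable {A : Type*} [Fintype A] [DecidableEq A] [Nontrivial A]

namespace Data

variable {D : Data A} (hA : D.Admissible) (hK : D.Keane)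

include hA hK

/-- Up to a vector of the stable space at time `0`, the cocycle can be followed backwards with a
subpolynomial loss. -/
theorem exists_lift_mod_stable (hc : D.CondC) {s : ℝ} (hs : 0 < s) : ∃ C > (0 : ℝ), ∀ j w,
    ∀ δ > (0 : ℝ), ∃ v, D.S 0 j v - w ∈ D.stable j ∧ ‖v‖ ≤ C * D.q j ^ s * ‖w‖ + δ := by
  obtain ⟨C, hC, h⟩ := hc s hs
  refine ⟨C, hC, fun j w δ hδ => ?_⟩
  obtain ⟨v, hv⟩ := S_surjective hA hK j.zero_le w
  obtain ⟨v', hv', hn⟩ := Submodule.Quotient.norm_mk_lt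
    (Submodule.Quotient.mk v : (A → ℝ) ⧸ D.stable 0) hδ
  refine ⟨v', ?_, ?_⟩
  · rw [← hv, ← map_sub, S_mem_stable hA hK j.zero_le]
    exact (Submodule.Quotient.eq _).1 hv'
  · have h1 := (h 0 j j.zero_le).1 v
    rw [hv] at h1
    have h2 := Submodule.Quotient.norm_mk_le (D.stable j) w
    have h3 : C * matNorm (D.Q 0 j) ^ s * ‖(Submodule.Quotient.mk w : (A → ℝ) ⧸ D.stable j)‖
        ≤ C * D.q j ^ s * ‖w‖ :=
      mul_le_mul_of_nonneg_left h2 (mul_pos hC (rpow_pos_q j s)).le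
    linarith

/-- A sequence of vectors of the stable spaces that follows the cocycle up to polynomially small
errors is polynomially small. -/
theorem norm_le_of_mem_stable (hc : D.CondC) (u : ℕ → A → ℝ)
    (hu : ∀ k, u k ∈ D.stable k) {t C₁ : ℝ} (ht : 0 < t) (hC₁ : 0 < C₁)
    (he : ∀ k, ‖D.defect u k‖ ≤ C₁ * D.q k ^ (-t)) :
    ∃ δ > (0 : ℝ), ∃ C > (0 : ℝ), ∀ k, ‖u k‖ ≤ C * D.q k ^ (-δ) := by
  obtain ⟨σ, hσ, C₂, hC₂, hunif⟩ := stable_uniform (D := D)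
  obtain ⟨C₃, hC₃, h3⟩ := norm_le_norm_S hA hK
  have hst : ∀ k, D.defect u k ∈ D.stable k := by
    intro k
    cases k with
    | zero => exact hu 0
    | succ k => exact sub_mem (hu _) ((S_mem_stable hA hK k.le_succ).2 (hu k))
  set d : ℝ := (Fintype.card A : ℝ) with hd
  have hd0 : 0 < d := Nat.cast_pos.2 Fintype.card_pos
  -- Chosen so that pulling an early defect back to time `0`, at a loss of `q j ^ d`, uses up half
  -- of the contraction rate.
  set η : ℝ := σ / (2 * d) with hη
  have hη0 : 0 < η := by positivity
  obtain ⟨C₄, hC₄, h4⟩ := hc (η * t / 2) (by positivity)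
  set δ : ℝ := min (σ / 2) (η * t / 2) with hδ
  have hδ0 : 0 < δ := lt_min (by positivity) (by positivity)
  have key : ∀ k j, j ≤ k →
      ‖D.S j k (D.defect u j)‖ ≤ (C₂ * C₃ * C₁ + C₄ * C₁) * D.q k ^ (-δ) := by
    intro k j hjk
    have hp := rpow_pos_q (D := D) k (-δ)
    rcases le_total (D.q j) (D.q k ^ η) with h | h
    -- Early defect: its pull-back lies in the stable space at time `0`, where the contraction is
    -- uniform.
    · obtain ⟨v, hv⟩ := S_surjective hA hK j.zero_le (D.defect u j)
      have hvs : v ∈ D.stable 0 := by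
        rw [← S_mem_stable hA hK j.zero_le, hv]
        exact hst j
      have hvn : ‖v‖ ≤ C₃ * C₁ * D.q k ^ (η * d) := by
        calc ‖v‖ ≤ C₃ * D.q j ^ d * ‖D.S 0 j v‖ := h3 j v
          _ ≤ C₃ * D.q j ^ d * (C₁ * D.q j ^ (-t)) := by
              rw [hv]
              exact mul_le_mul_of_nonneg_left (he j) (mul_pos hC₃ (rpow_pos_q _ _)).le
          _ = C₃ * C₁ * D.q j ^ (d + -t) := by rw [← q_rpow_mul]; ring
          _ ≤ C₃ * C₁ * D.q j ^ d :=
              mul_le_mul_of_nonneg_left (q_rpow_le _ (by linarith)) (by positivity)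
          _ ≤ _ := mul_le_mul_of_nonneg_left (small_regime hA hK h hd0.le) (by positivity)
      rw [← hv, S_comp hA hK j.zero_le hjk]
      calc ‖D.S 0 k v‖ ≤ C₂ * D.q k ^ (-σ) * ‖v‖ := hunif v hvs k
        _ ≤ C₂ * D.q k ^ (-σ) * (C₃ * C₁ * D.q k ^ (η * d)) :=
            mul_le_mul_of_nonneg_left hvn (mul_pos hC₂ (rpow_pos_q _ _)).le
        _ = C₂ * C₃ * C₁ * D.q k ^ (-σ + η * d) := by rw [← q_rpow_mul]; ring
        _ ≤ C₂ * C₃ * C₁ * D.q k ^ (-δ) := by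
            refine mul_le_mul_of_nonneg_left (q_rpow_le _ ?_) (by positivity)
            have : η * d = σ / 2 := by
              rw [hη]
              field_simp
            have := min_le_left (σ / 2) (η * t / 2)
            linarith
        _ ≤ _ := mul_le_mul_of_nonneg_right (le_add_of_nonneg_right (by positivity)) hp.le
    -- Late defect: (c) allows only a small growth on the stable space, less than the smallness of
    -- the defect itself.
    · calc ‖D.S j k (D.defect u j)‖ ≤ C₄ * D.q k ^ (η * t / 2) * ‖D.defect u j‖ :=
            (h4 j k hjk).2 _ (hst j)
        _ ≤ C₄ * D.q k ^ (η * t / 2) * (C₁ * D.q k ^ (-(η * t))) := by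
            refine mul_le_mul_of_nonneg_left ((he j).trans ?_) (mul_pos hC₄ (rpow_pos_q _ _)).le
            exact mul_le_mul_of_nonneg_left (large_regime hA hK h ht.le) hC₁.le
        _ = C₄ * C₁ * D.q k ^ (η * t / 2 + -(η * t)) := by rw [← q_rpow_mul]; ring
        _ ≤ C₄ * C₁ * D.q k ^ (-δ) := by
            refine mul_le_mul_of_nonneg_left (q_rpow_le _ ?_) (by positivity)
            have := min_le_right (σ / 2) (η * t / 2)
            linarith
        _ ≤ _ := mul_le_mul_of_nonneg_right (le_add_of_nonneg_left (by positivity)) hp.le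
  obtain ⟨E, hE, h⟩ := norm_le_of_terms hA hK (by positivity) key (half_pos hδ0)
  refine ⟨δ / 2, half_pos hδ0, E, hE, fun k => ?_⟩
  have := h k
  rwa [show -δ + δ / 2 = -(δ / 2) by ring] at this

/-- By (a) with exponent `1`, `q (k + 1)` is at most a constant times `q k ^ 2`. This converts decay
in `q k` into decay in `q (k + 1)`, at half the rate. -/
theorem q_rpow_neg_le_succ (ha : D.CondA) {s : ℝ} (hs : 0 < s) :
    ∃ C > (0 : ℝ), ∀ k, D.q k ^ (-(2 * s)) ≤ C * D.q (k + 1) ^ (-s) := by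
  obtain ⟨C, hC, h⟩ := matNorm_Q_succ_le hA hK ha one_pos
  refine ⟨C ^ s, Real.rpow_pos_of_pos hC _, fun k => ?_⟩
  have h8 : D.q (k + 1) ≤ C * D.q k ^ (2 : ℝ) := by
    calc D.q (k + 1) ≤ D.q k * matNorm (D.Q k (k + 1)) := by
          conv_lhs => rw [q, ← Q_mul hA hK k.zero_le k.le_succ]
          exact matNorm_mul_le _ _
      _ ≤ D.q k * (C * D.q k ^ (1 : ℝ)) := mul_le_mul_of_nonneg_left (h k) (q_pos k).le
      _ = C * D.q k ^ (2 : ℝ) := by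
          rw [Real.rpow_one, Real.rpow_two]
          ring
  have h9 := Real.rpow_le_rpow_of_nonpos (q_pos (k + 1)) h8 (by linarith : -s ≤ 0)
  rw [Real.mul_rpow hC.le (rpow_pos_q _ _).le, ← Real.rpow_mul (q_pos k).le] at h9
  calc D.q k ^ (-(2 * s)) = C ^ s * (C ^ (-s) * D.q k ^ (2 * -s)) := by
        rw [← mul_assoc, ← Real.rpow_add hC]
        simp only [add_neg_cancel, Real.rpow_zero, one_mul]
        ring_nf
    _ ≤ _ := mul_le_mul_of_nonneg_left h9 (Real.rpow_pos_of_pos hC _).le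

/-- A sequence of vectors that follows the cocycle up to polynomially small errors is polynomially
close to an orbit of the cocycle. -/
theorem exists_shadowing (ha : D.CondA) (hc : D.CondC) (u : ℕ → A → ℝ)
    {t C₁ : ℝ} (ht : 0 < t) (hC₁ : 0 < C₁) (he : ∀ k, ‖D.defect u k‖ ≤ C₁ * D.q k ^ (-t)) :
    ∃ χ : A → ℝ, ∃ δ > (0 : ℝ), ∃ C > (0 : ℝ), ∀ k, ‖u k - D.S 0 k χ‖ ≤ C * D.q k ^ (-δ) := by
  obtain ⟨C₂, hC₂, h2⟩ := exists_lift_mod_stable hA hK hc (half_pos ht)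
  -- Each defect is pulled back to time `0` modulo the stable space with a loss `q j ^ (t / 2)`,
  -- half of its smallness. The pull-backs are therefore summable, and their sum is the shadowing
  -- vector.
  have hlift : ∀ j, ∃ v, D.S 0 j v - D.defect u j ∈ D.stable j ∧
      ‖v‖ ≤ (C₂ * C₁ + 1) * D.q j ^ (-(t / 2)) := by
    intro j
    obtain ⟨v, hv, hn⟩ := h2 j (D.defect u j) (D.q j ^ (-(t / 2))) (rpow_pos_q (D := D) _ _)
    refine ⟨v, hv, hn.trans ?_⟩
    have h3 := mul_le_mul_of_nonneg_left (he j) (mul_pos hC₂ (rpow_pos_q (D := D) j (t / 2))).le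
    have h4 : C₂ * D.q j ^ (t / 2) * (C₁ * D.q j ^ (-t)) = C₂ * C₁ * D.q j ^ (-(t / 2)) := by
      rw [mul_mul_mul_comm, q_rpow_mul]
      ring_nf
    linarith
  choose v hv hvn using hlift
  have hsum : Summable v := Summable.of_norm_bounded
    ((summable_q_rpow hA hK (half_pos ht)).mul_left _) hvn
  set χ := ∑' j, v j with hχ
  set r : ℕ → A → ℝ := fun k => u k - D.S 0 k χ with hr
  have hdef : ∀ k, D.defect r (k + 1) = D.defect u (k + 1) := by
    intro k
    simp only [defect, hr, map_sub]
    rw [S_comp hA hK k.zero_le k.le_succ]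
    abel
  obtain ⟨C₃, hC₃, h3⟩ := hc (t / 2) (half_pos ht)
  obtain ⟨C₄, hC₄, h4⟩ := tsum_q_rpow_le hA hK (s := t / 4) (by positivity)
  -- Modulo the stable space the terms with `j ≤ k` cancel, so the class of `r k` is minus the class
  -- of the image of the tail `j > k`. Each tail term is estimated from its class at time `j`, that
  -- of the defect, through the inverse bound in (c).
  have hmod : ∀ k, ‖(Submodule.Quotient.mk (r k) : (A → ℝ) ⧸ D.stable k)‖ ≤
      C₃ * C₁ * C₄ * D.q k ^ (-(t / 4)) := by
    intro k
    set L := LinearMap.toContinuousLinearMap ((D.stable k).mkQ ∘ₗ D.S 0 k) with hL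
    have h5 : HasSum (fun i => v (i + (k + 1))) (χ - ∑ j ∈ Finset.range (k + 1), v j) :=
      (hasSum_nat_add_iff' (k + 1)).2 hsum.hasSum
    have h6 := h5.mapL L
    have h7 : L (χ - ∑ j ∈ Finset.range (k + 1), v j)
        = - (Submodule.Quotient.mk (r k) : (A → ℝ) ⧸ D.stable k) := by
      change Submodule.Quotient.mk (D.S 0 k (χ - ∑ j ∈ Finset.range (k + 1), v j)) = _
      rw [← Submodule.Quotient.mk_neg, Submodule.Quotient.eq]
      have : D.S 0 k (χ - ∑ j ∈ Finset.range (k + 1), v j) - -r k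
          = -∑ j ∈ Finset.range (k + 1), D.S j k (D.S 0 j (v j) - D.defect u j) := by
        simp only [hr, map_sub, Finset.sum_sub_distrib]
        rw [← eq_sum_defect hA hK u k, map_sum]
        rw [Finset.sum_congr rfl fun j hj => S_comp hA hK j.zero_le
          (Nat.lt_succ_iff.1 (Finset.mem_range.1 hj)) (v j)]
        abel
      rw [this]
      refine neg_mem (sum_mem fun j hj => ?_)
      exact (S_mem_stable hA hK (Nat.lt_succ_iff.1 (Finset.mem_range.1 hj))).2 (hv j)
    have h8 : ∀ i, ‖L (v (i + (k + 1)))‖ ≤ C₃ * C₁ * D.q (k + 1 + i) ^ (-(t / 2)) := by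
      intro i
      rw [add_comm (k + 1) i]
      set j := i + (k + 1) with hj
      have hkj : k ≤ j := by omega
      have h9 := (h3 k j hkj).1 (D.S 0 k (v j))
      rw [S_comp hA hK k.zero_le hkj, (Submodule.Quotient.eq _).2 (hv j)] at h9
      calc _ ≤ C₃ * D.q j ^ (t / 2) *
            ‖(Submodule.Quotient.mk (D.defect u j) : (A → ℝ) ⧸ D.stable j)‖ := h9
        _ ≤ C₃ * D.q j ^ (t / 2) * (C₁ * D.q j ^ (-t)) :=
            mul_le_mul_of_nonneg_left ((Submodule.Quotient.norm_mk_le _ _).trans (he j))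
              (mul_pos hC₃ (rpow_pos_q _ _)).le
        _ = C₃ * C₁ * D.q j ^ (-(t / 2)) := by
            rw [mul_mul_mul_comm, q_rpow_mul]
            ring_nf
    obtain ⟨h10, h11⟩ := h4 (k + 1) (t / 2) (by linarith)
    have h12 := h6.norm_le_of_bounded (h10.hasSum.mul_left (C₃ * C₁)) h8
    rw [h7, norm_neg] at h12
    refine h12.trans ?_
    rw [mul_assoc (C₃ * C₁)]
    refine mul_le_mul_of_nonneg_left (h11.trans ?_) (mul_pos hC₃ hC₁).le
    exact mul_le_mul_of_nonneg_left (q_rpow_anti hA hK (by linarith) k.le_succ) hC₄.le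
  -- A nearly minimal representative of the class of `r k`.
  have hsplit : ∀ k, ∃ w, r k - w ∈ D.stable k ∧
      ‖w‖ ≤ (C₃ * C₁ * C₄ + 1) * D.q k ^ (-(t / 4)) := by
    intro k
    obtain ⟨w, hw, hn⟩ := Submodule.Quotient.norm_mk_lt
      (Submodule.Quotient.mk (r k) : (A → ℝ) ⧸ D.stable k) (rpow_pos_q (D := D) k (-(t / 4)))
    refine ⟨w, (Submodule.Quotient.eq _).1 hw.symm, ?_⟩
    have := hmod k
    linarith
  choose w hw hwn using hsplit
  set C₅ := C₃ * C₁ * C₄ + 1 with hC₅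
  have hC₅0 : 0 < C₅ := by positivity
  obtain ⟨C₆, hC₆, h6⟩ := matNorm_Q_succ_le hA hK ha (s := t / 8) (by positivity)
  obtain ⟨C₇, hC₇, h7⟩ := q_rpow_neg_le_succ hA hK ha (s := t / 16) (by positivity)
  have hgrow : ∀ k, D.q k ^ (-(t / 8)) ≤ C₇ * D.q (k + 1) ^ (-(t / 16)) := fun k => by
    have := h7 k
    rwa [show 2 * (t / 16) = t / 8 by ring] at this
  -- The remainder lies in the stable spaces. The `w k` are unrelated for different `k`, but each is
  -- small and (a) limits their growth in one block, so the defects of `s` are still polynomially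
  -- small.
  set s : ℕ → A → ℝ := fun k => r k - w k with hs
  have hs0 : 0 ≤ ‖s 0‖ * D.q 0 ^ (t / 16) := by
    have := rpow_pos_q (D := D) 0 (t / 16)
    positivity
  obtain ⟨δ, hδ, C₈, hC₈, h8⟩ := norm_le_of_mem_stable hA hK hc s hw (t := t / 16)
    (C₁ := (C₁ + C₅ + C₆ * C₅ * C₇) + ‖s 0‖ * D.q 0 ^ (t / 16))
    (by positivity) (by positivity) (by
      intro k
      cases k with
      | zero =>
        rw [add_mul, mul_assoc ‖s 0‖, q_rpow_mul, add_neg_cancel, Real.rpow_zero, mul_one]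
        exact le_add_of_nonneg_left (mul_nonneg (by positivity) (rpow_pos_q _ _).le)
      | succ k =>
        have hp := rpow_pos_q (D := D) (k + 1) (-(t / 16))
        have e1 : D.defect s (k + 1)
            = D.defect u (k + 1) - w (k + 1) + D.S k (k + 1) (w k) := by
          rw [← hdef]
          simp only [defect, hs, map_sub]
          abel
        have e2 : ‖D.defect u (k + 1)‖ ≤ C₁ * D.q (k + 1) ^ (-(t / 16)) :=
          (he _).trans (mul_le_mul_of_nonneg_left (q_rpow_le _ (by linarith)) hC₁.le)
        have e3 : ‖w (k + 1)‖ ≤ C₅ * D.q (k + 1) ^ (-(t / 16)) :=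
          (hwn _).trans (mul_le_mul_of_nonneg_left (q_rpow_le _ (by linarith)) hC₅0.le)
        have e4 : ‖D.S k (k + 1) (w k)‖ ≤ C₆ * C₅ * C₇ * D.q (k + 1) ^ (-(t / 16)) := by
          calc _ ≤ matNorm (D.Q k (k + 1)) * ‖w k‖ := norm_S_le _ _ _
            _ ≤ (C₆ * D.q k ^ (t / 8)) * (C₅ * D.q k ^ (-(t / 4))) :=
                mul_le_mul (h6 k) (hwn k) (norm_nonneg _) (mul_pos hC₆ (rpow_pos_q _ _)).le
            _ = C₆ * C₅ * D.q k ^ (-(t / 8)) := by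
                rw [mul_mul_mul_comm, q_rpow_mul]
                ring_nf
            _ ≤ C₆ * C₅ * (C₇ * D.q (k + 1) ^ (-(t / 16))) :=
                mul_le_mul_of_nonneg_left (hgrow k) (by positivity)
            _ = _ := by ring
        rw [e1, add_mul]
        calc _ ≤ ‖D.defect u (k + 1)‖ + ‖w (k + 1)‖ + ‖D.S k (k + 1) (w k)‖ :=
              (norm_add_le _ _).trans (add_le_add_left (norm_sub_le _ _) _)
          _ ≤ (C₁ + C₅ + C₆ * C₅ * C₇) * D.q (k + 1) ^ (-(t / 16)) := by linarith
          _ ≤ _ := le_add_of_nonneg_right (mul_nonneg hs0 hp.le))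
  refine ⟨χ, min δ (t / 4), lt_min hδ (by positivity), C₈ + C₅, by positivity, fun k => ?_⟩
  have e1 : u k - D.S 0 k χ = s k + w k := by simp [hs, hr]
  have e2 : D.q k ^ (-δ) ≤ D.q k ^ (-min δ (t / 4)) := q_rpow_le _ (neg_le_neg (min_le_left _ _))
  have e3 : D.q k ^ (-(t / 4)) ≤ D.q k ^ (-min δ (t / 4)) :=
    q_rpow_le _ (neg_le_neg (min_le_right _ _))
  rw [e1, add_mul]
  exact (norm_add_le _ _).trans (add_le_add
    ((h8 k).trans (mul_le_mul_of_nonneg_left e2 hC₈.le))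
    ((hwn k).trans (mul_le_mul_of_nonneg_left e3 hC₅0.le)))

end Data

end Correction

/-! ### Special Birkhoff sums of functions on the intervals. -/

section Families

variable {A : Type*} [Fintype A] [DecidableEq A] [Nontrivial A]

theorem eVariationOn_add_le (f g : ℝ → ℝ) (s : Set ℝ) :
    eVariationOn (fun x => f x + g x) s ≤ eVariationOn f s + eVariationOn g s := by
  refine iSup_le fun p => ?_
  calc ∑ i ∈ Finset.range p.1, edist (f (p.2.1 (i + 1)) + g (p.2.1 (i + 1)))
        (f (p.2.1 i) + g (p.2.1 i))
      ≤ ∑ i ∈ Finset.range p.1, (edist (f (p.2.1 (i + 1))) (f (p.2.1 i))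
        + edist (g (p.2.1 (i + 1))) (g (p.2.1 i))) :=
        Finset.sum_le_sum fun i _ => edist_add_add_le _ _ _ _
    _ = _ := Finset.sum_add_distrib
    _ ≤ _ := add_le_add (eVariationOn.sum_le (f := f) p.2.2.1 p.2.2.2)
        (eVariationOn.sum_le (f := g) p.2.2.1 p.2.2.2)

theorem intervalIntegrable_of_boundedVariationOn {φ : ℝ → ℝ} {a b : ℝ} (hab : a ≤ b)
    (hφ : BoundedVariationOn φ (Ico a b)) : IntervalIntegrable φ volume a b :=
  (intervalIntegrable_iff_integrableOn_Ico_of_le hab).2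
    (integrableOn_of_bounded (aestronglyMeasurable_of_boundedVariationOn hφ)
      (bounded_of_boundedVariationOn hφ))

theorem abs_average_sub_le {f : ℝ → ℝ} {L c V : ℝ} (hL : 0 < L)
    (hf : IntervalIntegrable f volume 0 L) (h : ∀ x ∈ Ico 0 L, |f x - c| ≤ V) :
    |L⁻¹ * (∫ x in (0 : ℝ)..L, f x) - c| ≤ V := by
  have h1 : ∫ x in (0 : ℝ)..L, (f x - c) = (∫ x in (0 : ℝ)..L, f x) - L * c := by
    rw [intervalIntegral.integral_sub hf intervalIntegrable_const]
    simp
  have h2 : ‖∫ x in (0 : ℝ)..L, (f x - c)‖ ≤ V * |L - 0| := by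
    refine intervalIntegral.norm_integral_le_of_norm_le_const_ae ?_
    have hne : ∀ᵐ x : ℝ, x ≠ L := by simp [ae_iff, measure_singleton]
    filter_upwards [hne] with x hx hxL
    rw [uIoc_of_le hL.le] at hxL
    exact h x ⟨hxL.1.le, lt_of_le_of_ne hxL.2 hx⟩
  rw [h1, sub_zero, abs_of_pos hL, Real.norm_eq_abs] at h2
  have h3 : L⁻¹ * (∫ x in (0 : ℝ)..L, f x) - c = L⁻¹ * ((∫ x in (0 : ℝ)..L, f x) - L * c) := by
    field_simp
  rw [h3, abs_mul, abs_of_pos (inv_pos.2 hL)]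
  calc L⁻¹ * |(∫ x in (0 : ℝ)..L, f x) - L * c| ≤ L⁻¹ * (V * L) :=
        mul_le_mul_of_nonneg_left h2 (inv_pos.2 hL).le
    _ = V := by field_simp

namespace Data

/-- The sums over the return orbits of one step of a function given, on each interval, in terms
of the coordinate `x ∈ [0, len a)`. -/
def birk (D : Data A) (F : A → ℝ → ℝ) : A → ℝ → ℝ := fun a x =>
  F a x + if a = D.loser then F D.winner (x + (D.len D.winner - D.len D.loser)) else 0

/-- The special Birkhoff sums of a function at the `n`-th step. -/
def sb (D : Data A) (F : A → ℝ → ℝ) : ℕ → A → ℝ → ℝ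
  | 0 => F
  | n + 1 => birk (D.iter n) (sb D F n)

/-- The total variation of a function on the intervals. -/
def tvar (D : Data A) (F : A → ℝ → ℝ) : ENNReal := ∑ a, eVariationOn (F a) (Ico 0 (D.len a))

/-- The integral of a function on the intervals. -/
def mass (D : Data A) (F : A → ℝ → ℝ) : ℝ := ∑ a, ∫ x in (0 : ℝ)..D.len a, F a x

/-- `F` is a derivative of `G` on the intervals. -/
def IsPrimitive (D : Data A) (G F : A → ℝ → ℝ) : Prop :=
  ∀ a, ∀ x ∈ Ico 0 (D.len a), G a x - G a 0 = ∫ t in (0 : ℝ)..x, F a t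

variable (D : Data A)

theorem sb_add (F : A → ℝ → ℝ) (m n : ℕ) : D.sb F (m + n) = (D.iter m).sb (D.sb F m) n := by
  induction n with
  | zero => rfl
  | succ n ih =>
    change birk (D.iter (m + n)) (D.sb F (m + n)) = birk ((D.iter m).iter n) _
    rw [iter_iter, ih]

theorem V_iter (m n : ℕ) : (D.iter m).V n = D.V (m + n) := by
  unfold V
  rw [iter_iter]

theorem W_iter (m n : ℕ) : (D.iter m).W 0 n = D.W m (m + n) := by
  induction n with
  | zero => rw [add_zero, W_self, W_self]
  | succ n ih => rw [← add_assoc, W_succ _ n.zero_le, W_succ _ (Nat.le_add_right m n), ih, V_iter]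

theorem birk_sub (F G : A → ℝ → ℝ) : D.birk (F - G) = D.birk F - D.birk G := by
  ext a x
  simp only [birk, Pi.sub_apply]
  split_ifs <;> ring

theorem sb_sub (F G : A → ℝ → ℝ) (n : ℕ) : D.sb (F - G) n = D.sb F n - D.sb G n := by
  induction n with
  | zero => rfl
  | succ n ih =>
    change birk _ _ = birk _ _ - birk _ _
    rw [ih, birk_sub]

theorem sb_const (v : A → ℝ) (n : ℕ) :
    D.sb (fun a _ => v a) n = fun a _ => ((D.W 0 n)ᵀ *ᵥ v) a := by
  induction n with
  | zero => simp [sb, W_self]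
  | succ n ih =>
    change birk _ _ = _
    rw [ih]
    ext a x
    simp only [birk, Matrix.mulVec, dotProduct, Matrix.transpose_apply, D.W_succ n.zero_le,
      V_mul_apply, add_mul, Finset.sum_add_distrib]
    split_ifs <;> simp

theorem colSum_W_succ {m n : ℕ} (h : m ≤ n) (b : A) : colSum (D.W m (n + 1)) b =
    colSum (D.W m n) b + if b = (D.iter n).loser then colSum (D.W m n) (D.iter n).winner else 0 := by
  unfold colSum
  simp only [D.W_succ h, V_mul_apply, Finset.sum_add_distrib]
  split_ifs <;> simp

variable {D}

theorem Generic.shift_mem (h : D.Generic) {x : ℝ} (hx : x ∈ Ico 0 (D.step.len D.loser)) :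
    x + (D.len D.winner - D.len D.loser) ∈ Ico 0 (D.len D.winner) := by
  have := h.len_loser_lt
  rw [h.step_len_of_ne h.winner_ne_loser.symm] at hx
  exact ⟨by linarith [hx.1], by linarith [hx.2]⟩

theorem Generic.mem_of_mem_step (h : D.Generic) {a : A} {x : ℝ} (hx : x ∈ Ico 0 (D.step.len a)) :
    x ∈ Ico 0 (D.len a) := ⟨hx.1, hx.2.trans_le (h.step_len_le a)⟩

/-- The column sum of `W` is the return time, that is, the number of terms of the special Birkhoff
sum. -/
theorem abs_sb_le (hK : D.Keane) {F : A → ℝ → ℝ} {M : ℝ}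
    (hF : ∀ a, ∀ x ∈ Ico 0 (D.len a), |F a x| ≤ M) (n : ℕ) :
    ∀ a, ∀ x ∈ Ico 0 ((D.iter n).len a), |D.sb F n a x| ≤ M * colSum (D.W 0 n) a := by
  induction n with
  | zero =>
    intro a x hx
    have : colSum (1 : Matrix A A ℝ) a = 1 := by simp [colSum, Matrix.one_apply]
    rw [W_self, this, mul_one]
    exact hF a x hx
  | succ n ih =>
    intro a x hx
    have h := hK.iter_generic n
    rw [iter_succ] at hx
    change |birk (D.iter n) (D.sb F n) a x| ≤ _
    rw [birk, D.colSum_W_succ n.zero_le]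
    split_ifs with hal
    · rw [mul_add]
      subst hal
      exact (abs_add_le _ _).trans (add_le_add (ih _ _ (h.mem_of_mem_step hx))
        (ih _ _ (h.shift_mem hx)))
    · rw [add_zero, add_zero]
      exact ih _ _ (h.mem_of_mem_step hx)

theorem Generic.sum_step (h : D.Generic) {M : Type*} [AddCommMonoid M] (f : A → M) :
    ∑ a, f a = f D.winner + (f D.loser + ∑ a ∈ (Finset.univ.erase D.winner).erase D.loser, f a) := by
  rw [Finset.add_sum_erase _ _ (Finset.mem_erase.2 ⟨h.winner_ne_loser.symm, Finset.mem_univ _⟩),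
    Finset.add_sum_erase _ _ (Finset.mem_univ _)]

theorem Generic.birk_winner (h : D.Generic) (F : A → ℝ → ℝ) : D.birk F D.winner = F D.winner := by
  ext x
  rw [birk, if_neg h.winner_ne_loser, add_zero]

theorem birk_of_ne (F : A → ℝ → ℝ) {a : A} (ha : a ≠ D.loser) : D.birk F a = F a := by
  ext x
  rw [birk, if_neg ha, add_zero]

/-- In both types of step the return orbit of a point of the new loser's interval visits the
winner's interval once, at this coordinate, and the loser's interval once, at `x`. Only the order of
the two visits depends on the type, so the sum does not see it. -/
theorem birk_loser (F : A → ℝ → ℝ) : D.birk F D.loser = fun x =>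
    F D.loser x + F D.winner (x + (D.len D.winner - D.len D.loser)) := by
  ext x
  rw [birk, if_pos rfl]

/-- A step cuts the winner's interval in two: one part becomes the new interval of the winner, the
other is laid over the loser's interval. Variation is superadditive under the cut and subadditive
under the addition. The integral is treated by the same cut in `Generic.mass_birk`. -/
theorem Generic.tvar_birk_le (h : D.Generic) (F : A → ℝ → ℝ) :
    D.step.tvar (D.birk F) ≤ D.tvar F := by
  unfold tvar
  have hlt := h.len_loser_lt
  set c := D.len D.winner - D.len D.loser with hc
  have hc0 : 0 < c := by linarith
  rw [h.sum_step, h.sum_step (fun a => eVariationOn (F a) (Ico 0 (D.len a))), ← add_assoc,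
    ← add_assoc]
  refine add_le_add ?_ (Finset.sum_le_sum fun a ha => ?_)
  · rw [h.birk_winner, birk_loser, h.step_len_winner,
      h.step_len_of_ne h.winner_ne_loser.symm, ← hc]
    have h1 := eVariationOn_add_le (F D.loser) (fun x => F D.winner (x + c)) (Ico 0 (D.len D.loser))
    have h2 : eVariationOn (fun x => F D.winner (x + c)) (Ico 0 (D.len D.loser)) ≤
        eVariationOn (F D.winner) (Ico c (D.len D.winner)) :=
      eVariationOn.comp_le_of_monotoneOn (F D.winner) (fun x => x + c)
        (fun x _ y _ hxy => by simpa using hxy)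
        (fun x hx => ⟨by linarith [hx.1], by linarith [hx.2]⟩)
    have h3 : eVariationOn (F D.winner) (Ico 0 c) + eVariationOn (F D.winner) (Ico c (D.len D.winner))
        ≤ eVariationOn (F D.winner) (Ico 0 (D.len D.winner)) := by
      refine (eVariationOn.add_le_union _ fun x hx y hy => (hx.2.trans_le hy.1).le).trans ?_
      rw [Ico_union_Ico_eq_Ico hc0.le (by linarith [D.len_pos D.loser])]
    calc _ ≤ eVariationOn (F D.winner) (Ico 0 c) + (eVariationOn (F D.loser) (Ico 0 (D.len D.loser))
          + eVariationOn (F D.winner) (Ico c (D.len D.winner))) := by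
          gcongr
          exact h1.trans (by gcongr)
      _ = (eVariationOn (F D.winner) (Ico 0 c) + eVariationOn (F D.winner) (Ico c (D.len D.winner)))
          + eVariationOn (F D.loser) (Ico 0 (D.len D.loser)) := by abel
      _ ≤ _ := by gcongr
  · simp only [Finset.mem_erase, Finset.mem_univ, and_true] at ha
    rw [birk_of_ne F ha.1, h.step_len_of_ne ha.2]

theorem tvar_sb_le (hK : D.Keane) (F : A → ℝ → ℝ) (n : ℕ) : (D.iter n).tvar (D.sb F n) ≤ D.tvar F := by
  induction n with
  | zero => exact le_rfl
  | succ n ih =>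
    rw [iter_succ]
    exact ((hK.iter_generic n).tvar_birk_le _).trans ih

theorem boundedVariationOn_of_tvar {F : A → ℝ → ℝ} (hF : D.tvar F ≠ ⊤) (a : A) :
    BoundedVariationOn (F a) (Ico 0 (D.len a)) :=
  (ENNReal.sum_ne_top.1 hF) a (Finset.mem_univ a)

theorem intervalIntegrable_of_tvar {F : A → ℝ → ℝ} (hF : D.tvar F ≠ ⊤) (a : A) :
    IntervalIntegrable (F a) volume 0 (D.len a) :=
  intervalIntegrable_of_boundedVariationOn (D.len_pos a).le (boundedVariationOn_of_tvar hF a)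

theorem abs_sub_le_of_tvar {F : A → ℝ → ℝ} {V : ENNReal} (hV : V ≠ ⊤) (hF : D.tvar F ≤ V) {a : A}
    {x y : ℝ} (hx : x ∈ Ico 0 (D.len a)) (hy : y ∈ Ico 0 (D.len a)) : |F a x - F a y| ≤ V.toReal := by
  have h1 : edist (F a x) (F a y) ≤ V := (eVariationOn.edist_le _ hx hy).trans
    ((Finset.single_le_sum (f := fun a => eVariationOn (F a) (Ico 0 (D.len a)))
      (fun _ _ => zero_le) (Finset.mem_univ a)).trans hF)
  rw [← Real.dist_eq, dist_edist]
  exact ENNReal.toReal_mono hV h1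

theorem Generic.mass_birk (h : D.Generic) {F : A → ℝ → ℝ}
    (hF : ∀ a, IntervalIntegrable (F a) volume 0 (D.len a)) : D.step.mass (D.birk F) = D.mass F := by
  unfold mass
  have hlt := h.len_loser_lt
  have hl := D.len_pos D.loser
  rw [h.sum_step, h.sum_step (fun a => ∫ x in (0 : ℝ)..D.len a, F a x), ← add_assoc, ← add_assoc]
  congr 1
  · rw [h.birk_winner, birk_loser, h.step_len_winner, h.step_len_of_ne h.winner_ne_loser.symm]
    set c := D.len D.winner - D.len D.loser with hc
    have hcw : D.len D.winner = D.len D.loser + c := by rw [hc]; ring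
    have h1 : IntervalIntegrable (F D.winner) volume 0 c :=
      (hF _).mono_set (by
        rw [uIcc_of_le (by linarith), uIcc_of_le (by linarith)]
        exact Icc_subset_Icc_right (by linarith))
    have h2 : IntervalIntegrable (F D.winner) volume c (D.len D.winner) :=
      (hF _).mono_set (by
        rw [uIcc_of_le (by linarith), uIcc_of_le (by linarith)]
        exact Icc_subset_Icc_left (by linarith))
    have h3 : IntervalIntegrable (fun x => F D.winner (x + c)) volume 0 (D.len D.loser) := by
      have := h2.comp_add_right c
      rwa [sub_self, show D.len D.winner - c = D.len D.loser by linarith] at this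
    rw [intervalIntegral.integral_add (hF _) h3, intervalIntegral.integral_comp_add_right,
      zero_add, ← hcw, ← intervalIntegral.integral_add_adjacent_intervals h1 h2]
    ring
  · refine Finset.sum_congr rfl fun a ha => ?_
    simp only [Finset.mem_erase, Finset.mem_univ, and_true] at ha
    rw [birk_of_ne F ha.1, h.step_len_of_ne ha.2]

theorem tvar_sb_ne_top (hK : D.Keane) {F : A → ℝ → ℝ} (hF : D.tvar F ≠ ⊤) (n : ℕ) :
    (D.iter n).tvar (D.sb F n) ≠ ⊤ :=
  ne_top_of_le_ne_top hF (tvar_sb_le hK F n)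

theorem mass_sb (hK : D.Keane) {F : A → ℝ → ℝ} (hF : D.tvar F ≠ ⊤) (n : ℕ) :
    (D.iter n).mass (D.sb F n) = D.mass F := by
  induction n with
  | zero => rfl
  | succ n ih =>
    rw [iter_succ, ← ih]
    exact (hK.iter_generic n).mass_birk (intervalIntegrable_of_tvar (tvar_sb_ne_top hK hF n))

theorem Generic.isPrimitive_birk (h : D.Generic) {G F : A → ℝ → ℝ}
    (hF : ∀ a, IntervalIntegrable (F a) volume 0 (D.len a)) (hG : D.IsPrimitive G F) :
    D.step.IsPrimitive (D.birk G) (D.birk F) := by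
  intro a x hx
  have hx' := h.mem_of_mem_step hx
  rcases eq_or_ne a D.loser with rfl | ha
  · have hlt := h.len_loser_lt
    have hs := h.shift_mem hx
    have hs0 := h.shift_mem (x := 0) ⟨le_rfl, D.step.len_pos _⟩
    rw [birk_loser, birk_loser]
    set c := D.len D.winner - D.len D.loser with hc
    rw [zero_add] at hs0
    have e1 := hG _ _ hs
    have e2 := hG _ _ hs0
    have e3 := hG _ _ hx'
    have hsub : ∀ {a : A} {s t : ℝ}, s ∈ Ico 0 (D.len a) → t ∈ Ico 0 (D.len a) →
        IntervalIntegrable (F a) volume s t := fun {a} {s} {t} hs ht =>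
      (hF _).mono_set (by
        rw [uIcc_of_le (D.len_pos a).le]
        exact uIcc_subset_Icc ⟨hs.1, hs.2.le⟩ ⟨ht.1, ht.2.le⟩)
    have h3 : IntervalIntegrable (fun x => F D.winner (x + c)) volume 0 x := by
      have := (hsub hs0 hs).comp_add_right c
      rwa [sub_self, add_sub_cancel_right] at this
    rw [intervalIntegral.integral_add (hsub ⟨le_rfl, D.len_pos _⟩ hx') h3,
      intervalIntegral.integral_comp_add_right, zero_add, ← e3,
      ← intervalIntegral.integral_add_adjacent_intervals
        ((hsub hs0 ⟨le_rfl, D.len_pos _⟩)) (hsub ⟨le_rfl, D.len_pos _⟩ hs),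
      intervalIntegral.integral_symm, ← e1, ← e2]
    ring_nf
  · rw [birk_of_ne G ha, birk_of_ne F ha]
    exact hG a x hx'

theorem isPrimitive_sb (hK : D.Keane) {G F : A → ℝ → ℝ} (hF : D.tvar F ≠ ⊤)
    (hG : D.IsPrimitive G F) (n : ℕ) : (D.iter n).IsPrimitive (D.sb G n) (D.sb F n) := by
  induction n with
  | zero => exact hG
  | succ n ih =>
    rw [iter_succ]
    exact (hK.iter_generic n).isPrimitive_birk
      (intervalIntegrable_of_tvar (tvar_sb_ne_top hK hF n)) ih

/-- The special Birkhoff sums at time `k + 1` of a function which at time `k` is close to a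
constant on each interval. -/
theorem abs_sb_sub_le (hA : D.Admissible) (hK : D.Keane) {F : A → ℝ → ℝ} {v : A → ℝ} {M : ℝ} {k : ℕ}
    (hF : ∀ a, ∀ x ∈ Ico 0 ((D.iter (D.time k)).len a), |D.sb F (D.time k) a x - v a| ≤ M) (a : A)
    (x : ℝ) (hx : x ∈ Ico 0 ((D.iter (D.time (k + 1))).len a)) :
    |D.sb F (D.time (k + 1)) a x - D.S k (k + 1) v a| ≤ M * matNorm (D.Q k (k + 1)) := by
  have ht := (time_strictMono hA hK k.lt_succ_self).le
  obtain ⟨n, hn⟩ := Nat.exists_eq_add_of_le ht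
  have hQ : D.Q k (k + 1) = (D.iter (D.time k)).W 0 n := by
    rw [Q_eq_W hA hK k.le_succ, W_iter, ← hn]
  have h0 : 0 ≤ M := (abs_nonneg _).trans
    (hF a 0 ⟨le_rfl, Data.len_pos _ _⟩)
  have h1 := abs_sb_le (hK.iter (D.time k)) (F := D.sb F (D.time k) - fun a _ => v a) hF n a x
    (by rwa [iter_iter, ← hn])
  rw [sb_sub, ← sb_add, ← hn, sb_const, ← hQ] at h1
  exact h1.trans (mul_le_mul_of_nonneg_left ((big_Q D k (k + 1)).colSum_le a) h0)

end Data

end Families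

/-! ### Growth of the sums of the derivative, decay of the corrected sums of the function. -/

section SmallSums

variable {A : Type*} [Fintype A] [DecidableEq A] [Nontrivial A]

namespace Data

variable {D : Data A}

/-- The special Birkhoff sums of a function of bounded variation with mean value zero grow slower
than the return times. -/
theorem abs_sb_le_of_mass_zero (hA : D.Admissible) (hD : D.RothType) {F : A → ℝ → ℝ}
    (hF : D.tvar F ≠ ⊤) (hmass : D.mass F = 0) : ∃ δ > (0 : ℝ), ∃ C > (0 : ℝ), ∀ k a,
    ∀ x ∈ Ico 0 ((D.iter (D.time k)).len a), |D.sb F (D.time k) a x| ≤ C * D.q k ^ (1 - δ) := by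
  obtain ⟨hK, ha, hb, hc⟩ := hD
  set V := (D.tvar F).toReal with hV
  have hV0 : 0 ≤ V := ENNReal.toReal_nonneg
  have hint : ∀ k a, IntervalIntegrable (D.sb F (D.time k) a) volume 0
      ((D.iter (D.time k)).len a) := fun k =>
    intervalIntegrable_of_tvar (tvar_sb_ne_top hK hF (D.time k))
  -- Averages rather than values at a point: their mean value with respect to the lengths is exactly
  -- zero, as (b) requires.
  set μ : ℕ → A → ℝ := fun k a => ((D.iter (D.time k)).len a)⁻¹ *
    ∫ x in (0 : ℝ)..(D.iter (D.time k)).len a, D.sb F (D.time k) a x with hμ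
  have hosc : ∀ k a, ∀ x ∈ Ico 0 ((D.iter (D.time k)).len a),
      |D.sb F (D.time k) a x - μ k a| ≤ V := fun k a x hx => by
    rw [abs_sub_comm]
    exact abs_average_sub_le (Data.len_pos _ _) (hint k a) fun y hy =>
      abs_sub_le_of_tvar hF (tvar_sb_le hK F _) hy hx
  have hmean : ∀ k, ∑ a, (D.iter (D.time k)).len a * μ k a = 0 := fun k => by
    rw [← hmass, ← mass_sb hK hF (D.time k)]
    refine Finset.sum_congr rfl fun a _ => ?_
    rw [hμ, mul_inv_cancel_left₀ (Data.len_pos _ _).ne']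
  -- The sums at time `k` differ from `μ k` by at most the variation, an error that one block
  -- multiplies by at most `‖Z(k + 1)‖`; averaging at time `k + 1` keeps the bound.
  have hdef : ∀ s > (0 : ℝ), ∃ C > (0 : ℝ), ∀ k, ‖D.defect μ k‖ ≤ C * D.q k ^ s := by
    intro s hs
    obtain ⟨C, hC, h⟩ := matNorm_Q_succ_le hA hK ha hs
    refine ⟨V * C + ‖μ 0‖ + 1, by positivity, fun k => ?_⟩
    have hq := rpow_pos_q (D := D) k s
    cases k with
    | zero =>
      have := one_le_q_rpow (D := D) 0 hs.le
      change ‖μ 0‖ ≤ _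
      calc ‖μ 0‖ = ‖μ 0‖ * 1 := (mul_one _).symm
        _ ≤ (V * C + ‖μ 0‖ + 1) * D.q 0 ^ s := by
          refine mul_le_mul ?_ this zero_le_one (by positivity)
          have : 0 ≤ V * C := by positivity
          linarith
    | succ k =>
      have h1 : ‖D.defect μ (k + 1)‖ ≤ V * matNorm (D.Q k (k + 1)) := by
        refine (pi_norm_le_iff_of_nonneg (mul_nonneg hV0 (matNorm_nonneg _))).2 fun a => ?_
        exact abs_average_sub_le (Data.len_pos _ _) (hint (k + 1) a)
          fun x hx => abs_sb_sub_le hA hK (hosc k) a x hx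
      calc _ ≤ V * matNorm (D.Q k (k + 1)) := h1
        _ ≤ V * (C * D.q k ^ s) := mul_le_mul_of_nonneg_left (h k) hV0
        _ ≤ V * (C * D.q (k + 1) ^ s) := by
            refine mul_le_mul_of_nonneg_left (mul_le_mul_of_nonneg_left ?_ hC.le) hV0
            exact q_rpow_mono hA hK hs.le k.le_succ
        _ = V * C * D.q (k + 1) ^ s := by ring
        _ ≤ _ := by
            refine mul_le_mul_of_nonneg_right ?_ hq.le
            have := norm_nonneg (μ 0)
            linarith
  obtain ⟨δ, hδ, C, hC, h⟩ := norm_le_of_meanZero hA hK ha hb μ hmean hdef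
  refine ⟨min δ 1, lt_min hδ one_pos, C + V, by positivity, fun k a x hx => ?_⟩
  have h1 := hosc k a x hx
  have h2 : |μ k a| ≤ C * D.q k ^ (1 - min δ 1) := (norm_le_pi_norm (μ k) a).trans ((h k).trans
    (mul_le_mul_of_nonneg_left (q_rpow_le _ (by linarith [min_le_left δ 1])) hC.le))
  have h3 : V ≤ V * D.q k ^ (1 - min δ 1) :=
    le_mul_of_one_le_right hV0 (one_le_q_rpow k (by linarith [min_le_right δ 1]))
  have h4 := abs_sub_abs_le_abs_sub (D.sb F (D.time k) a x) (μ k a)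
  linarith

/-- After subtraction of a function which is constant on each interval, the special Birkhoff sums
of a function whose derivative is of bounded variation with mean value zero are small. -/
theorem exists_small_sb (hA : D.Admissible) (hD : D.RothType) {G F : A → ℝ → ℝ}
    (hF : D.tvar F ≠ ⊤) (hmass : D.mass F = 0) (hG : D.IsPrimitive G F) :
    ∃ χ : A → ℝ, ∃ δ > (0 : ℝ), ∃ C > (0 : ℝ), ∀ k a, ∀ x ∈ Ico 0 ((D.iter (D.time k)).len a),
      |D.sb (fun a x => G a x - χ a) (D.time k) a x| ≤ C * D.q k ^ (-δ) := by
  obtain ⟨δ, hδ, C, hC, h⟩ := abs_sb_le_of_mass_zero hA hD hF hmass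
  obtain ⟨hK, ha, hb, hc⟩ := hD
  obtain ⟨C₁, hC₁, h1⟩ := len_iter_time_le hA hK ha (half_pos hδ)
  -- Values at the left ends suffice here, since no mean value condition is needed for shadowing.
  set u : ℕ → A → ℝ := fun k a => D.sb G (D.time k) a 0 with hu
  -- The derivative is at most `q k ^ (1 - δ)` and the interval has length at most `q k ^ (-1 + δ /
  -- 2)`: half of the gain survives.
  have hosc : ∀ k a, ∀ x ∈ Ico 0 ((D.iter (D.time k)).len a),
      |D.sb G (D.time k) a x - u k a| ≤ C * C₁ * D.q k ^ (-(δ / 2)) := by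
    intro k a x hx
    rw [hu, isPrimitive_sb hK hF hG (D.time k) a x hx]
    have h2 : ‖∫ t in (0 : ℝ)..x, D.sb F (D.time k) a t‖ ≤ C * D.q k ^ (1 - δ) * |x - 0| := by
      refine intervalIntegral.norm_integral_le_of_norm_le_const fun t ht => ?_
      rw [uIoc_of_le hx.1] at ht
      exact h k a t ⟨ht.1.le, ht.2.trans_lt hx.2⟩
    rw [sub_zero, abs_of_nonneg hx.1] at h2
    calc _ ≤ C * D.q k ^ (1 - δ) * x := h2
      _ ≤ C * D.q k ^ (1 - δ) * (C₁ * D.q k ^ (-1 + δ / 2)) :=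
          mul_le_mul_of_nonneg_left (hx.2.le.trans (h1 k a)) (mul_pos hC (rpow_pos_q _ _)).le
      _ = C * C₁ * D.q k ^ (-(δ / 2)) := by
          rw [mul_mul_mul_comm, q_rpow_mul]
          ring_nf
  obtain ⟨C₂, hC₂, h2⟩ := matNorm_Q_succ_le hA hK ha (s := δ / 4) (by positivity)
  obtain ⟨C₃, hC₃, h3⟩ := q_rpow_neg_le_succ hA hK ha (s := δ / 8) (by positivity)
  have hu0 : 0 ≤ ‖u 0‖ * D.q 0 ^ (δ / 8) := mul_nonneg (norm_nonneg _) (rpow_pos_q _ _).le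
  have hdef : ∀ k, ‖D.defect u k‖ ≤
      (C * C₁ * C₂ * C₃ + ‖u 0‖ * D.q 0 ^ (δ / 8)) * D.q k ^ (-(δ / 8)) := by
    intro k
    have hp := rpow_pos_q (D := D) k (-(δ / 8))
    cases k with
    | zero =>
      rw [add_mul, mul_assoc ‖u 0‖, q_rpow_mul, add_neg_cancel, Real.rpow_zero, mul_one]
      exact le_add_of_nonneg_left (mul_nonneg (by positivity) hp.le)
    | succ k =>
      have h4 : ‖D.defect u (k + 1)‖ ≤ C * C₁ * D.q k ^ (-(δ / 2)) * matNorm (D.Q k (k + 1)) := by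
        refine (pi_norm_le_iff_of_nonneg (mul_nonneg (mul_pos (mul_pos hC hC₁)
          (rpow_pos_q _ _)).le (matNorm_nonneg _))).2 fun a => ?_
        exact abs_sb_sub_le hA hK (hosc k) a 0 ⟨le_rfl, Data.len_pos _ _⟩
      calc _ ≤ C * C₁ * D.q k ^ (-(δ / 2)) * matNorm (D.Q k (k + 1)) := h4
        _ ≤ C * C₁ * D.q k ^ (-(δ / 2)) * (C₂ * D.q k ^ (δ / 4)) :=
            mul_le_mul_of_nonneg_left (h2 k) (mul_pos (mul_pos hC hC₁) (rpow_pos_q _ _)).le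
        _ = C * C₁ * C₂ * D.q k ^ (-(2 * (δ / 8))) := by
            rw [mul_mul_mul_comm, q_rpow_mul]
            ring_nf
        _ ≤ C * C₁ * C₂ * (C₃ * D.q (k + 1) ^ (-(δ / 8))) :=
            mul_le_mul_of_nonneg_left (h3 k) (by positivity)
        _ = C * C₁ * C₂ * C₃ * D.q (k + 1) ^ (-(δ / 8)) := by ring
        _ ≤ _ := mul_le_mul_of_nonneg_right (le_add_of_nonneg_right hu0) hp.le
  obtain ⟨χ, τ, hτ, C₄, hC₄, h4⟩ := exists_shadowing hA hK ha hc u (by positivity)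
    (by positivity) hdef
  refine ⟨χ, min τ (δ / 2), lt_min hτ (by positivity), C * C₁ + C₄, by positivity,
    fun k a x hx => ?_⟩
  have e1 : D.sb (fun a x => G a x - χ a) (D.time k) a x
      = (D.sb G (D.time k) a x - u k a) + (u k - D.S 0 k χ) a := by
    have := D.sb_sub G (fun a _ => χ a) (D.time k)
    change D.sb (G - fun a _ => χ a) (D.time k) a x = _
    rw [this, sb_const, Pi.sub_apply, Pi.sub_apply, Pi.sub_apply, S_apply hA hK,
      Q_eq_W hA hK k.zero_le]
    change _ - ((D.W 0 (D.time k))ᵀ *ᵥ χ) a = _ + (_ - ((D.W 0 (D.time k))ᵀ *ᵥ χ) a)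
    ring
  rw [e1, add_mul]
  refine (abs_add_le _ _).trans (add_le_add ((hosc k a x hx).trans ?_) ?_)
  · exact mul_le_mul_of_nonneg_left (q_rpow_le _ (neg_le_neg (min_le_right _ _))) (by positivity)
  · exact (norm_le_pi_norm (u k - D.S 0 k χ) a).trans ((h4 k).trans
      (mul_le_mul_of_nonneg_left (q_rpow_le _ (neg_le_neg (min_le_left _ _))) hC₄.le))

end Data

end SmallSums

/-! ### From small special sums to bounded transfer functions. -/

section Bounded

variable {A : Type*} [Fintype A] [DecidableEq A] [Nontrivial A]

namespace Data

/-- The function `F` is, up to an error at most `δ`, the coboundary of a function bounded by `M`. -/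
def NearCoboundary (L R len : A → ℝ) (tot : ℝ) (F : A → ℝ → ℝ) (M δ : ℝ) : Prop :=
  ∃ ψ : ℝ → ℝ, (∀ x ∈ Ico 0 tot, |ψ x| ≤ M) ∧
    ∀ a, ∀ x ∈ Ico 0 (len a), |ψ (R a + x) - ψ (L a + x) - F a x| ≤ δ

/-- Replacing the map by its inverse changes the sign of the function. -/
theorem NearCoboundary.swap {L R len : A → ℝ} {tot : ℝ} {F : A → ℝ → ℝ} {M δ : ℝ}
    (h : NearCoboundary L R len tot F M δ) : NearCoboundary R L len tot (-F) M δ := by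
  obtain ⟨ψ, h1, h2⟩ := h
  refine ⟨ψ, h1, fun a x hx => ?_⟩
  rw [abs_sub_comm]
  convert h2 a x hx using 2
  simp only [Pi.neg_apply]
  ring

/-- An approximate transfer function for the first return map extends to the larger interval. The
bound grows by the size of `F`, the error does not grow at all. -/
theorem EndpointStep.nearCoboundary {w l : A} {len L R len' L' R' : A → ℝ} {tot tot' : ℝ}
    (e : EndpointStep w l len L R len' L' R' tot tot') {F F' : A → ℝ → ℝ} {M δ B : ℝ}
    (hF : ∀ a, ∀ x ∈ Ico 0 (len a), |F a x| ≤ B) (hδ : 0 ≤ δ)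
    (hne : ∀ a, a ≠ l → F' a = F a) (hl : ∀ x, F' l x = F l x + F w (x + (len w - len l)))
    (h : NearCoboundary L' R' len' tot' F' M δ) : NearCoboundary L R len tot F (M + B) δ := by
  obtain ⟨ψ, h1, h2⟩ := h
  have hlenl : len' l = len l := e.len_of_ne l e.ne.symm
  have hB : 0 ≤ B := (abs_nonneg _).trans (hF l 0 ⟨le_rfl, by rw [← hlenl]; exact e.len_pos l⟩)
  have htot := e.tot_eq
  -- The cut-off end is the image of the loser's interval, so the equation on that interval forces
  -- the new values. On the end of the winner's interval the equation then reduces to the one for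
  -- the loser after the step.
  set ψ' : ℝ → ℝ := fun x => if x < tot' then ψ x else ψ (L' l + (x - tot')) + F l (x - tot') with hψ'
  have hold : ∀ {x}, x < tot' → ψ' x = ψ x := fun {x} hx => if_pos hx
  have hnew : ∀ y, 0 ≤ y → ψ' (tot' + y) = ψ (L' l + y) + F l y := fun y hy => by
    simp only [hψ', if_neg (not_lt.2 (le_add_of_nonneg_right hy)), add_sub_cancel_left]
  refine ⟨ψ', fun x hx => ?_, fun a x hx => ?_⟩
  · rcases lt_or_ge x tot' with hx' | hx'
    · rw [hold hx']
      linarith [h1 x ⟨hx.1, hx'⟩]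
    · obtain ⟨y, rfl⟩ : ∃ y, x = tot' + y := ⟨x - tot', by ring⟩
      have hy : y ∈ Ico 0 (len l) := ⟨by linarith, by linarith [hx.2]⟩
      rw [hnew y hy.1]
      refine (abs_add_le _ _).trans (add_le_add (h1 _ ⟨?_, ?_⟩) (hF l y hy))
      · linarith [e.left_nonneg l, hy.1]
      · linarith [e.left_le l, hy.2]
  · by_cases hal : a = l
    · subst hal
      have e1 : R a + x = tot' + x := by linarith [e.right_end]
      rw [e1, hnew x hx.1, ← e.left_eq a, hold (by linarith [e.left_le a, hx.2])]
      have : ψ (L' a + x) + F a x - ψ (L' a + x) - F a x = 0 := by ring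
      rw [this, abs_zero]
      exact hδ
    · by_cases hx' : x < len' a
      · rw [← e.left_eq a, ← e.right_eq a hal, hold (by linarith [e.right_le a]),
          hold (by linarith [e.left_le a]), ← hne a hal]
        exact h2 a x ⟨hx.1, hx'⟩
      · have haw : a = w := by
          by_contra haw
          rw [e.len_of_ne a haw] at hx'
          exact hx' hx.2
        subst haw
        rw [e.len_winner, not_lt] at hx'
        obtain ⟨y, rfl⟩ : ∃ y, x = y + (len a - len l) := ⟨x - (len a - len l), by ring⟩
        have hy : y ∈ Ico 0 (len l) := ⟨by linarith, by linarith [hx.2]⟩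
        have e1 : L a + (y + (len a - len l)) = tot' + y := by linarith [e.left_winner]
        have e2 : R a + (y + (len a - len l)) = R' l + y := by linarith [e.right_loser]
        rw [e1, e2, hnew y hy.1, hold (by linarith [e.right_le l, hy.2])]
        have := h2 l y (by rwa [hlenl])
        rw [hl] at this
        convert this using 2
        ring

variable {D : Data A}

theorem Generic.nearCoboundary (h : D.Generic) {F : A → ℝ → ℝ} {M δ B : ℝ}
    (hF : ∀ a, ∀ x ∈ Ico 0 (D.len a), |F a x| ≤ B) (hδ : 0 ≤ δ)
    (hn : NearCoboundary D.step.left D.step.right D.step.len D.step.total (D.birk F) M δ) :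
    NearCoboundary D.left D.right D.len D.total F (M + B) δ := by
  rcases h.endpoints with e | e
  · exact e.nearCoboundary hF hδ (fun a ha => birk_of_ne F ha) (fun x => by rw [birk_loser]) hn
  · have := (e.nearCoboundary (F := -F) (fun a x hx => by
      rw [Pi.neg_apply, Pi.neg_apply, abs_neg]
      exact hF a x hx) hδ (fun a ha => by
      ext x
      rw [Pi.neg_apply, birk_of_ne F ha]
      rfl) (fun x => by
      rw [Pi.neg_apply, birk_loser]
      simp only [Pi.neg_apply]
      ring) hn.swap).swap
    rwa [neg_neg] at this

/-- Each step adds to the norm a column sum, which is at least one. Hence the number of elementary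
steps in a block is controlled by (a). -/
theorem nat_sub_le_matNorm_W {m n : ℕ} (h : m ≤ n) : ((n - m : ℕ) : ℝ) ≤ matNorm (D.W m n) := by
  induction n, h using Nat.le_induction with
  | base => simpa using matNorm_nonneg _
  | succ n h ih =>
    rw [(D.big_W m (n + 1)).matNorm_eq, Nat.succ_sub h, Nat.cast_succ]
    rw [(D.big_W m n).matNorm_eq] at ih
    have : ∑ b, colSum (D.W m (n + 1)) b = ∑ b, colSum (D.W m n) b
        + colSum (D.W m n) (D.iter n).winner := by
      simp only [D.colSum_W_succ h, Finset.sum_add_distrib, Finset.sum_ite_eq', Finset.mem_univ,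
        if_true]
    have h1 := (D.big_W m n).one_le_colSum (D.iter n).winner
    change _ ≤ ∑ b, colSum (D.W m (n + 1)) b
    rw [this]
    exact add_le_add ih h1

theorem matNorm_W_mono {m n p : ℕ} (h1 : m ≤ n) (h2 : n ≤ p) : matNorm (D.W m n) ≤ matNorm (D.W m p) := by
  rw [← D.W_mul h1 h2]
  exact matNorm_le_matNorm_mul (D.big_W _ _) (D.big_W _ _)

theorem nearCoboundary_add (hK : D.Keane) {F : A → ℝ → ℝ} {M δ η : ℝ} {m : ℕ} (hδ : 0 ≤ δ)
    (hF : ∀ a, ∀ x ∈ Ico 0 ((D.iter m).len a), |D.sb F m a x| ≤ η) (n : ℕ)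
    (h : NearCoboundary (D.iter (m + n)).left (D.iter (m + n)).right (D.iter (m + n)).len
      (D.iter (m + n)).total (D.sb F (m + n)) M δ) :
    NearCoboundary (D.iter m).left (D.iter m).right (D.iter m).len
      (D.iter m).total (D.sb F m) (M + n * (η * matNorm (D.W m (m + n)))) δ := by
  have hη : 0 ≤ η := (abs_nonneg _).trans
    (hF (Classical.arbitrary A) 0 ⟨le_rfl, Data.len_pos _ _⟩)
  suffices H : ∀ j ≤ n, ∀ M, NearCoboundary (D.iter (m + j)).left (D.iter (m + j)).right
      (D.iter (m + j)).len (D.iter (m + j)).total (D.sb F (m + j)) M δ →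
      NearCoboundary (D.iter m).left (D.iter m).right (D.iter m).len
      (D.iter m).total (D.sb F m) (M + j * (η * matNorm (D.W m (m + n)))) δ from H n le_rfl M h
  intro j
  induction j with
  | zero =>
    intro _ M h
    simpa using h
  | succ j ih =>
    intro hj M h
    have hB : ∀ a, ∀ x ∈ Ico 0 ((D.iter (m + j)).len a),
        |D.sb F (m + j) a x| ≤ η * matNorm (D.W m (m + n)) := by
      intro a x hx
      rw [← iter_iter] at hx
      have := abs_sb_le (hK.iter m) hF j a x hx
      rw [← sb_add, W_iter] at this
      exact this.trans (mul_le_mul_of_nonneg_left (((D.big_W _ _).colSum_le a).trans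
        (matNorm_W_mono (by omega) (by omega))) hη)
    have h' := ih (by omega) _ ((hK.iter_generic (m + j)).nearCoboundary hB hδ
      (by rw [← iter_succ]; exact h))
    convert h' using 1
    push_cast
    ring

/-- A function with small special Birkhoff sums is nearly a coboundary, with uniform bounds. -/
theorem nearCoboundary_of_small (hA : D.Admissible) (hK : D.Keane) (ha : D.CondA)
    {F : A → ℝ → ℝ} {δ C : ℝ} (hδ : 0 < δ) (hC : 0 < C)
    (hF : ∀ k a, ∀ x ∈ Ico 0 ((D.iter (D.time k)).len a),
      |D.sb F (D.time k) a x| ≤ C * D.q k ^ (-δ)) :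
    ∃ M, ∀ k, NearCoboundary D.left D.right D.len D.total F M (C * D.q k ^ (-δ)) := by
  obtain ⟨E, hE, h⟩ := matNorm_Q_succ_le hA hK ha (s := δ / 4) (by positivity)
  have hsum := (summable_q_rpow hA hK (half_pos hδ)).mul_left (C * E ^ 2)
  -- The cost of block `k`: at most `E * q k ^ (δ / 4)` steps, each costing a sum of at most `E * q
  -- k ^ (δ / 4)` terms of size `C * q k ^ (-δ)`.
  set f : ℕ → ℝ := fun k => C * E ^ 2 * D.q k ^ (-(δ / 2)) with hf
  have hf0 : ∀ k, 0 ≤ f k := fun k => mul_nonneg (by positivity) (rpow_pos_q _ _).le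
  have key : ∀ k, ∀ M δ', 0 ≤ δ' → NearCoboundary (D.iter (D.time k)).left
      (D.iter (D.time k)).right (D.iter (D.time k)).len (D.iter (D.time k)).total
      (D.sb F (D.time k)) M δ' → NearCoboundary D.left D.right D.len D.total F
        (M + ∑ j ∈ Finset.range k, f j) δ' := by
    intro k
    induction k with
    | zero =>
      intro M δ' _ h
      rw [Finset.sum_range_zero, add_zero]
      exact h
    | succ k ih =>
      intro M δ' hδ' hM
      obtain ⟨n, hn⟩ := Nat.exists_eq_add_of_le (time_strictMono hA hK k.lt_succ_self).le
      rw [hn] at hM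
      have h1 := nearCoboundary_add hK hδ' (hF k) n hM
      obtain ⟨ψ, h2, h3⟩ := ih _ δ' hδ' h1
      refine ⟨ψ, fun x hx => (h2 x hx).trans ?_, h3⟩
      rw [Finset.sum_range_succ, add_assoc, add_comm (∑ j ∈ Finset.range k, f j)]
      refine add_le_add le_rfl (add_le_add ?_ le_rfl)
      have h4 : matNorm (D.W (D.time k) (D.time k + n)) ≤ E * D.q k ^ (δ / 4) := by
        have := h k
        rwa [Q_eq_W hA hK k.le_succ, hn] at this
      have h5 : (n : ℝ) ≤ E * D.q k ^ (δ / 4) := by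
        have := nat_sub_le_matNorm_W (D := D) (Nat.le_add_right (D.time k) n)
        rw [Nat.add_sub_cancel_left] at this
        exact this.trans h4
      have hq1 := rpow_pos_q (D := D) k (-δ)
      have hq2 := rpow_pos_q (D := D) k (δ / 4)
      calc (n : ℝ) * (C * D.q k ^ (-δ) * matNorm (D.W (D.time k) (D.time k + n)))
          ≤ (E * D.q k ^ (δ / 4)) * (C * D.q k ^ (-δ) * (E * D.q k ^ (δ / 4))) := by
            have := matNorm_nonneg (D.W (D.time k) (D.time k + n))
            gcongr
        _ = C * E ^ 2 * (D.q k ^ (δ / 4) * D.q k ^ (-δ) * D.q k ^ (δ / 4)) := by ring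
        _ = f k := by
            rw [q_rpow_mul, q_rpow_mul, hf]
            ring_nf
  refine ⟨∑' j, f j, fun k => ?_⟩
  have hCq := mul_pos hC (rpow_pos_q (D := D) k (-δ))
  -- At time `k` the zero function is a transfer function up to the size of the special sums.
  obtain ⟨ψ, h1, h2⟩ := key k 0 _ hCq.le ⟨0, fun x _ => by simp, fun a x hx => by
    simpa using hF k a x hx⟩
  refine ⟨ψ, fun x hx => (h1 x hx).trans ?_, h2⟩
  rw [zero_add]
  exact hsum.sum_le_tsum _ fun j _ => hf0 j

theorem abs_birkhoffSum_sub_le {Φ : D.Dom → ℝ} {ψ : ℝ → ℝ} {δ : ℝ}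
    (h : ∀ x : D.Dom, |ψ (D.T x) - ψ x - Φ x| ≤ δ) (n : ℕ) (x : D.Dom) :
    |ψ (D.T^[n] x) - ψ x - birkhoffSum D.T Φ n x| ≤ n * δ := by
  induction n with
  | zero => simp
  | succ n ih =>
    rw [birkhoffSum_succ, Function.iterate_succ_apply']
    calc _ = |(ψ (D.T^[n] x) - ψ x - birkhoffSum D.T Φ n x)
          + (ψ (D.T (D.T^[n] x)) - ψ (D.T^[n] x) - Φ (D.T^[n] x))| := by
          congr 1
          ring
      _ ≤ n * δ + δ := (abs_add_le _ _).trans (add_le_add ih (h _))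
      _ = _ := by
          push_cast
          ring

/-- The function on the intervals given by a function on `I`. -/
def loc (D : Data A) (Φ : ℝ → ℝ) : A → ℝ → ℝ := fun a x => Φ (D.left a + x)

/-- A function whose derivative is of bounded variation with mean value zero has, up to a function
constant on each interval, bounded Birkhoff sums. -/
theorem exists_bounded_birkhoffSum (hA : D.Admissible) (hD : D.RothType) {Φ F : ℝ → ℝ}
    (hF : D.tvar (D.loc F) ≠ ⊤) (hmass : D.mass (D.loc F) = 0)
    (hΦ : D.IsPrimitive (D.loc Φ) (D.loc F)) :
    ∃ χ : A → ℝ, ∃ M, ∀ Θ : D.Dom → ℝ, (∀ a x hx, Θ (D.pt a x hx) = Φ (D.left a + x) - χ a) →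
      ∀ n x, |birkhoffSum D.T Θ n x| ≤ M := by
  obtain ⟨χ, δ, hδ, C, hC, h⟩ := exists_small_sb hA hD hF hmass hΦ
  obtain ⟨M, hM⟩ := nearCoboundary_of_small hA hD.1 hD.2.1 hδ hC h
  refine ⟨χ, 2 * M, fun Θ hΘ n x => ?_⟩
  -- The transfer functions depend on `k` and need not converge. For fixed `n`, however, they bound
  -- the Birkhoff sum by `2 * M` plus `n` times an error that tends to zero.
  have hlim : Filter.Tendsto (fun k => 2 * M + n * (C * D.q k ^ (-δ))) Filter.atTop
      (nhds (2 * M + n * (C * 0))) :=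
    (((tendsto_q_rpow hA hD.1 hδ).const_mul C).const_mul (n : ℝ)).const_add (2 * M)
  rw [mul_zero, mul_zero, add_zero] at hlim
  refine ge_of_tendsto' hlim fun k => ?_
  obtain ⟨ψ, h1, h2⟩ := hM k
  have h3 := abs_birkhoffSum_sub_le (Φ := Θ) (ψ := ψ) (δ := C * D.q k ^ (-δ)) (fun y => by
    obtain ⟨a, z, hz, rfl⟩ := D.exists_pt y
    rw [T_pt, hΘ]
    exact h2 a z hz) n x
  have h4 := h1 _ (D.T^[n] x).2
  have h5 := h1 _ x.2
  rw [abs_le] at *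
  constructor <;> linarith [h3.1, h3.2, h4.1, h4.2, h5.1, h5.2]

open Filter in
/-- A function with bounded Birkhoff sums is the coboundary of a bounded function. -/
theorem exists_bounded_coboundary {Θ : D.Dom → ℝ} {M : ℝ}
    (h : ∀ n x, |birkhoffSum D.T Θ n x| ≤ M) :
    ∃ ψ : D.Dom → ℝ, (∀ x, |ψ x| ≤ M) ∧ (∀ x, ψ (D.T x) - ψ x = Θ x) ∧
      (Measurable D.T → Measurable Θ → Measurable ψ) := by
  have hb : ∀ x, IsBoundedUnder (· ≤ ·) atTop fun n => birkhoffSum D.T Θ n x := fun x =>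
    isBoundedUnder_of ⟨M, fun n => (abs_le.1 (h n x)).2⟩
  have hb' : ∀ x, IsBoundedUnder (· ≥ ·) atTop fun n => birkhoffSum D.T Θ n x := fun x =>
    isBoundedUnder_of ⟨-M, fun n => (abs_le.1 (h n x)).1⟩
  -- The cocycle relation `S_{n+1} Θ (x) = Θ (x) + S_n Θ (T x)` and the shift invariance of the
  -- limsup give the equation; a limsup of a sequence also keeps measurability.
  refine ⟨fun x => -limsup (fun n => birkhoffSum D.T Θ n x) atTop, fun x => ?_, fun x => ?_,
    fun hT hΘ => ?_⟩
  · rw [abs_neg, abs_le]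
    constructor
    · exact le_limsup_of_frequently_le (Frequently.of_forall fun n => (abs_le.1 (h n x)).1) (hb x)
    · exact limsup_le_of_le (hb' x).isCoboundedUnder_le
        (Eventually.of_forall fun n => (abs_le.1 (h n x)).2)
  · have h1 : limsup (fun n => birkhoffSum D.T Θ n x) atTop
        = Θ x + limsup (fun n => birkhoffSum D.T Θ n (D.T x)) atTop := by
      rw [← limsup_nat_add _ 1, ← limsup_const_add _ _ _ (hb _) (hb' _).isCoboundedUnder_le]
      simp only [birkhoffSum_succ']
    simp only [h1]
    ring
  · refine (Measurable.limsup fun n => ?_).neg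
    unfold birkhoffSum
    exact Finset.measurable_sum _ fun k _ => hΘ.comp (hT.iterate k)

theorem abs_birkhoffSum_le_of_coboundary {Θ ψ : D.Dom → ℝ} {M : ℝ} (h : ∀ x, |ψ x| ≤ M)
    (hψ : ∀ x, ψ (D.T x) - ψ x = Θ x) (n : ℕ) (x : D.Dom) : |birkhoffSum D.T Θ n x| ≤ 2 * M := by
  have : birkhoffSum D.T Θ n x = ψ (D.T^[n] x) - ψ x := by
    induction n with
    | zero => simp
    | succ n ih =>
      rw [birkhoffSum_succ, ih, ← hψ, Function.iterate_succ_apply']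
      ring
  rw [this]
  have h1 := abs_le.1 (h x)
  have h2 := abs_le.1 (h (D.T^[n] x))
  rw [abs_le]
  constructor <;> linarith

end Data

end Bounded

/-! ### Lipschitz functions with invariant increments are affine. -/

section Rigidity

variable {A : Type*} [Fintype A] [DecidableEq A] [Nontrivial A]

theorem offset_eq_zero (p : A ≃ Fin (Fintype.card A)) (len : A → ℝ) {a : A} (ha : (p a : ℕ) = 0) :
    offset p len a = 0 :=
  Finset.sum_eq_zero fun b hb => by simp [Fin.lt_def, ha] at hb

theorem offset_succ (p : A ≃ Fin (Fintype.card A)) (len : A → ℝ) {a b : A}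
    (h : (p b : ℕ) = p a + 1) : offset p len b = offset p len a + len a := by
  rw [offset_add_len, offset]
  refine Finset.sum_congr ?_ fun _ _ => rfl
  ext c
  simp only [Finset.mem_filter, Finset.mem_univ, true_and, Fin.lt_def, Fin.le_def]
  omega

namespace Data

/-- The increments of `ψ` over an interval and over its image are the same. -/
def InvariantIncrements (L R len : A → ℝ) (ψ : ℝ → ℝ) : Prop :=
  ∀ a, ∀ x ∈ Icc 0 (len a), ψ (R a + x) - ψ (R a) = ψ (L a + x) - ψ (L a)

theorem InvariantIncrements.swap {L R len : A → ℝ} {ψ : ℝ → ℝ}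
    (h : InvariantIncrements L R len ψ) : InvariantIncrements R L len ψ :=
  fun a x hx => (h a x hx).symm

theorem EndpointStep.shift_mem {w l : A} {len L R len' L' R' : A → ℝ} {tot tot' : ℝ}
    (e : EndpointStep w l len L R len' L' R' tot tot') {x : ℝ} (hx : x ∈ Icc 0 (len l)) :
    len' w + x ∈ Icc 0 (len w) := by
  have := e.lt
  rw [e.len_winner]
  exact ⟨by linarith [hx.1], by linarith [hx.2]⟩

theorem EndpointStep.increment_winner {w l : A} {len L R len' L' R' : A → ℝ} {tot tot' : ℝ}
    (e : EndpointStep w l len L R len' L' R' tot tot') {ψ : ℝ → ℝ}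
    (h : InvariantIncrements L R len ψ) {y : ℝ} (hy : y ∈ Icc 0 (len l)) :
    ψ (L w + (len' w + y)) - ψ (L w + len' w) = ψ (L l + y) - ψ (L l) := by
  have e1 : L w + len' w = R l := by linarith [e.left_winner, e.right_end, e.len_winner]
  rw [← add_assoc, e1]
  exact h l y hy

theorem EndpointStep.invariantIncrements {w l : A} {len L R len' L' R' : A → ℝ} {tot tot' : ℝ}
    (e : EndpointStep w l len L R len' L' R' tot tot') {ψ : ℝ → ℝ}
    (h : InvariantIncrements L R len ψ) : InvariantIncrements L' R' len' ψ := by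
  intro a x hx
  have hlen : len' a ≤ len a := by
    by_cases haw : a = w
    · rw [haw, e.len_winner]
      have := e.len_pos l
      rw [e.len_of_ne l e.ne.symm] at this
      linarith
    · rw [e.len_of_ne a haw]
  rw [e.left_eq]
  by_cases hal : a = l
  · subst hal
    have hx' : x ∈ Icc 0 (len a) := ⟨hx.1, hx.2.trans hlen⟩
    have h0 : (0 : ℝ) ∈ Icc 0 (len a) := ⟨le_rfl, hx'.1.trans hx'.2⟩
    have e1 : R' a = R w + len' w := by linarith [e.right_loser, e.len_winner]
    have h1 := h w _ (e.shift_mem hx')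
    have h2 := h w _ (e.shift_mem h0)
    have h3 := e.increment_winner h hx'
    rw [add_zero] at h2
    rw [e1, add_assoc]
    linarith
  · rw [e.right_eq a hal]
    exact h a x ⟨hx.1, hx.2.trans hlen⟩

variable {D : Data A}

/-- The increment of `ψ` from the left end of an interval. -/
def increment (D : Data A) (ψ : ℝ → ℝ) (a : A) (x : ℝ) : ℝ := ψ (D.left a + x) - ψ (D.left a)

/-- Invariance passes to the first return map. The end cut from the winner's interval corresponds,
under `T` or its inverse, to the loser's interval, so the increment over it is an increment over the
latter. -/
theorem Generic.increment_step (h : D.Generic) {ψ : ℝ → ℝ}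
    (hψ : InvariantIncrements D.left D.right D.len ψ) :
    InvariantIncrements D.step.left D.step.right D.step.len ψ ∧
    (∀ a, ∀ x ∈ Icc 0 (D.step.len a), D.step.increment ψ a x = D.increment ψ a x) ∧
    ∀ y ∈ Icc 0 (D.len D.loser), D.increment ψ D.winner (D.step.len D.winner + y) =
      D.increment ψ D.winner (D.step.len D.winner) + D.increment ψ D.loser y := by
  have hl := D.len_pos D.loser
  rcases h.endpoints with e | e
  · refine ⟨e.invariantIncrements hψ, fun a x hx => ?_, fun y hy => ?_⟩
    · unfold increment
      rw [e.left_eq]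
    · have := e.increment_winner hψ hy
      unfold increment
      linarith
  · have h' := (e.invariantIncrements hψ.swap).swap
    refine ⟨h', fun a x hx => ?_, fun y hy => ?_⟩
    · have h1 := h' a x hx
      have h2 := hψ a x ⟨hx.1, hx.2.trans (h.step_len_le a)⟩
      rw [e.left_eq] at h1
      unfold increment
      linarith
    · have h1 := e.increment_winner hψ.swap hy
      have h2 := hψ _ _ (e.shift_mem hy)
      have h3 := hψ _ _ (e.shift_mem ⟨le_rfl, hl.le⟩)
      have h4 := hψ _ _ hy
      rw [add_zero] at h3
      unfold increment
      linarith

/-- The increments of `ψ` over the intervals. -/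
def incrementVec (D : Data A) (ψ : ℝ → ℝ) (a : A) : ℝ := D.increment ψ a (D.len a)

theorem invariantIncrements_iter (hK : D.Keane) {ψ : ℝ → ℝ}
    (hψ : InvariantIncrements D.left D.right D.len ψ) (n : ℕ) :
    InvariantIncrements (D.iter n).left (D.iter n).right (D.iter n).len ψ := by
  induction n with
  | zero => exact hψ
  | succ n ih =>
    rw [iter_succ]
    exact ((hK.iter_generic n).increment_step ih).1

theorem Generic.incrementVec_step (h : D.Generic) {ψ : ℝ → ℝ}
    (hψ : InvariantIncrements D.left D.right D.len ψ) :
    (∀ a, a ≠ D.winner → D.incrementVec ψ a = D.step.incrementVec ψ a) ∧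
    D.incrementVec ψ D.winner = D.step.incrementVec ψ D.winner + D.step.incrementVec ψ D.loser := by
  obtain ⟨-, h2, h3⟩ := h.increment_step hψ
  have h4 : ∀ a, a ≠ D.winner → D.incrementVec ψ a = D.step.incrementVec ψ a := fun a ha => by
    unfold incrementVec
    rw [h2 a _ ⟨(D.step.len_pos a).le, le_rfl⟩, h.step_len_of_ne ha]
  refine ⟨h4, ?_⟩
  rw [← h4 _ h.winner_ne_loser.symm]
  unfold incrementVec
  rw [h2 _ _ ⟨(D.step.len_pos _).le, le_rfl⟩, ← h3 _ ⟨(D.len_pos _).le, le_rfl⟩]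
  congr 1
  rw [h.step_len_winner]
  ring

/-- Increments over the intervals obey the same recursion as the lengths, which are the case where
`ψ` is the identity. -/
theorem W_mulVec_incrementVec (hK : D.Keane) {ψ : ℝ → ℝ}
    (hψ : InvariantIncrements D.left D.right D.len ψ) (n : ℕ) :
    D.W 0 n *ᵥ (D.iter n).incrementVec ψ = D.incrementVec ψ := by
  induction n with
  | zero =>
    rw [W_self, Matrix.one_mulVec]
    rfl
  | succ n ih =>
    rw [D.W_succ n.zero_le, ← Matrix.mulVec_mulVec, ← ih]
    congr 1
    obtain ⟨h1, h2⟩ := (hK.iter_generic n).incrementVec_step (invariantIncrements_iter hK hψ n)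
    rw [V, Matrix.add_mulVec, Matrix.one_mulVec, iter_succ]
    ext a
    rw [Pi.add_apply, Matrix.single_mulVec, Function.update_apply]
    split_ifs with ha
    · rw [ha, h2]
      ring
    · rw [h1 a ha]
      simp

theorem abs_increment_le {K : NNReal} {ψ : ℝ → ℝ} (hψ : LipschitzWith K ψ) {a : A} {x : ℝ}
    (hx : x ∈ Icc 0 (D.len a)) : |D.increment ψ a x| ≤ K * D.len a := by
  have h1 := hψ.dist_le_mul (D.left a + x) (D.left a)
  rw [Real.dist_eq, Real.dist_eq, add_sub_cancel_left, abs_of_nonneg hx.1] at h1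
  exact h1.trans (mul_le_mul_of_nonneg_left hx.2 K.2)

theorem tendsto_iter_time_len (hA : D.Admissible) (hK : D.Keane) (ha : D.CondA) :
    ∃ f : ℕ → ℝ, Filter.Tendsto f Filter.atTop (nhds 0) ∧
      ∀ k b, (D.iter (D.time k)).len b ≤ f k := by
  obtain ⟨C, hC, h⟩ := len_iter_time_le hA hK ha (s := 1 / 2) (by norm_num)
  refine ⟨fun k => C * D.q k ^ (-1 + 1 / 2 : ℝ), ?_, h⟩
  have := (tendsto_q_rpow hA hK (s := 1 / 2) (by norm_num)).const_mul C
  rw [mul_zero] at this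
  convert this using 4
  norm_num

/-- The increments over the intervals of a Lipschitz function with invariant increments are
proportional to the lengths. -/
theorem incrementVec_eq (hA : D.Admissible) (hK : D.Keane) (ha : D.CondA) (hb : D.CondB)
    {K : NNReal} {ψ : ℝ → ℝ} (hψ : LipschitzWith K ψ)
    (hinv : InvariantIncrements D.left D.right D.len ψ) :
    ∃ c, ∀ a, D.incrementVec ψ a = c * D.len a := by
  obtain ⟨θ, hθ, B, hB, hb⟩ := hb
  obtain ⟨C, hC, hlen⟩ := len_iter_time_le hA hK ha (half_pos hθ)
  -- Pairing `v` with the increments is the same at time `0` and, after applying `S(0, k)` to `v`,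
  -- at time `k`. There (b) allows growth `q k ^ (1 - θ)`, while the Lipschitz bound makes the
  -- increments at most of order `q k ^ (-1 + θ / 2)`; so the pairing vanishes.
  have horth : ∀ v : A → ℝ, ∑ a, D.len a * v a = 0 → v ⬝ᵥ D.incrementVec ψ = 0 := by
    intro v hv
    set E : ℝ := Fintype.card A * (B * ‖v‖ * (K * C)) with hE
    have hbound : ∀ k, |v ⬝ᵥ D.incrementVec ψ| ≤ E * D.q k ^ (-(θ / 2)) := by
      intro k
      rw [← W_mulVec_incrementVec hK hinv (D.time k), Matrix.dotProduct_mulVec,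
        ← Matrix.mulVec_transpose]
      have hQ : (D.W 0 (D.time k))ᵀ *ᵥ v = D.S 0 k v := by
        rw [S_apply hA hK, Q_eq_W hA hK k.zero_le]
        rfl
      rw [hQ]
      calc |D.S 0 k v ⬝ᵥ (D.iter (D.time k)).incrementVec ψ|
          ≤ ∑ a, |D.S 0 k v a * (D.iter (D.time k)).incrementVec ψ a| :=
            Finset.abs_sum_le_sum_abs _ _
        _ ≤ ∑ _a : A, (B * D.q k ^ (1 - θ) * ‖v‖) * (K * (C * D.q k ^ (-1 + θ / 2))) := by
            refine Finset.sum_le_sum fun a _ => ?_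
            rw [abs_mul]
            refine mul_le_mul ((norm_le_pi_norm (D.S 0 k v) a).trans (hb k v hv)) ?_
              (abs_nonneg _) (mul_nonneg (mul_pos hB (rpow_pos_q _ _)).le (norm_nonneg _))
            exact (abs_increment_le hψ ⟨(Data.len_pos _ _).le, le_rfl⟩).trans
              (mul_le_mul_of_nonneg_left (hlen k a) K.2)
        _ = E * (D.q k ^ (1 - θ) * D.q k ^ (-1 + θ / 2)) := by
            rw [Finset.sum_const, Finset.card_univ, nsmul_eq_mul, hE]
            ring
        _ = _ := by
            rw [q_rpow_mul]
            ring_nf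
    have hlim := (tendsto_q_rpow hA hK (half_pos hθ)).const_mul E
    rw [mul_zero] at hlim
    exact abs_eq_zero.1 (le_antisymm (ge_of_tendsto' hlim hbound) (abs_nonneg _))
  obtain ⟨b⟩ := (inferInstance : Nonempty A)
  refine ⟨D.incrementVec ψ b / D.len b, fun a => ?_⟩
  have hb0 := (D.len_pos b).ne'
  -- The test vector is supported on two letters and orthogonal to the lengths.
  have := horth (Pi.single a (D.len b) - Pi.single b (D.len a)) (by
    change D.len ⬝ᵥ _ = 0
    rw [dotProduct_sub, dotProduct_single, dotProduct_single]
    ring)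
  rw [sub_dotProduct, single_dotProduct, single_dotProduct] at this
  field_simp
  linarith

theorem eq_of_increment_eq_zero {ψ : ℝ → ℝ}
    (h : ∀ a, ∀ x ∈ Icc 0 (D.len a), D.increment ψ a x = 0) {x : ℝ} (hx : x ∈ Ico 0 D.total) :
    ψ x = ψ 0 := by
  have hleft : ∀ i : ℕ, ∀ a, (D.top a : ℕ) = i → ψ (D.left a) = ψ 0 := by
    intro i
    induction i with
    | zero =>
      intro a ha
      rw [left, offset_eq_zero _ _ ha]
    | succ i ih =>
      intro b hb
      set a := D.top.symm ⟨i, by have := (D.top b).2; omega⟩ with hadef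
      have ha : (D.top a : ℕ) = i := by simp [hadef]
      have h1 := h a (D.len a) ⟨(D.len_pos a).le, le_rfl⟩
      have h2 : D.left b = D.left a + D.len a := offset_succ _ _ (by omega)
      rw [h2, ← ih a ha]
      exact sub_eq_zero.1 h1
  obtain ⟨a, y, hy, hxy⟩ := D.exists_pt ⟨x, hx⟩
  have : x = D.left a + y := congrArg Subtype.val hxy
  rw [this, ← hleft _ a rfl]
  exact sub_eq_zero.1 (h a y ⟨hy.1, hy.2.le⟩)

/-- For interval exchange maps of Roth type, a Lipschitz function with invariant increments is
affine. -/
theorem affine_of_invariantIncrements (hA : D.Admissible) (hD : D.RothType)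
    {K : NNReal} {ψ : ℝ → ℝ} (hψ : LipschitzWith K ψ)
    (hinv : ∀ a, ∀ x ∈ Ico 0 (D.len a),
      ψ (D.right a + x) - ψ (D.right a) = ψ (D.left a + x) - ψ (D.left a)) :
    ∃ c, ∀ x ∈ Ico 0 D.total, ψ x = ψ 0 + c * x := by
  obtain ⟨hK, ha, hb, -⟩ := hD
  -- Continuity adds the right ends, so that increments over whole intervals make sense.
  have hinv' : InvariantIncrements D.left D.right D.len ψ := by
    intro a
    have hcl : EqOn (fun x => ψ (D.right a + x) - ψ (D.right a))
        (fun x => ψ (D.left a + x) - ψ (D.left a)) (closure (Ico 0 (D.len a))) :=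
      (show EqOn _ _ (Ico 0 (D.len a)) from hinv a).closure
        ((hψ.continuous.comp (continuous_const.add continuous_id)).sub continuous_const)
        ((hψ.continuous.comp (continuous_const.add continuous_id)).sub continuous_const)
    rw [closure_Ico (D.len_pos a).ne] at hcl
    exact hcl
  obtain ⟨c, hc⟩ := incrementVec_eq hA hK ha hb hψ hinv'
  -- Without its linear part the function has zero increment over every interval, at time `0` and
  -- hence at all times.
  set φ : ℝ → ℝ := fun x => ψ x - c * x with hφ
  obtain ⟨K', hφL⟩ : ∃ K' : NNReal, LipschitzWith K' φ :=
    ⟨_, hψ.sub (lipschitzWith_smul c)⟩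
  have hφinv : InvariantIncrements D.left D.right D.len φ := fun a x hx => by
    have := hinv' a x hx
    simp only [hφ]
    linarith
  have hφ0 : ∀ n, (D.iter n).incrementVec φ = 0 := by
    intro n
    induction n with
    | zero =>
      ext a
      have h1 := hc a
      simp only [incrementVec, increment, hφ, Pi.zero_apply] at h1 ⊢
      change ψ (D.left a + D.len a) - c * (D.left a + D.len a) - (ψ (D.left a) - c * D.left a) = 0
      linarith
    | succ n ih =>
      obtain ⟨h1, h2⟩ := (hK.iter_generic n).incrementVec_step (invariantIncrements_iter hK hφinv n)
      rw [ih] at h1 h2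
      rw [iter_succ]
      have h3 := h1 _ (hK.iter_generic n).winner_ne_loser.symm
      ext a
      by_cases haw : a = (D.iter n).winner
      · rw [haw]
        rw [← h3] at h2
        simpa using h2.symm
      · exact (h1 a haw).symm
  -- A bound on partial increments passes back through a step without loss: past the new right end
  -- of the winner, a partial increment is the full increment over the new interval, which is zero,
  -- plus a partial increment of the loser. At late times all partial increments are small by the
  -- Lipschitz bound.
  have hosc : ∀ (η : ℝ) (n : ℕ), (∀ a, ∀ x ∈ Icc 0 ((D.iter n).len a), |(D.iter n).increment φ a x| ≤ η) →
      ∀ a, ∀ x ∈ Icc 0 (D.len a), |D.increment φ a x| ≤ η := by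
    intro η n
    induction n with
    | zero => exact fun h => h
    | succ n ih =>
      intro h
      refine ih fun a x hx => ?_
      have hg := hK.iter_generic n
      obtain ⟨-, h2, h3⟩ := hg.increment_step (invariantIncrements_iter hK hφinv n)
      rw [iter_succ] at h
      by_cases hx' : x ≤ (D.iter n).step.len a
      · rw [← h2 a x ⟨hx.1, hx'⟩]
        exact h a x ⟨hx.1, hx'⟩
      · have haw : a = (D.iter n).winner := by
          by_contra haw
          rw [hg.step_len_of_ne haw] at hx'
          exact hx' hx.2
        subst haw
        obtain ⟨y, rfl⟩ : ∃ y, x = (D.iter n).step.len (D.iter n).winner + y :=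
          ⟨x - (D.iter n).step.len (D.iter n).winner, by ring⟩
        have hy : y ∈ Icc 0 ((D.iter n).len (D.iter n).loser) :=
          ⟨by linarith, by linarith [hx.2, hg.step_len_winner]⟩
        have h4 := congrFun (hφ0 (n + 1)) (D.iter n).winner
        rw [iter_succ, incrementVec, h2 _ _ ⟨(Data.len_pos _ _).le, le_rfl⟩, Pi.zero_apply] at h4
        rw [← hg.step_len_of_ne hg.winner_ne_loser.symm] at hy
        rw [h3 y (by rwa [← hg.step_len_of_ne hg.winner_ne_loser.symm]), h4, zero_add, ← h2 _ _ hy]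
        exact h _ _ hy
  have hzero : ∀ a, ∀ x ∈ Icc 0 (D.len a), D.increment φ a x = 0 := by
    intro a x hx
    obtain ⟨f, hf, hle⟩ := tendsto_iter_time_len hA hK ha
    have hlim := hf.const_mul (K' : ℝ)
    rw [mul_zero] at hlim
    refine abs_eq_zero.1 (le_antisymm (ge_of_tendsto' hlim fun k => ?_) (abs_nonneg _))
    refine hosc _ (D.time k) (fun b y hy => ?_) a x hx
    exact (abs_increment_le hφL hy).trans (mul_le_mul_of_nonneg_left (hle k b) K'.2)
  refine ⟨c, fun x hx => ?_⟩
  have := eq_of_increment_eq_zero hzero hx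
  simp only [hφ] at this
  linarith

end Data

end Rigidity

/-! ### Piecewise polynomials and piecewise derivatives. -/

section Pieces

open Polynomial

variable {A : Type*} [Fintype A] [DecidableEq A] [Nontrivial A]

/-- Holding for both orders of the intervals, this is what makes the integral of a coboundary
vanish. -/
theorem sum_offset_telescope (p : A ≃ Fin (Fintype.card A)) (len : A → ℝ) (h : ℝ → ℝ) :
    ∑ a, (h (offset p len a + len a) - h (offset p len a)) = h (∑ a, len a) - h 0 := by
  set f : ℕ → ℝ := fun i => ∑ b with (p b : ℕ) < i, len b with hf
  have h1 : ∀ a, offset p len a = f (p a) := fun a => by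
    simp only [hf, offset, Fin.lt_def]
  have h2 : ∀ a, offset p len a + len a = f (p a + 1) := fun a => by
    rw [offset_add_len]
    simp only [hf, Fin.le_def, Nat.lt_succ_iff]
  calc ∑ a, (h (offset p len a + len a) - h (offset p len a))
      = ∑ a, (h (f (p a + 1)) - h (f (p a))) := by simp only [h2]; simp only [h1]
    _ = ∑ i : Fin (Fintype.card A), (h (f (i + 1)) - h (f i)) :=
        Equiv.sum_comp p fun i : Fin (Fintype.card A) => h (f (i + 1)) - h (f i)
    _ = ∑ i ∈ Finset.range (Fintype.card A), (h (f (i + 1)) - h (f i)) :=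
        Fin.sum_univ_eq_sum_range (fun i => h (f (i + 1)) - h (f i)) _
    _ = h (f (Fintype.card A)) - h (f 0) := Finset.sum_range_sub (fun i => h (f i)) _
    _ = _ := by simp [hf]

namespace Data

variable (D : Data A)

/-- The name of the interval that contains `x`. -/
def letter (x : D.Dom) : A := (D.j₀.symm x).1

@[simp]
theorem letter_pt (a : A) (x : ℝ) (hx : x ∈ Ico 0 (D.len a)) : D.letter (D.pt a x hx) = a := by
  rw [← j₀_apply, letter, Equiv.symm_apply_apply]

theorem mem_piece_iff (x : D.Dom) (a : A) : (x : ℝ) ∈ D.piece a ↔ D.letter x = a := by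
  constructor
  · intro h
    have hx : (x : ℝ) - D.left a ∈ Ico 0 (D.len a) := ⟨sub_nonneg.2 h.1, by linarith [h.2]⟩
    have : x = D.pt a _ hx := Subtype.ext (by simp [pt])
    rw [this, letter_pt]
  · rintro rfl
    obtain ⟨b, y, hy, rfl⟩ := D.exists_pt x
    rw [letter_pt]
    change D.left b + y ∈ D.piece b
    exact ⟨by linarith [hy.1], by linarith [hy.2]⟩

theorem mem_piece_letter (y : D.Dom) : (y : ℝ) ∈ D.piece (D.letter y) := (D.mem_piece_iff y _).2 rfl

theorem piece_subset (a : A) : D.piece a ⊆ Ico 0 D.total := fun _ hx =>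
  ⟨(D.left_nonneg a).trans hx.1, hx.2.trans_le (D.left_add_len_le a)⟩

theorem left_add_mem_piece {a : A} {x : ℝ} (hx : x ∈ Ico 0 (D.len a)) : D.left a + x ∈ D.piece a :=
  ⟨by linarith [hx.1], by linarith [hx.2]⟩

theorem right_add_mem {a : A} {x : ℝ} (hx : x ∈ Ico 0 (D.len a)) : D.right a + x ∈ Ico 0 D.total := by
  have := D.right_nonneg a
  have := D.right_add_len_le a
  exact ⟨by linarith [hx.1], by linarith [hx.2]⟩

theorem ext_of_mem (f : D.Dom → ℝ) {x : ℝ} (hx : x ∈ Ico 0 D.total) : D.ext f x = f ⟨x, hx⟩ :=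
  dif_pos hx

@[simp]
theorem ext_coe (f : D.Dom → ℝ) (x : D.Dom) : D.ext f x = f x := D.ext_of_mem f x.2

theorem coboundary_apply (ψ : D.Dom → ℝ) (x : D.Dom) : D.coboundary ψ x = ψ (D.T x) - ψ x := rfl

theorem coboundary_pt (ψ : D.Dom → ℝ) {a : A} {x : ℝ} (hx : x ∈ Ico 0 (D.len a)) :
    D.coboundary ψ (D.pt a x hx) = D.ext ψ (D.right a + x) - D.ext ψ (D.left a + x) := by
  rw [coboundary_apply, ← D.ext_coe ψ (D.T _), ← D.ext_coe ψ (D.pt a x hx), T_pt]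
  rfl

theorem measurable_of_continuousOn_piece {f : D.Dom → ℝ} (g : A → ℝ → ℝ)
    (hg : ∀ a, ContinuousOn (g a) (D.piece a)) (h : ∀ x, f x = g (D.letter x) x) : Measurable f := by
  classical
  have : f = fun x : D.Dom => ∑ a, (D.piece a).piecewise (g a) (fun _ => 0) (x : ℝ) := by
    ext x
    rw [Finset.sum_eq_single (D.letter x), Set.piecewise_eq_of_mem _ _ _ (D.mem_piece_letter x), h]
    · intro a _ ha
      refine Set.piecewise_eq_of_notMem _ _ _ fun hx => ha ?_
      exact ((D.mem_piece_iff x a).1 hx).symm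
    · simp
  rw [this]
  refine Finset.measurable_sum _ fun a _ => ?_
  exact ((hg a).measurable_piecewise (g := fun _ => (0 : ℝ)) continuousOn_const
    measurableSet_Ico).comp measurable_subtype_coe

theorem measurable_T : Measurable D.T := by
  have : Measurable fun x => (D.T x : ℝ) := by
    refine D.measurable_of_continuousOn_piece (fun a x => D.right a + (x - D.left a))
      (fun a => by fun_prop) fun x => ?_
    obtain ⟨a, y, hy, rfl⟩ := D.exists_pt x
    rw [T_pt, letter_pt]
    simp [pt]
  exact this.subtype_mk (h := fun x => (D.T x).2)

/-- The function on `I` given by a polynomial for each interval. -/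
def ev : (A → ℝ[X]) →ₗ[ℝ] (D.Dom → ℝ) where
  toFun p x := (p (D.letter x)).eval (x : ℝ)
  map_add' p q := by ext x; simp
  map_smul' c p := by ext x; simp

theorem ev_apply (p : A → ℝ[X]) (x : D.Dom) : D.ev p x = (p (D.letter x)).eval (x : ℝ) := rfl

theorem ev_pt (p : A → ℝ[X]) {a : A} {x : ℝ} (hx : x ∈ Ico 0 (D.len a)) :
    D.ev p (D.pt a x hx) = (p a).eval (D.left a + x) := by
  rw [ev_apply, letter_pt]
  rfl

theorem ext_ev (p : A → ℝ[X]) {a : A} {x : ℝ} (hx : x ∈ D.piece a) :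
    D.ext (D.ev p) x = (p a).eval x := by
  rw [D.ext_of_mem _ (D.piece_subset a hx), ev_apply,
    (D.mem_piece_iff ⟨x, D.piece_subset a hx⟩ a).1 hx]

theorem piece_infinite (a : A) : (D.piece a).Infinite :=
  Set.Ico_infinite (by linarith [D.len_pos a])

theorem ev_injective : Function.Injective D.ev := by
  intro p q h
  ext1 a
  refine Polynomial.eq_of_infinite_eval_eq _ _ ((D.piece_infinite a).mono fun x hx => ?_)
  have := D.ext_ev q hx
  rw [← h, D.ext_ev p hx] at this
  exact this

theorem iteratedDerivWithin_ev (p : A → ℝ[X]) (l : ℕ) (a : A) :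
    EqOn (iteratedDerivWithin l (D.ext (D.ev p)) (D.piece a))
      (fun x => (derivative^[l] (p a)).eval x) (D.piece a) := by
  refine (iteratedDerivWithin_congr fun x hx => D.ext_ev p hx).trans ?_
  generalize p a = q
  induction l generalizing q with
  | zero => intro x _; simp
  | succ l ih =>
    rw [iteratedDerivWithin_succ', Function.iterate_succ_apply]
    refine (iteratedDerivWithin_congr fun x hx => ?_).trans (ih (derivative q))
    exact q.derivWithin (uniqueDiffOn_Ico' x hx)

/-- The integral over `I` of the function given by a polynomial for each interval. -/
def polyMean (p : A → ℝ[X]) : ℝ := ∑ a, ∫ x in D.left a..D.left a + D.len a, (p a).eval x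

theorem integral_piece (a : A) (f : ℝ → ℝ) :
    ∫ x in D.piece a, f x = ∫ x in D.left a..D.left a + D.len a, f x := by
  rw [intervalIntegral.integral_of_le (by linarith [D.len_pos a]), piece, integral_Ico_eq_integral_Ioc]

theorem bvPiece_polynomial (r : ℕ) {f : ℝ → ℝ} {a b : ℝ} {q : ℝ[X]}
    (h : ∀ l, EqOn (iteratedDerivWithin l f (Ico a b)) (fun x => (derivative^[l] q).eval x) (Ico a b)) :
    BVPiece r f a b := by
  have hcd : ∀ (q : ℝ[X]) (n : WithTop ℕ∞), ContDiff ℝ n fun x => q.eval x :=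
    fun q n => by simpa using q.contDiff_aeval (𝕜 := ℝ) n
  have hlip : ∀ (q : ℝ[X]) (a b : ℝ), ∃ K, LipschitzOnWith K (fun x => q.eval x) (Icc a b) :=
    fun q a b => (hcd q 1).contDiffOn.exists_lipschitzOnWith one_ne_zero (convex_Icc a b) isCompact_Icc
  refine ⟨(hcd q _).contDiffOn.congr fun x hx => ?_, fun c hc => ?_, _, ?_,
    (ae_restrict_mem measurableSet_Ico).mono (h r)⟩
  · have := h 0 hx
    simpa using this
  · obtain ⟨K, hK⟩ := hlip (derivative^[r - 1] q) a c
    refine ac_congr (fun x hx => (h _ ?_).symm)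
      (LipschitzOnWith.absolutelyContinuousOnInterval (by rwa [uIcc_of_le hc.1]))
    rw [uIcc_of_le hc.1] at hx
    exact ⟨hx.1, hx.2.trans_lt hc.2⟩
  · obtain ⟨K, hK⟩ := hlip (derivative^[r] q) a b
    have h2 : BoundedVariationOn (fun x => (derivative^[r] q).eval x) (Icc a b) := by
      have := (LipschitzOnWith.comp_locallyBoundedVariationOn (g := fun x : ℝ => x) (s := Icc a b) hK
        (fun x hx => hx) (monotone_id.monotoneOn _).locallyBoundedVariationOn)
      rcases lt_or_ge b a with hab | hab
      · rw [Icc_eq_empty hab.not_ge]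
        exact ne_of_eq_of_ne (eVariationOn.subsingleton _ subsingleton_empty) ENNReal.zero_ne_top
      · have := this a b (left_mem_Icc.2 hab) (right_mem_Icc.2 hab)
        rwa [inter_self] at this
    exact h2.mono Ico_subset_Icc_self

variable {D}

/-- Derivatives of order beyond `r` vanish, so the mean conditions may be imposed for all `l`; in
this form they no longer mention `r` and pass directly to derivatives. -/
theorem ev_mem_ΓStar {r : ℕ} {p : A → ℝ[X]} (hp : ∀ a, p a ∈ degreeLT ℝ r) :
    D.ev p ∈ D.ΓStar r ↔ ∀ l, 0 < l → D.polyMean (fun a => derivative^[l] (p a)) = 0 := by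
  have key : ∀ l, ∑ a, ∫ x in D.piece a, iteratedDerivWithin l (D.ext (D.ev p)) (D.piece a) x
      = D.polyMean (fun a => derivative^[l] (p a)) := fun l =>
    Finset.sum_congr rfl fun a _ => by
      rw [← integral_piece]
      exact setIntegral_congr_fun measurableSet_Ico (D.iteratedDerivWithin_ev p l a)
  constructor
  · rintro ⟨-, -, h⟩ l hl
    rcases le_or_gt l r with hlr | hlr
    · rw [← key]
      exact h l hl hlr
    · refine Finset.sum_eq_zero fun a _ => ?_
      have : derivative^[l] (p a) = 0 :=
        Polynomial.iterate_derivative_eq_zero_of_degree_lt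
          ((Polynomial.mem_degreeLT.1 (hp a)).trans (by exact_mod_cast hlr))
      simp only [this, eval_zero, intervalIntegral.integral_zero]
  · intro h
    refine ⟨fun a => ⟨p a, hp a, fun x hx => ?_⟩, fun a => ?_, fun l hl _ => ?_⟩
    · rw [ev_apply, (D.mem_piece_iff x a).1 hx]
    · exact bvPiece_polynomial r fun l => D.iteratedDerivWithin_ev p l a
    · rw [key]
      exact h l hl

theorem exists_ev_of_mem_ΓPoly {r : ℕ} {χ : D.Dom → ℝ} (h : χ ∈ D.ΓPoly r) :
    ∃ p : A → ℝ[X], (∀ a, p a ∈ degreeLT ℝ r) ∧ D.ev p = χ := by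
  choose p hp h using h
  exact ⟨p, hp, funext fun x => (h _ x (D.mem_piece_letter x)).symm⟩

/-- The derivative on each interval. -/
def pieceDeriv (D : Data A) (Φ : D.Dom → ℝ) : D.Dom → ℝ :=
  fun x => derivWithin (D.ext Φ) (D.piece (D.letter x)) x

theorem ext_pieceDeriv (Φ : D.Dom → ℝ) (a : A) :
    EqOn (D.ext (D.pieceDeriv Φ)) (derivWithin (D.ext Φ) (D.piece a)) (D.piece a) := by
  intro x hx
  rw [D.ext_of_mem _ (D.piece_subset a hx), pieceDeriv,
    (D.mem_piece_iff ⟨x, D.piece_subset a hx⟩ a).1 hx]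

theorem iteratedDerivWithin_pieceDeriv (Φ : D.Dom → ℝ) (l : ℕ) (a : A) :
    EqOn (iteratedDerivWithin l (D.ext (D.pieceDeriv Φ)) (D.piece a))
      (iteratedDerivWithin (l + 1) (D.ext Φ) (D.piece a)) (D.piece a) := by
  rw [iteratedDerivWithin_succ']
  exact iteratedDerivWithin_congr (ext_pieceDeriv Φ a)

theorem pieceDeriv_mem {n : ℕ} {Φ : D.Dom → ℝ} (h : Φ ∈ D.BVStar (n + 2)) :
    D.pieceDeriv Φ ∈ D.BVStar (n + 1) := by
  obtain ⟨h1, h2⟩ := h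
  refine ⟨fun a => ?_, fun l hl hlr => ?_⟩
  · obtain ⟨h3, h4, φ, h5, h6⟩ := h1 a
    refine ⟨(h3.derivWithin uniqueDiffOn_Ico' (m := n) (by norm_cast)).congr
      (ext_pieceDeriv Φ a), fun c hc => ac_congr (fun x hx => ?_) (h4 c hc), φ, h5, ?_⟩
    · rw [uIcc_of_le hc.1] at hx
      exact (iteratedDerivWithin_pieceDeriv Φ n a ⟨hx.1, hx.2.trans_lt hc.2⟩).symm
    · refine Filter.EventuallyEq.trans ?_ h6
      filter_upwards [ae_restrict_mem measurableSet_Ico] with x hx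
      exact iteratedDerivWithin_pieceDeriv Φ (n + 1) a hx
  · rw [← h2 (l + 1) l.succ_pos (by omega)]
    refine Finset.sum_congr rfl fun a _ => ?_
    exact setIntegral_congr_fun measurableSet_Ico (iteratedDerivWithin_pieceDeriv Φ l a)

theorem BVStar.continuousOn {n : ℕ} {Φ : D.Dom → ℝ} (h : Φ ∈ D.BVStar n) (a : A) :
    ContinuousOn (D.ext Φ) (D.piece a) := (h.1 a).1.continuousOn

theorem BVStar.measurable {n : ℕ} {Φ : D.Dom → ℝ} (h : Φ ∈ D.BVStar n) : Measurable Φ :=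
  D.measurable_of_continuousOn_piece (fun _ => D.ext Φ) (BVStar.continuousOn h) fun _ => (ext_coe _ _ _).symm

theorem measurable_ev (p : A → ℝ[X]) : Measurable (D.ev p) :=
  D.measurable_of_continuousOn_piece (fun a x => (p a).eval x) (fun a => (p a).continuous.continuousOn)
    fun _ => rfl

theorem BVStar.integral_pieceDeriv {n : ℕ} {Φ : D.Dom → ℝ} (h : Φ ∈ D.BVStar (n + 2)) {a : A} {x : ℝ}
    (hx : x ∈ Ico 0 (D.len a)) : ∫ t in (0 : ℝ)..x, D.ext (D.pieceDeriv Φ) (D.left a + t)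
      = D.ext Φ (D.left a + x) - D.ext Φ (D.left a) := by
  have hsub : Icc (D.left a) (D.left a + x) ⊆ D.piece a := fun y hy =>
    ⟨hy.1, hy.2.trans_lt (by linarith [hx.2])⟩
  rw [intervalIntegral.integral_comp_add_left (fun t => D.ext (D.pieceDeriv Φ) t), add_zero]
  have hle : D.left a ≤ D.left a + x := by linarith [hx.1]
  refine intervalIntegral.integral_eq_sub_of_hasDeriv_right_of_le hle
    ((BVStar.continuousOn h a).mono hsub) (fun y hy => ?_) ?_
  · have hy' : y ∈ D.piece a := hsub ⟨hy.1.le, hy.2.le⟩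
    rw [ext_pieceDeriv Φ a hy']
    have hd : DifferentiableWithinAt ℝ (D.ext Φ) (D.piece a) y :=
      ((h.1 a).1.differentiableOn (by simp)) y hy'
    refine hd.hasDerivWithinAt.mono_of_mem_nhdsWithin ?_
    exact mem_nhdsWithin_of_mem_nhds (Ico_mem_nhds hy.1 hy'.2)
  · refine ContinuousOn.intervalIntegrable ?_
    rw [uIcc_of_le hle]
    exact (BVStar.continuousOn (pieceDeriv_mem h) a).mono hsub

end Data

end Pieces

/-! ### Integration of the cohomological equation. -/

section Primitives

open Polynomial

variable {A : Type*} [Fintype A] [DecidableEq A] [Nontrivial A]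

theorem exists_antiderivative {n : ℕ} {q : ℝ[X]} (hq : q ∈ degreeLT ℝ n) :
    ∃ P ∈ degreeLT ℝ (n + 1), derivative P = q := by
  refine ⟨∑ i ∈ Finset.range n, monomial (i + 1) (q.coeff i / (i + 1)), sum_mem fun i hi => ?_, ?_⟩
  · refine mem_degreeLT.2 ((degree_monomial_le _ _).trans_lt ?_)
    have := Finset.mem_range.1 hi
    exact_mod_cast (by omega : i + 1 < n + 1)
  · ext m
    have h : ∀ i : ℕ, q.coeff i / ((i : ℝ) + 1) * ((i : ℝ) + 1) = q.coeff i := fun i =>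
      div_mul_cancel₀ _ (by positivity)
    simp only [derivative_sum, derivative_monomial, finsetSum_coeff, Nat.add_sub_cancel, coeff_monomial,
      Nat.cast_add, Nat.cast_one, h, Finset.sum_ite_eq', Finset.mem_range]
    split_ifs with hm
    · rfl
    · exact (coeff_eq_zero_of_degree_lt ((mem_degreeLT.1 hq).trans_le
        (by exact_mod_cast not_lt.1 hm))).symm

namespace Data

variable {D : Data A}

theorem ext_restrict (g : ℝ → ℝ) : EqOn (D.ext fun x => g x) g (Ico 0 D.total) :=
  fun _ hx => D.ext_of_mem _ hx

/-- The recursion on the order that lets regularity be checked one derivative at a time. -/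
theorem mem_smoothLip_succ {n : ℕ} {ψ : D.Dom → ℝ} : ψ ∈ D.smoothLip (n + 1) ↔
    DifferentiableOn ℝ (D.ext ψ) (Ico 0 D.total) ∧
      (fun x : D.Dom => derivWithin (D.ext ψ) (Ico 0 D.total) x) ∈ D.smoothLip n := by
  have h1 := ext_restrict (D := D) (derivWithin (D.ext ψ) (Ico 0 D.total))
  have h2 := iteratedDerivWithin_congr (n := n) h1
  change (_ ∧ _) ↔ _ ∧ _ ∧ _
  rw [contDiffOn_congr h1]
  have h3 : ((n + 1 : ℕ) : WithTop ℕ∞) = n + 1 := by norm_cast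
  rw [h3, contDiffOn_succ_iff_derivWithin uniqueDiffOn_Ico', iteratedDerivWithin_succ']
  have h4 : ∀ K, LipschitzOnWith K (iteratedDerivWithin n
      (derivWithin (D.ext ψ) (Ico 0 D.total)) (Ico 0 D.total)) (Ico 0 D.total) ↔
      LipschitzOnWith K (iteratedDerivWithin n (D.ext fun x : D.Dom =>
        derivWithin (D.ext ψ) (Ico 0 D.total) x) (Ico 0 D.total)) (Ico 0 D.total) := fun K =>
    ⟨fun h x hx y hy => by rw [h2 hx, h2 hy]; exact h hx hy,
      fun h x hx y hy => by rw [← h2 hx, ← h2 hy]; exact h hx hy⟩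
  simp only [h4]
  have h5 : ((n : WithTop ℕ∞) = ⊤ → AnalyticOn ℝ (D.ext ψ) (Ico 0 D.total)) := fun h => by
    exact absurd h (by simp)
  tauto

theorem mem_smoothLip_zero {ψ : D.Dom → ℝ} :
    ψ ∈ D.smoothLip 0 ↔ ∃ K, LipschitzOnWith K (D.ext ψ) (Ico 0 D.total) := by
  change (_ ∧ _) ↔ _
  simp only [iteratedDerivWithin_zero]
  refine ⟨fun h => h.2, fun h => ⟨?_, h⟩⟩
  obtain ⟨K, hK⟩ := h
  exact contDiffOn_zero.2 hK.continuousOn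

theorem bounded_of_lipschitz {ψ : D.Dom → ℝ} {K : NNReal}
    (h : LipschitzOnWith K (D.ext ψ) (Ico 0 D.total)) : ∃ M, ∀ x, |ψ x| ≤ M := by
  rcases isEmpty_or_nonempty D.Dom with h0 | ⟨⟨y⟩⟩
  · exact ⟨0, fun x => h0.elim x⟩
  · refine ⟨|ψ y| + K * D.total, fun x => ?_⟩
    have h1 := h.dist_le_mul x x.2 y y.2
    rw [ext_coe, ext_coe, Real.dist_eq, Real.dist_eq] at h1
    have h2 : |(x : ℝ) - y| ≤ D.total := by
      rw [abs_le]
      constructor <;> linarith [x.2.1, x.2.2, y.2.1, y.2.2]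
    have h3 := mul_le_mul_of_nonneg_left h2 K.2
    have h4 := abs_sub_abs_le_abs_sub (ψ x) (ψ y)
    change (K : ℝ) * _ ≤ K * _ at h3
    linarith

theorem exists_lipschitz_of_mem_smoothLip {n : ℕ} {ψ : D.Dom → ℝ} (h : ψ ∈ D.smoothLip n) :
    ∃ K, LipschitzOnWith K (D.ext ψ) (Ico 0 D.total) := by
  induction n generalizing ψ with
  | zero => exact mem_smoothLip_zero.1 h
  | succ n ih =>
    obtain ⟨h1, h2⟩ := mem_smoothLip_succ.1 h
    obtain ⟨K, hK⟩ := ih h2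
    obtain ⟨M, hM⟩ := bounded_of_lipschitz hK
    refine ⟨M.toNNReal, (convex_Ico 0 D.total).lipschitzOnWith_of_nnnorm_derivWithin_le h1
      fun x hx => ?_⟩
    rw [← NNReal.coe_le_coe, coe_nnnorm, Real.norm_eq_abs]
    exact (hM ⟨x, hx⟩).trans (Real.le_coe_toNNReal M)

theorem exists_bound_of_mem_CLip {n : ℕ} {ψ : D.Dom → ℝ} (h : ψ ∈ D.CLip (n + 1)) :
    ∃ M, ∀ x, |ψ x| ≤ M := by
  cases n with
  | zero => exact h
  | succ n => exact bounded_of_lipschitz (exists_lipschitz_of_mem_smoothLip h).choose_spec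

/-- A merely bounded transfer function may fail to be measurable and so cannot be integrated; it is
replaced by the one built from the limsup of Birkhoff sums. In higher regularity continuity is
enough. -/
theorem exists_measurable_coboundary {n : ℕ} {ψ : D.Dom → ℝ} (h : ψ ∈ D.CLip (n + 1))
    (hm : Measurable (D.coboundary ψ)) :
    ∃ ψ' ∈ D.CLip (n + 1), Measurable ψ' ∧ D.coboundary ψ' = D.coboundary ψ := by
  cases n with
  | zero =>
    obtain ⟨M, hM⟩ := exists_bound_of_mem_CLip h
    obtain ⟨ψ', h1, h2, h3⟩ := exists_bounded_coboundary
      (abs_birkhoffSum_le_of_coboundary hM fun x => (D.coboundary_apply ψ x).symm)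
    exact ⟨ψ', ⟨_, h1⟩, h3 D.measurable_T hm, funext h2⟩
  | succ n =>
    refine ⟨ψ, h, ?_, rfl⟩
    obtain ⟨K, hK⟩ := exists_lipschitz_of_mem_smoothLip h
    have := (continuousOn_iff_continuous_domRestrict.1 hK.continuousOn).measurable
    convert this using 1
    ext x
    simp

/-- The primitive vanishing at `0`. -/
def prim (D : Data A) (ψ : D.Dom → ℝ) : D.Dom → ℝ := fun x => ∫ t in (0 : ℝ)..x, D.ext ψ t

theorem integrableOn_ext {ψ : D.Dom → ℝ} (hm : Measurable ψ) (hb : ∃ M, ∀ x, |ψ x| ≤ M) :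
    IntegrableOn (D.ext ψ) (Ico 0 D.total) := by
  obtain ⟨M, hM⟩ := hb
  refine integrableOn_of_bounded (aemeasurable_restrict_of_measurable_subtype measurableSet_Ico
    ?_).aestronglyMeasurable ⟨M, fun x hx => ?_⟩
  · simpa using hm
  · rw [D.ext_of_mem ψ hx]
    exact hM _

theorem intervalIntegrable_ext {ψ : D.Dom → ℝ} (hm : Measurable ψ) (hb : ∃ M, ∀ x, |ψ x| ≤ M)
    {x y : ℝ} (hx : x ∈ Icc 0 D.total) (hy : y ∈ Icc 0 D.total) :
    IntervalIntegrable (D.ext ψ) volume x y := by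
  have h0 : 0 ≤ D.total := hx.1.trans hx.2
  have := (intervalIntegrable_iff_integrableOn_Ico_of_le h0).2 (integrableOn_ext hm hb)
  refine this.mono_set ?_
  rw [uIcc_of_le h0]
  exact uIcc_subset_Icc hx hy

theorem prim_mem_CLip {n : ℕ} {ψ : D.Dom → ℝ} (h : ψ ∈ D.CLip (n + 1)) (hm : Measurable ψ) :
    D.prim ψ ∈ D.CLip (n + 2) := by
  have hext := ext_restrict (D := D) (fun x => ∫ t in (0 : ℝ)..x, D.ext ψ t)
  have hb := exists_bound_of_mem_CLip h
  have hint : ∀ {x y : ℝ}, x ∈ Ico 0 D.total → y ∈ Ico 0 D.total →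
      IntervalIntegrable (D.ext ψ) volume x y := fun hx hy =>
    intervalIntegrable_ext hm hb ⟨hx.1, hx.2.le⟩ ⟨hy.1, hy.2.le⟩
  cases n with
  | zero =>
    obtain ⟨M, hM⟩ := hb
    refine mem_smoothLip_zero.2 ⟨M.toNNReal, LipschitzOnWith.of_dist_le_mul fun x hx y hy => ?_⟩
    have h0 : (0 : ℝ) ∈ Ico 0 D.total := ⟨le_rfl, hx.1.trans_lt hx.2⟩
    have e1 := hext hx
    have e2 := hext hy
    rw [show D.ext (D.prim ψ) x = _ from e1, show D.ext (D.prim ψ) y = _ from e2, Real.dist_eq,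
      intervalIntegral.integral_interval_sub_left (hint h0 hx) (hint h0 hy)]
    refine (intervalIntegral.norm_integral_le_of_norm_le_const (f := D.ext ψ) fun t ht => ?_).trans
      (mul_le_mul_of_nonneg_right (Real.le_coe_toNNReal M) (abs_nonneg _))
    have ht' : t ∈ Ico 0 D.total := ordConnected_Ico.uIcc_subset hy hx (uIoc_subset_uIcc ht)
    rw [D.ext_of_mem _ ht']
    exact hM _
  | succ n =>
    have hc : ContinuousOn (D.ext ψ) (Ico 0 D.total) :=
      (exists_lipschitz_of_mem_smoothLip h).choose_spec.continuousOn
    have hd : ∀ x ∈ Ico 0 D.total, HasDerivWithinAt (D.ext (D.prim ψ)) (D.ext ψ x) (Ico 0 D.total) x := by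
      intro x hx
      refine HasDerivWithinAt.congr ?_ (fun y hy => hext hy) (hext hx)
      obtain ⟨c, hxc, hc1⟩ := exists_between hx.2
      have hsub : Icc 0 c ⊆ Ico 0 D.total := fun y hy => ⟨hy.1, hy.2.trans_lt hc1⟩
      have : Fact (x ∈ Icc 0 c) := ⟨⟨hx.1, hxc.le⟩⟩
      have h0 : (0 : ℝ) ∈ Ico 0 D.total := ⟨le_rfl, hx.1.trans_lt hx.2⟩
      refine (intervalIntegral.integral_hasDerivWithinAt_right (s := Icc 0 c) (t := Icc 0 c)
        (hint h0 hx) ?_ ((hc x hx).mono hsub)).mono_of_mem_nhdsWithin ?_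
      · exact (hc.mono hsub).stronglyMeasurableAtFilter_nhdsWithin measurableSet_Icc x
      · refine mem_nhdsWithin.2 ⟨Iio c, isOpen_Iio, hxc, fun y hy => ⟨hy.2.1, hy.1.le⟩⟩
    refine mem_smoothLip_succ.2 ⟨fun x hx => (hd x hx).differentiableWithinAt, ?_⟩
    convert (show ψ ∈ D.smoothLip n from h) using 1
    ext x
    rw [(hd x x.2).derivWithin (uniqueDiffOn_Ico' x x.2), ext_coe]

theorem ext_coboundary (ψ : D.Dom → ℝ) {a : A} {x : ℝ} (hx : x ∈ Ico 0 (D.len a)) :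
    D.ext (D.coboundary ψ) (D.left a + x) = D.ext ψ (D.right a + x) - D.ext ψ (D.left a + x) := by
  rw [← coboundary_pt D ψ hx, ← D.ext_coe (D.coboundary ψ) (D.pt a x hx)]
  rfl

theorem integral_ext_coboundary {ψ : D.Dom → ℝ} (hm : Measurable ψ) (hb : ∃ M, ∀ x, |ψ x| ≤ M)
    {a : A} {x : ℝ} (hx : x ∈ Icc 0 (D.len a)) :
    ∫ t in (0 : ℝ)..x, D.ext (D.coboundary ψ) (D.left a + t) =
      ((∫ t in (0 : ℝ)..D.right a + x, D.ext ψ t) - ∫ t in (0 : ℝ)..D.right a, D.ext ψ t) -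
      ((∫ t in (0 : ℝ)..D.left a + x, D.ext ψ t) - ∫ t in (0 : ℝ)..D.left a, D.ext ψ t) := by
  have key : ∀ c, 0 ≤ c → c + D.len a ≤ D.total →
      IntervalIntegrable (fun t => D.ext ψ (c + t)) volume 0 x ∧
      ∫ t in (0 : ℝ)..x, D.ext ψ (c + t)
        = (∫ t in (0 : ℝ)..c + x, D.ext ψ t) - ∫ t in (0 : ℝ)..c, D.ext ψ t := by
    intro c hc hc'
    have h0 : (0 : ℝ) ∈ Icc 0 D.total := ⟨le_rfl, by linarith [D.len_pos a]⟩
    have h1 : c ∈ Icc 0 D.total := ⟨hc, by linarith [D.len_pos a]⟩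
    have h2 : c + x ∈ Icc 0 D.total := ⟨by linarith [hx.1], by linarith [hx.2]⟩
    constructor
    · have := (intervalIntegrable_ext hm hb h1 h2).comp_add_left c
      simpa using this
    · rw [intervalIntegral.integral_comp_add_left (fun t => D.ext ψ t), add_zero,
        intervalIntegral.integral_interval_sub_left (intervalIntegrable_ext hm hb h0 h2)
          (intervalIntegrable_ext hm hb h0 h1)]
  obtain ⟨i1, e1⟩ := key _ (D.right_nonneg a) (D.right_add_len_le a)
  obtain ⟨i2, e2⟩ := key _ (D.left_nonneg a) (D.left_add_len_le a)
  rw [← e1, ← e2, ← intervalIntegral.integral_sub i1 i2]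
  refine intervalIntegral.integral_congr_Ioo_of_le hx.1 fun t ht => ?_
  exact ext_coboundary ψ ⟨ht.1.le, ht.2.trans_le hx.2⟩

/-- The increments of the primitive of `ψ` telescope to the same total in the order before and in
the order after the exchange. -/
theorem sum_integral_ext_coboundary {ψ : D.Dom → ℝ} (hm : Measurable ψ)
    (hb : ∃ M, ∀ x, |ψ x| ≤ M) :
    ∑ a, ∫ t in (0 : ℝ)..D.len a, D.ext (D.coboundary ψ) (D.left a + t) = 0 := by
  have h1 := sum_offset_telescope D.bot D.len fun x => ∫ t in (0 : ℝ)..x, D.ext ψ t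
  have h2 := sum_offset_telescope D.top D.len fun x => ∫ t in (0 : ℝ)..x, D.ext ψ t
  rw [Finset.sum_congr rfl fun a _ => integral_ext_coboundary hm hb ⟨(D.len_pos a).le, le_rfl⟩,
    Finset.sum_sub_distrib]
  exact sub_eq_zero.2 (h1.trans h2.symm)

theorem integral_eval_derivative (p : ℝ[X]) (c x : ℝ) :
    ∫ t in (0 : ℝ)..x, (derivative p).eval (c + t) = p.eval (c + x) - p.eval c := by
  rw [intervalIntegral.integral_comp_add_left (fun t => (derivative p).eval t), add_zero]
  exact intervalIntegral.integral_eq_sub_of_hasDerivAt (fun t _ => p.hasDerivAt t)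
    ((derivative p).continuous.intervalIntegrable _ _)

/-- A cohomological equation for the derivatives can be integrated. -/
theorem exists_lift {n : ℕ} {Φ : D.Dom → ℝ} (hΦ : Φ ∈ D.BVStar (n + 2)) {q : A → ℝ[X]}
    (hq : ∀ a, q a ∈ degreeLT ℝ (n + 1)) (hqm : D.ev q ∈ D.ΓStar (n + 1)) {ψ : D.Dom → ℝ}
    (hψ : ψ ∈ D.CLip (n + 1)) (h : D.pieceDeriv Φ = D.ev q + D.coboundary ψ) :
    ∃ P : A → ℝ[X], (∀ a, P a ∈ degreeLT ℝ (n + 2)) ∧ (∀ a, derivative (P a) = q a) ∧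
      D.ev P ∈ D.ΓStar (n + 2) ∧ ∃ Ψ ∈ D.CLip (n + 2), Φ = D.ev P + D.coboundary Ψ := by
  have hφ := pieceDeriv_mem hΦ
  obtain ⟨ψ, hψ, hm, hcob⟩ := exists_measurable_coboundary hψ (by
    rw [← sub_eq_iff_eq_add'] at h
    rw [← h]
    exact (BVStar.measurable hφ).sub (measurable_ev q))
  rw [← hcob] at h
  have hb := exists_bound_of_mem_CLip hψ
  have hsum : ∀ a, ∀ t ∈ Ico 0 (D.len a), D.ext (D.pieceDeriv Φ) (D.left a + t)
      = (q a).eval (D.left a + t) + D.ext (D.coboundary ψ) (D.left a + t) := by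
    intro a t ht
    rw [h, map_add, Pi.add_apply, D.ext_ev q (D.left_add_mem_piece ht)]
  have hlen : ∀ a, D.len a ∈ Icc 0 (D.len a) := fun a => ⟨(D.len_pos a).le, le_rfl⟩
  have hTb : ∃ M, ∀ x, |D.coboundary ψ x| ≤ M := by
    obtain ⟨M, hM⟩ := hb
    exact ⟨M + M, fun x => (abs_sub _ _).trans (add_le_add (hM _) (hM _))⟩
  have hTm : Measurable (D.coboundary ψ) := (hm.comp D.measurable_T).sub hm
  have hint : ∀ a, ∀ x ∈ Icc 0 (D.len a),
      IntervalIntegrable (fun t => D.ext (D.coboundary ψ) (D.left a + t)) volume 0 x := by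
    intro a x hx
    have h1 := D.left_nonneg a
    have h2 := D.left_add_len_le a
    have := (intervalIntegrable_ext hTm hTb (x := D.left a) (y := D.left a + x)
      ⟨h1, by linarith [hx.1, hx.2]⟩ ⟨by linarith [hx.1], by linarith [hx.2]⟩).comp_add_left (D.left a)
    simpa using this
  have hpint : ∀ (p : ℝ[X]) (c x y : ℝ), IntervalIntegrable (fun t => p.eval (c + t)) volume x y :=
    fun p c x y => (p.continuous.comp (continuous_const.add continuous_id)).intervalIntegrable _ _
  have hΦint : ∀ a, ∀ x ∈ Icc 0 (D.len a), ∫ t in (0 : ℝ)..x, D.ext (D.pieceDeriv Φ) (D.left a + t)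
      = (∫ t in (0 : ℝ)..x, (q a).eval (D.left a + t))
        + ∫ t in (0 : ℝ)..x, D.ext (D.coboundary ψ) (D.left a + t) := by
    intro a x hx
    rw [← intervalIntegral.integral_add (hpint _ _ _ _) (hint a x hx)]
    exact intervalIntegral.integral_congr_Ioo_of_le hx.1 fun t ht =>
      hsum a t ⟨ht.1.le, ht.2.trans_le hx.2⟩
  -- The derivative of `Φ` has mean zero, by the condition `l = 1`, and so does a coboundary. What
  -- is left is the first-order mean condition for the primitives of `q`.
  have hmean : D.polyMean q = 0 := by
    have h1 := hΦ.2 1 one_pos (by omega)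
    have h2 : ∀ a, ∫ x in D.piece a, iteratedDerivWithin 1 (D.ext Φ) (D.piece a) x
        = ∫ t in (0 : ℝ)..D.len a, D.ext (D.pieceDeriv Φ) (D.left a + t) := by
      intro a
      rw [intervalIntegral.integral_comp_add_left (fun t => D.ext (D.pieceDeriv Φ) t), add_zero,
        ← integral_piece]
      refine setIntegral_congr_fun measurableSet_Ico fun x hx => ?_
      have := iteratedDerivWithin_pieceDeriv Φ 0 a hx
      rw [iteratedDerivWithin_zero] at this
      exact this.symm
    rw [Finset.sum_congr rfl fun a _ => (h2 a).trans (hΦint a _ (hlen a)), Finset.sum_add_distrib,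
      sum_integral_ext_coboundary hm hb, add_zero] at h1
    rw [← h1]
    refine Finset.sum_congr rfl fun a _ => ?_
    rw [intervalIntegral.integral_comp_add_left (fun t => (q a).eval t), add_zero]
  choose P hP hPq using fun a => exists_antiderivative (hq a)
  set H : ℝ → ℝ := fun x => ∫ t in (0 : ℝ)..x, D.ext ψ t with hH
  -- One integration constant on each interval, read off from the integrated equation at the left
  -- end.
  set c : A → ℝ := fun a => D.ext Φ (D.left a) - (P a).eval (D.left a)
    - (H (D.right a) - H (D.left a)) with hc
  have hderiv : ∀ a, derivative (P a + C (c a)) = q a := fun a => by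
    rw [derivative_add, derivative_C, add_zero, hPq]
  have hdeg : ∀ a, P a + C (c a) ∈ degreeLT ℝ (n + 2) := fun a =>
    add_mem (hP a) (mem_degreeLT.2 (degree_C_le.trans_lt (by exact_mod_cast (n + 1).succ_pos)))
  refine ⟨fun a => P a + C (c a), hdeg, hderiv, (ev_mem_ΓStar hdeg).2 fun l hl => ?_,
    D.prim ψ, prim_mem_CLip hψ hm, ?_⟩
  · obtain ⟨l, rfl⟩ : ∃ m, l = m + 1 := ⟨l - 1, by omega⟩
    simp only [Function.iterate_succ_apply, hderiv]
    rcases Nat.eq_zero_or_pos l with rfl | hl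
    · exact hmean
    · exact (ev_mem_ΓStar hq).1 hqm l hl
  · ext y
    obtain ⟨a, x, hx, rfl⟩ := D.exists_pt y
    have hx' : x ∈ Icc 0 (D.len a) := ⟨hx.1, hx.2.le⟩
    have e1 := BVStar.integral_pieceDeriv hΦ hx
    rw [hΦint a x hx', integral_ext_coboundary hm hb hx', ← hPq a, integral_eval_derivative] at e1
    have hprim := ext_restrict (D := D) H
    rw [Pi.add_apply, ev_pt, coboundary_pt,
      show D.ext (D.prim ψ) (D.right a + x) = _ from hprim (D.right_add_mem hx),
      show D.ext (D.prim ψ) (D.left a + x) = _ from hprim (D.piece_subset a (D.left_add_mem_piece hx)),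
      eval_add, eval_C, ← D.ext_coe Φ (D.pt a x hx)]
    change D.ext Φ (D.left a + x) = _
    simp only [hc, hH]
    linarith

end Data

end Primitives

/-! ### Existence of the correction and the dimension of `Γ_T(r)`. -/

section Cohomology

open Polynomial

variable {A : Type*} [Fintype A] [DecidableEq A] [Nontrivial A]

namespace Data

variable {D : Data A}

/-- Absolute continuity recovers `Φ` from its almost everywhere derivative, which may be replaced by
the representatives of bounded variation on the intervals; the mean condition `l = 1` becomes zero
mass. -/
theorem BVStar.exists_primitive {Φ : D.Dom → ℝ} (hΦ : Φ ∈ D.BVStar 1) :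
    ∃ F : ℝ → ℝ, D.tvar (D.loc F) ≠ ⊤ ∧ D.mass (D.loc F) = 0 ∧
      D.IsPrimitive (D.loc (D.ext Φ)) (D.loc F) := by
  choose φ hφ hφ' using fun a => (hΦ.1 a).2.2
  set F : ℝ → ℝ := D.ext fun x => φ (D.letter x) x with hF
  have hFa : ∀ a, EqOn F (φ a) (D.piece a) := fun a x hx => by
    rw [hF, D.ext_of_mem _ (D.piece_subset a hx)]
    change φ (D.letter ⟨x, D.piece_subset a hx⟩) x = _
    rw [(D.mem_piece_iff ⟨x, D.piece_subset a hx⟩ a).1 hx]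
  refine ⟨F, ?_, ?_, fun a x hx => ?_⟩
  · refine ENNReal.sum_ne_top.2 fun a _ => ne_top_of_le_ne_top (hφ a) ?_
    change _ ≤ eVariationOn (φ a) (D.piece a)
    rw [← eVariationOn.congr (hFa a)]
    exact eVariationOn.comp_le_of_monotoneOn F (fun x => D.left a + x)
      (fun x _ y _ h => by simpa using h) fun x hx => D.left_add_mem_piece hx
  · rw [← hΦ.2 1 one_pos le_rfl]
    refine Finset.sum_congr rfl fun a _ => ?_
    unfold loc
    rw [intervalIntegral.integral_comp_add_left F, add_zero, ← integral_piece]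
    exact (setIntegral_congr_fun measurableSet_Ico (hFa a)).trans (integral_congr_ae (hφ' a).symm)
  · unfold loc
    rw [intervalIntegral.integral_comp_add_left F, add_zero]
    have hac := ((hΦ.1 a).2.1 (D.left a + x) (D.left_add_mem_piece hx)).integral_deriv_eq_sub
    simp only [Nat.sub_self, iteratedDerivWithin_zero] at hac
    rw [← hac]
    refine intervalIntegral.integral_congr_ae ?_
    have h1 := hφ' a
    rw [Filter.EventuallyEq, ae_restrict_iff' measurableSet_Ico] at h1
    filter_upwards [h1] with t ht htI
    rw [uIoc_of_le (by linarith [hx.1])] at htI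
    have ht' : t ∈ D.piece a := ⟨htI.1.le, htI.2.trans_lt (by linarith [hx.2])⟩
    rw [hFa a ht', ← ht ht', iteratedDerivWithin_one,
      derivWithin_of_mem_nhds (Ico_mem_nhds htI.1 ht'.2)]

/-- Induction on the regularity: the base case is the bounded solution obtained from Birkhoff sums,
and the inductive step solves the equation for the derivative and integrates it. -/
theorem exists_cohomologous (hA : D.Admissible) (hD : D.RothType) (n : ℕ) :
    ∀ Φ ∈ D.BVStar (n + 1), ∃ p : A → ℝ[X], (∀ a, p a ∈ degreeLT ℝ (n + 1)) ∧
      D.ev p ∈ D.ΓStar (n + 1) ∧ ∃ Ψ ∈ D.CLip (n + 1), Φ = D.ev p + D.coboundary Ψ := by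
  induction n with
  | zero =>
    intro Φ hΦ
    obtain ⟨F, h1, h2, h3⟩ := BVStar.exists_primitive hΦ
    obtain ⟨χ, M, h⟩ := exists_bounded_birkhoffSum hA hD h1 h2 h3
    have hdeg : ∀ a, C (χ a) ∈ degreeLT ℝ 1 := fun a =>
      mem_degreeLT.2 (degree_C_le.trans_lt (by exact_mod_cast one_pos))
    obtain ⟨Ψ, h4, h5, -⟩ := exists_bounded_coboundary (h (Φ - D.ev fun a => C (χ a))
      fun a x hx => by
        rw [Pi.sub_apply, ev_pt, eval_C, ← D.ext_coe Φ (D.pt a x hx)]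
        rfl)
    refine ⟨fun a => C (χ a), hdeg, (ev_mem_ΓStar hdeg).2 fun l hl => ?_, Ψ, ⟨M, h4⟩, ?_⟩
    · simp [polyMean, Polynomial.iterate_derivative_C hl]
    · rw [show D.coboundary Ψ = _ from funext h5]
      abel
  | succ n ih =>
    intro Φ hΦ
    obtain ⟨q, h1, h2, ψ, h3, h4⟩ := ih _ (pieceDeriv_mem hΦ)
    obtain ⟨P, h5, -, h6, h7⟩ := exists_lift hΦ h1 h2 h3 h4
    exact ⟨P, h5, h6, h7⟩

/-- The space `Γ_T(r)`, in terms of polynomials. -/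
def polyΓT (D : Data A) (r : ℕ) : Submodule ℝ (A → ℝ[X]) := (D.ΓTPoly r).comap D.ev

theorem mem_polyΓT {r : ℕ} {p : A → ℝ[X]} : p ∈ D.polyΓT r ↔ (∀ a, p a ∈ degreeLT ℝ r) ∧
    (∀ l, 0 < l → D.polyMean (fun a => derivative^[l] (p a)) = 0) ∧
    ∃ ψ ∈ D.CLip r, D.coboundary ψ = D.ev p := by
  constructor
  · rintro ⟨h1, h2⟩
    have hdeg : ∀ a, p a ∈ degreeLT ℝ r := by
      obtain ⟨q, h3, h4⟩ := exists_ev_of_mem_ΓPoly h1.1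
      rwa [← D.ev_injective h4]
    exact ⟨hdeg, (ev_mem_ΓStar hdeg).1 h1, h2⟩
  · rintro ⟨h1, h2, h3⟩
    exact ⟨(ev_mem_ΓStar h1).2 h2, h3⟩

theorem derivative_mem_degreeLT {n : ℕ} {p : ℝ[X]} (hp : p ∈ degreeLT ℝ (n + 1)) :
    derivative p ∈ degreeLT ℝ n := by
  rw [mem_degreeLT] at hp ⊢
  rcases eq_or_ne p 0 with rfl | h
  · simp
  · have h1 := degree_derivative_lt h
    rw [degree_eq_natDegree h] at h1 hp
    refine h1.trans_le ?_
    have : p.natDegree < n + 1 := by exact_mod_cast hp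
    exact_mod_cast Nat.lt_succ_iff.1 this

theorem eval_add_of_degreeLT_two {p : ℝ[X]} (hp : p ∈ degreeLT ℝ 2) (x h : ℝ) :
    p.eval (x + h) = p.eval x + h * (derivative p).eval x := by
  have hd : p.degree ≤ 1 := Order.le_of_lt_succ (mem_degreeLT.1 hp)
  rw [eq_X_add_C_of_degree_le_one hd]
  simp
  ring

/-- A point and a nearby point on its right have the same itinerary for a while. -/
theorem exists_translation {p : A → ℝ[X]} (hp : ∀ a, p a ∈ degreeLT ℝ 2) (m : ℕ) (x : D.Dom) :
    ∃ h₀ > (0 : ℝ), ∀ h ∈ Ico 0 h₀, ∀ y : D.Dom, (y : ℝ) = x + h →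
      (D.T^[m] y : ℝ) = D.T^[m] x + h ∧
      birkhoffSum D.T (D.ev p) m y = birkhoffSum D.T (D.ev p) m x
        + h * birkhoffSum D.T (D.ev fun a => derivative (p a)) m x := by
  induction m generalizing x with
  | zero => exact ⟨1, one_pos, fun h _ y hy => ⟨hy, by simp⟩⟩
  | succ m ih =>
    obtain ⟨h₁, h1, H⟩ := ih (D.T x)
    obtain ⟨a, t, ht, rfl⟩ := D.exists_pt x
    refine ⟨min h₁ (D.len a - t), lt_min h1 (sub_pos.2 ht.2), fun h hh y hy => ?_⟩
    have hm := hh.2.trans_le (min_le_right _ _)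
    have ht' : t + h ∈ Ico 0 (D.len a) := ⟨add_nonneg ht.1 hh.1, by linarith⟩
    obtain rfl : y = D.pt a (t + h) ht' := Subtype.ext (by rw [hy]; simp [pt, add_assoc])
    obtain ⟨e1, e2⟩ := H h ⟨hh.1, hh.2.trans_le (min_le_left _ _)⟩ (D.T (D.pt a (t + h) ht')) (by
      rw [T_pt, T_pt, add_assoc])
    refine ⟨e1, ?_⟩
    rw [birkhoffSum_succ', birkhoffSum_succ', birkhoffSum_succ', e2, ev_pt, ev_pt, ev_pt,
      ← add_assoc (D.left a), eval_add_of_degreeLT_two (hp a) (D.left a + t)]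
    ring

theorem birkhoffSum_coboundary (ψ : D.Dom → ℝ) (m : ℕ) (x : D.Dom) :
    birkhoffSum D.T (D.coboundary ψ) m x = ψ (D.T^[m] x) - ψ x := by
  induction m with
  | zero => simp
  | succ m ih =>
    rw [birkhoffSum_succ, ih, coboundary_apply, Function.iterate_succ_apply']
    ring

/-- A Lipschitz `ψ` need not be differentiable everywhere, so the equation is differentiated at the
level of Birkhoff sums. Two points at small distance `t` share their itinerary up to time `n`, so
the sums of `p` differ by `t` times the sum of the derivatives; being increments of `ψ`, they differ
by at most `2 * K * t`. The sums of the derivatives are thus bounded by `2 * K`. -/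
theorem exists_bounded_of_lipschitz {p : A → ℝ[X]} (hp : ∀ a, p a ∈ degreeLT ℝ 2)
    {ψ : D.Dom → ℝ} {K : NNReal} (hψ : LipschitzOnWith K (D.ext ψ) (Ico 0 D.total))
    (h : D.coboundary ψ = D.ev p) :
    ∃ ψ' ∈ D.bounded, D.coboundary ψ' = D.ev fun a => derivative (p a) := by
  have key : ∀ n x, |birkhoffSum D.T (D.ev fun a => derivative (p a)) n x| ≤ 2 * K := by
    intro n x
    obtain ⟨h₀, hpos, H⟩ := exists_translation hp n x
    obtain ⟨t, ht, ht'⟩ := exists_between (lt_min hpos (sub_pos.2 x.2.2))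
    have hy : (x : ℝ) + t ∈ Ico 0 D.total :=
      ⟨add_nonneg x.2.1 ht.le, by linarith [ht'.trans_le (min_le_right _ _)]⟩
    obtain ⟨e1, e2⟩ := H t ⟨ht.le, ht'.trans_le (min_le_left _ _)⟩ ⟨_, hy⟩ rfl
    have hdist : ∀ u v : D.Dom, (v : ℝ) = u + t → |ψ v - ψ u| ≤ K * t := by
      intro u v huv
      have := hψ.dist_le_mul v v.2 u u.2
      rwa [ext_coe, ext_coe, Real.dist_eq, Real.dist_eq, huv, add_sub_cancel_left,
        abs_of_pos ht] at this
    rw [← h, birkhoffSum_coboundary, birkhoffSum_coboundary] at e2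
    have d1 := abs_le.1 (hdist _ _ e1)
    have d2 := abs_le.1 (hdist x ⟨_, hy⟩ rfl)
    refine le_of_mul_le_mul_left ?_ ht
    rw [← abs_of_pos ht, ← abs_mul, abs_of_pos ht, abs_le]
    constructor <;> linarith
  obtain ⟨ψ', h1, h2, -⟩ := exists_bounded_coboundary key
  exact ⟨ψ', ⟨_, h1⟩, funext h2⟩

theorem hasDerivWithinAt_translate {f : ℝ → ℝ} {b c x : ℝ} (hf : DifferentiableOn ℝ f (Ico 0 b))
    (hx : c + x ∈ Ico 0 b) :
    HasDerivWithinAt (fun t => f (c + t)) (derivWithin f (Ico 0 b) (c + x)) (Ici x) x := by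
  have h1 : HasDerivWithinAt f (derivWithin f (Ico 0 b) (c + x)) (Ici (c + x)) (c + x) :=
    (hf _ hx).hasDerivWithinAt.mono_of_mem_nhdsWithin
      (mem_nhdsWithin.2 ⟨Iio b, isOpen_Iio, hx.2, fun y hy => ⟨hx.1.trans hy.2, hy.1⟩⟩)
  have h2 : HasDerivWithinAt (fun t => c + t) 1 (Ici x) x := (hasDerivWithinAt_id x _).const_add c
  have h3 := h1.comp x h2 fun t ht => by simpa using ht
  rw [mul_one] at h3
  exact h3

theorem derivative_mem_polyΓT {n : ℕ} {p : A → ℝ[X]} (hp : p ∈ D.polyΓT (n + 2)) :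
    (fun a => derivative (p a)) ∈ D.polyΓT (n + 1) := by
  obtain ⟨h1, h2, ψ, h3, h4⟩ := mem_polyΓT.1 hp
  refine mem_polyΓT.2 ⟨fun a => derivative_mem_degreeLT (h1 a), fun l _ => h2 (l + 1) l.succ_pos, ?_⟩
  cases n with
  | zero => exact exists_bounded_of_lipschitz h1 (mem_smoothLip_zero.1 h3).choose_spec h4
  | succ n =>
    obtain ⟨h5, h6⟩ := mem_smoothLip_succ.1 h3
    refine ⟨_, h6, funext fun y => ?_⟩
    obtain ⟨a, x, hx, rfl⟩ := D.exists_pt y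
    rw [coboundary_apply, ev_pt, T_pt]
    -- Right derivatives, because the equation holds only to the right of a left endpoint.
    have d1 := (hasDerivWithinAt_translate h5 (D.right_add_mem hx)).sub
      (hasDerivWithinAt_translate h5 (D.piece_subset a (D.left_add_mem_piece hx)))
    have d2 : HasDerivWithinAt (fun t => (p a).eval (D.left a + t))
        ((derivative (p a)).eval (D.left a + x)) (Ici x) x := by
      have := ((p a).hasDerivAt (D.left a + x)).comp x ((hasDerivAt_id x).const_add (D.left a))
      rw [mul_one] at this
      exact this.hasDerivWithinAt
    have heq : ∀ t ∈ Ico 0 (D.len a), D.ext ψ (D.right a + t) - D.ext ψ (D.left a + t)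
        = (p a).eval (D.left a + t) := fun t ht => by
      rw [← coboundary_pt D ψ ht, h4, ev_pt]
    have d3 := d2.congr_of_eventuallyEq (f₁ := fun t => D.ext ψ (D.right a + t) - D.ext ψ (D.left a + t))
      (Filter.eventuallyEq_of_mem (mem_nhdsWithin.2 ⟨Iio (D.len a), isOpen_Iio, hx.2,
        fun t ht => show t ∈ Ico 0 (D.len a) from ⟨hx.1.trans ht.2, ht.1⟩⟩) heq) (heq x hx)
    exact (uniqueDiffWithinAt_Ici x).eq_deriv _ d1 d3

/-- The relation `0 = q + (coboundary of -ψ)` is a cohomological equation for the derivative of the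
zero function; integrating it gives the preimage. -/
theorem exists_mem_polyΓT_derivative {n : ℕ} {q : A → ℝ[X]} (hq : q ∈ D.polyΓT (n + 1)) :
    ∃ p ∈ D.polyΓT (n + 2), (fun a => derivative (p a)) = q := by
  obtain ⟨h1, h2, ψ, h3, h4⟩ := mem_polyΓT.1 hq
  have h0 : D.pieceDeriv 0 = D.ev q + D.coboundary (-ψ) := by
    rw [map_neg, h4, add_neg_cancel]
    ext x
    rw [pieceDeriv, map_zero]
    simp
  obtain ⟨P, h5, h6, h7, Ψ, h8, h9⟩ := exists_lift (zero_mem _) h1 ((ev_mem_ΓStar h1).2 h2)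
    (neg_mem h3) h0
  refine ⟨P, mem_polyΓT.2 ⟨h5, (ev_mem_ΓStar h5).1 h7, -Ψ, neg_mem h8, ?_⟩, funext h6⟩
  rw [map_neg]
  exact (eq_neg_of_add_eq_zero_left h9.symm).symm

theorem const_mem_smoothLip (n : ℕ) (c : ℝ) : (fun _ => c) ∈ D.smoothLip n := by
  induction n generalizing c with
  | zero =>
    refine mem_smoothLip_zero.2 ⟨0, fun x hx y hy => ?_⟩
    rw [D.ext_of_mem _ hx, D.ext_of_mem _ hy]
    simp
  | succ n ih =>
    have h := ext_restrict (D := D) fun _ => c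
    refine mem_smoothLip_succ.2 ⟨(differentiableOn_const c).congr h, ?_⟩
    convert ih (0 : ℝ) using 1
    ext x
    rw [derivWithin_congr h (h x.2)]
    simp

theorem coe_mem_smoothLip (n : ℕ) : (fun x : D.Dom => (x : ℝ)) ∈ D.smoothLip n := by
  have h := ext_restrict (D := D) fun x => x
  cases n with
  | zero =>
    refine mem_smoothLip_zero.2 ⟨1, fun x hx y hy => ?_⟩
    rw [h hx, h hy]
    simp
  | succ n =>
    refine mem_smoothLip_succ.2 ⟨differentiableOn_id.congr h, ?_⟩
    convert const_mem_smoothLip (D := D) n 1 using 1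
    ext x
    rw [derivWithin_congr h (h x.2)]
    exact derivWithin_id' _ _ (uniqueDiffOn_Ico' x x.2)

/-- The displacements of the intervals, as constant polynomials. -/
def displacement (D : Data A) : A → ℝ[X] := fun a => C (D.right a - D.left a)

/-- The displacement is the coboundary of the identity function. -/
theorem displacement_mem (n : ℕ) : D.displacement ∈ D.polyΓT (n + 2) := by
  refine mem_polyΓT.2 ⟨fun a => mem_degreeLT.2 (degree_C_le.trans_lt
    (by exact_mod_cast (n + 1).succ_pos)), fun l hl => ?_, _, coe_mem_smoothLip n, funext fun y => ?_⟩
  · simp [polyMean, displacement, Polynomial.iterate_derivative_C hl]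
  · obtain ⟨a, x, hx, rfl⟩ := D.exists_pt y
    rw [coboundary_apply, T_pt, ev_pt, displacement, eval_C]
    change D.right a + x - (D.left a + x) = _
    ring

/-- Without displacement `T` would fix the left end of the last interval, which is a connexion. -/
theorem displacement_ne_zero (hK : D.Keane) : D.displacement ≠ 0 := by
  intro h
  have h0 : ∀ a, D.right a = D.left a := fun a => by
    have := congrFun h a
    simpa [displacement, sub_eq_zero] using this
  refine hK ⟨lastLetter D.top, lastLetter D.top, 1, ?_, one_pos, ?_⟩
  · rw [lastLetter_pos]
    have := Fintype.one_lt_card (α := A)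
    omega
  · rw [j₀_apply]
    refine Subtype.ext ?_
    rw [Function.iterate_one, T_pt, h0]
    rfl

/-- A transfer function whose coboundary is constant on each interval has invariant increments.
Being Lipschitz it is affine, and the coboundary of an affine function is a multiple of the
displacement. -/
theorem exists_eq_smul_displacement (hA : D.Admissible) (hD : D.RothType) {n : ℕ} {p : A → ℝ[X]}
    (hp : p ∈ D.polyΓT (n + 2)) (h : (fun a => derivative (p a)) = 0) :
    ∃ c : ℝ, c • D.displacement = p := by
  obtain ⟨-, -, ψ, h3, h4⟩ := mem_polyΓT.1 hp
  have hconst : ∀ a, p a = C ((p a).coeff 0) := fun a =>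
    eq_C_of_derivative_eq_zero (congrFun h a)
  obtain ⟨K, hK⟩ := exists_lipschitz_of_mem_smoothLip h3
  -- The Lipschitz extension to the line supplies values at the right end of `I`, which the rigidity
  -- argument uses.
  obtain ⟨g, hg, hgψ⟩ := hK.extend_real
  have heq : ∀ a, ∀ t ∈ Ico 0 (D.len a), g (D.right a + t) - g (D.left a + t) = (p a).coeff 0 := by
    intro a t ht
    rw [← hgψ (D.right_add_mem ht), ← hgψ (D.piece_subset a (D.left_add_mem_piece ht)),
      ← coboundary_pt D ψ ht, h4, ev_pt, hconst a]
    simp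
  have h0 : ∀ a, (0 : ℝ) ∈ Ico 0 (D.len a) := fun a => ⟨le_rfl, D.len_pos a⟩
  obtain ⟨c, hc⟩ := affine_of_invariantIncrements hA hD hg (fun a x hx => by
    have e1 := heq a x hx
    have e2 := heq a 0 (h0 a)
    rw [add_zero, add_zero] at e2
    linarith)
  refine ⟨c, funext fun a => ?_⟩
  have e2 := heq a 0 (h0 a)
  rw [hc _ (D.right_add_mem (h0 a)), hc _ (D.piece_subset a (D.left_add_mem_piece (h0 a)))] at e2
  rw [hconst a, ← e2, Pi.smul_apply, displacement, smul_C, smul_eq_mul]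
  congr 1
  ring

instance finiteDimensional_ΓPoly (r : ℕ) : FiniteDimensional ℝ (D.ΓPoly r) := by
  set f : (A → degreeLT ℝ r) →ₗ[ℝ] (D.Dom → ℝ) :=
    D.ev.comp (LinearMap.compLeft (degreeLT ℝ r).subtype A) with hf
  refine Submodule.finiteDimensional_of_le (S₂ := LinearMap.range f) fun χ hχ => ?_
  obtain ⟨p, hp, rfl⟩ := exists_ev_of_mem_ΓPoly hχ
  exact ⟨fun a => ⟨p a, hp a⟩, rfl⟩

instance finiteDimensional_ΓTPoly (r : ℕ) : FiniteDimensional ℝ (D.ΓTPoly r) :=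
  Submodule.finiteDimensional_of_le (S₂ := D.ΓPoly r) fun _ h => h.1.1

/-- `Γ_T(r)` and its model in terms of polynomials. -/
def polyΓTEquiv (D : Data A) (r : ℕ) : D.polyΓT r ≃ₗ[ℝ] D.ΓTPoly r :=
  (Submodule.equivMapOfInjective D.ev D.ev_injective _).trans <| LinearEquiv.ofEq _ _ <|
    Submodule.map_comap_eq_of_le fun _ h => by
      obtain ⟨p, -, hp⟩ := exists_ev_of_mem_ΓPoly h.1.1
      exact ⟨p, hp⟩

/-- The derivative, from `Γ_T(n + 2)` to `Γ_T(n + 1)`. -/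
def polyΓTDerivative (D : Data A) (n : ℕ) : D.polyΓT (n + 2) →ₗ[ℝ] D.polyΓT (n + 1) :=
  (LinearMap.compLeft derivative A).restrict fun _ h => derivative_mem_polyΓT h

/-- Rank and nullity of the derivative: it is onto, and its kernel is the line of the displacement.
-/
theorem finrank_polyΓT_succ (hA : D.Admissible) (hD : D.RothType) (n : ℕ) :
    Module.finrank ℝ (D.polyΓT (n + 2)) = Module.finrank ℝ (D.polyΓT (n + 1)) + 1 := by
  have : FiniteDimensional ℝ (D.polyΓT (n + 2)) := (D.polyΓTEquiv _).symm.finiteDimensional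
  have hrange : LinearMap.range (D.polyΓTDerivative n) = ⊤ := LinearMap.range_eq_top.2 fun q => by
    obtain ⟨p, hp, h⟩ := exists_mem_polyΓT_derivative q.2
    exact ⟨⟨p, hp⟩, Subtype.ext h⟩
  have hker : Module.finrank ℝ (LinearMap.ker (D.polyΓTDerivative n)) = 1 := by
    have hmem : (⟨D.displacement, displacement_mem n⟩ : D.polyΓT (n + 2)) ∈
        LinearMap.ker (D.polyΓTDerivative n) := Subtype.ext (funext fun a => derivative_C)
    refine finrank_eq_one (R := ℝ) (M := LinearMap.ker (D.polyΓTDerivative n)) ⟨_, hmem⟩ (fun h => displacement_ne_zero hD.1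
      (congrArg Subtype.val (congrArg Subtype.val h))) fun w => ?_
    obtain ⟨c, hc⟩ := exists_eq_smul_displacement hA hD w.1.2 (congrArg Subtype.val w.2)
    exact ⟨c, Subtype.ext (Subtype.ext hc)⟩
  rw [← LinearMap.finrank_range_add_finrank_ker (D.polyΓTDerivative n), hrange, hker, finrank_top]

/-- For piecewise constants the mean conditions are void, and the opposite sign conventions for
coboundaries define the same subspace. -/
theorem ΓTPoly_one : D.ΓTPoly 1 = D.ΓT := by
  have hΓ : D.ΓStar 1 = D.Γ := by
    ext χ
    constructor
    · intro h a
      obtain ⟨p, hp, h⟩ := h.1 a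
      refine ⟨p.coeff 0, fun x hx => ?_⟩
      rw [h x hx, eq_C_of_degree_le_zero (Order.le_of_lt_succ (mem_degreeLT.1 hp))]
      simp
    · intro h
      choose c hc using h
      have hdeg : ∀ a, C (c a) ∈ degreeLT ℝ 1 := fun a =>
        mem_degreeLT.2 (degree_C_le.trans_lt (by exact_mod_cast one_pos))
      have : χ = D.ev fun a => C (c a) := by
        ext x
        rw [ev_apply, eval_C]
        exact hc _ x (D.mem_piece_letter x)
      rw [this]
      refine (ev_mem_ΓStar hdeg).2 fun l hl => ?_
      simp [polyMean, Polynomial.iterate_derivative_C hl]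
  rw [ΓTPoly, ΓT, hΓ, Submodule.map_neg]
  rfl

theorem finrank_ΓTPoly (hA : D.Admissible) (hD : D.RothType) (n : ℕ) :
    Module.finrank ℝ (D.ΓTPoly (n + 1)) = Module.finrank ℝ D.ΓT + n := by
  induction n with
  | zero => rw [ΓTPoly_one, add_zero]
  | succ n ih =>
    rw [← (D.polyΓTEquiv _).finrank_eq, finrank_polyΓT_succ hA hD, (D.polyΓTEquiv _).finrank_eq, ih,
      add_assoc]

end Data

end Cohomology

/-! ### Linear algebra of the obstruction map. -/

section Obstruction

variable {V : Type*} [AddCommGroup V] [Module ℝ V]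

/-- If every element of `B` is congruent modulo `E` to an element of `G ≤ B`, then its class modulo
`G ⊓ E` is given by a unique linear map. -/
theorem existsUnique_obstruction {B G E : Submodule ℝ V} (h : ∀ Φ ∈ B, ∃ χ ∈ G, Φ - χ ∈ E) :
    ∃! ob : B →ₗ[ℝ] G ⧸ (G ⊓ E).submoduleOf G,
      ∀ (Φ : B) (χ : G), ob Φ = Submodule.Quotient.mk χ ↔ (Φ : V) - χ ∈ E := by
  have hmk : ∀ χ χ' : G, (Submodule.Quotient.mk χ : G ⧸ (G ⊓ E).submoduleOf G)
      = Submodule.Quotient.mk χ' ↔ (χ : V) - χ' ∈ E := by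
    intro χ χ'
    rw [Submodule.Quotient.eq]
    exact ⟨fun h => h.2, fun h => ⟨(χ - χ').2, h⟩⟩
  choose f hf using fun Φ : B => h Φ Φ.2
  set g : B → G := fun Φ => ⟨f Φ, (hf Φ).1⟩ with hg
  have hgE : ∀ Φ : B, (Φ : V) - g Φ ∈ E := fun Φ => (hf Φ).2
  refine ⟨{ toFun := fun Φ => Submodule.Quotient.mk (g Φ), map_add' := ?_, map_smul' := ?_ }, ?_, ?_⟩
  · intro Φ Φ'
    rw [← Submodule.Quotient.mk_add, hmk]
    convert E.sub_mem (E.add_mem (hgE Φ) (hgE Φ')) (hgE (Φ + Φ')) using 1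
    push_cast
    abel
  · intro c Φ
    rw [RingHom.id_apply, ← Submodule.Quotient.mk_smul, hmk]
    convert E.sub_mem (E.smul_mem c (hgE Φ)) (hgE (c • Φ)) using 1
    push_cast
    rw [smul_sub]
    abel
  · intro Φ χ
    change Submodule.Quotient.mk (g Φ) = _ ↔ _
    rw [hmk]
    have := hgE Φ
    constructor
    · intro h
      convert E.add_mem this h using 1
      abel
    · intro h
      convert E.sub_mem h this using 1
      abel
  · intro ob hob
    ext Φ
    exact (hob Φ (g Φ)).2 (hgE Φ)

end Obstruction

end IntervalExchange

end

theorem mainTheorem4 {A : Type*} [Fintype A] [DecidableEq A] [Nontrivial A]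
    (D : IntervalExchange.Data A) (hadm : D.Admissible) (hD : D.RothType)
    (r : ℕ) (hr : 1 ≤ r) :
    (∀ Φ ∈ D.BVStar r, ∃ χ ∈ D.ΓStar r, ∃ Ψ ∈ D.CLip r, Φ = χ + (Ψ ∘ D.T - Ψ)) ∧
    (∃! ob : D.BVStar r →ₗ[ℝ] D.ΓStar r ⧸ (D.ΓTPoly r).submoduleOf (D.ΓStar r),
      ∀ (Φ : D.BVStar r) (χ : D.ΓStar r), ob Φ = Submodule.Quotient.mk χ ↔
        ∃ Ψ ∈ D.CLip r, (Φ : D.Dom → ℝ) = χ + (Ψ ∘ D.T - Ψ)) ∧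
    FiniteDimensional ℝ (D.ΓTPoly r) ∧
    Module.finrank ℝ (D.ΓTPoly r) = Module.finrank ℝ D.ΓT + (r - 1) := by
  obtain ⟨n, rfl⟩ : ∃ n, r = n + 1 := ⟨r - 1, by omega⟩
  have hex : ∀ Φ ∈ D.BVStar (n + 1), ∃ χ ∈ D.ΓStar (n + 1), ∃ Ψ ∈ D.CLip (n + 1),
      Φ = χ + (Ψ ∘ D.T - Ψ) := fun Φ hΦ => by
    obtain ⟨p, -, hp, Ψ, hΨ, h⟩ := IntervalExchange.Data.exists_cohomologous hadm hD n Φ hΦ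
    exact ⟨_, hp, Ψ, hΨ, h⟩
  -- Being cohomologous is congruence modulo the image of the coboundary map, the form in which the
  -- linear algebra applies.
  have hiff : ∀ Φ χ : D.Dom → ℝ, (∃ Ψ ∈ D.CLip (n + 1), Φ = χ + (Ψ ∘ D.T - Ψ)) ↔
      Φ - χ ∈ (D.CLip (n + 1)).map D.coboundary := fun Φ χ => by
    simp only [← sub_eq_iff_eq_add']
    exact ⟨fun ⟨Ψ, h1, h2⟩ => ⟨Ψ, h1, h2.symm⟩, fun ⟨Ψ, h1, h2⟩ => ⟨Ψ, h1, h2.symm⟩⟩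
  refine ⟨hex, ?_, IntervalExchange.Data.finiteDimensional_ΓTPoly _,
    IntervalExchange.Data.finrank_ΓTPoly hadm hD n⟩
  simp only [hiff] at hex ⊢
  exact IntervalExchange.existsUnique_obstruction hex
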